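/- **Theorem 6.4 (The Riemann hypothesis as a mathematical phase transition).** *Definitions.* A fractal string $\mathcal L$ is a bounded open set $\Omega\subset\mathbb R$ which is not a finite union of intervals, i.e. which has infinitely many connected components $I_j$ $(j\ge 1)$; let $\ell_j=|I_j|$ denote their lengths. For $\varepsilon>0$ let $V(\varepsilon)$ be the Lebesgue measure of $\{x\in\Omega : d(x,\partial\Omega)<\varepsilon\}$, and for $d\ge 0$ let $$\mathcal M_d^*=\limsup_{\varepsilon\to0^+}V(\varepsilon)\,\varepsilon^{-(1-d)},\qquad \mathcal M_{*,d}=\liminf_{\varepsilon\to0^+}V(\varepsilon)\,\varepsilon^{-(1-d)}.$$ The (Minkowski) dimension of $\mathcal L$ is $D_{\mathcal L}=\inf\{d\ge0:\mathcal M_d^*<\infty\}$, and $\mathcal L$ is Minkowski measurable if $0<\mathcal M_{*,D_{\mathcal L}}=\mathcal M^*_{D_{\mathcal L}}<\infty$. The spectral counting function of $\mathcal L$ is $N_\nu(x)=\#\{(n,j): n\ge1,\ j\ge1,\ n\,\ell_j^{-1}\le x\}$ (the frequencies $n\,\ell_j^{-1}$ are counted with multiplicity), and its Weyl term is $W(x)=|\Omega|\,x$.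 For $D\in(0,1)$, the inverse spectral problem $(\mathrm{ISP})_D$ is said to be true if every fractal string $\mathcal L$ of dimension $D$ such that $$N_\nu(x)=W(x)-\mathcal C\,x^D+o(x^D)\quad\text{as }x\to+\infty$$ for some nonzero real constant $\mathcal C$ is Minkowski measurable. *Statement.* $(\mathrm{ISP})_{1/2}$ is not true. Moreover, the Riemann hypothesis holds if and only if $D=1/2$ is the only value of $D\in(0,1)$ for which $(\mathrm{ISP})_D$ fails to be true, that is, if and only if $$\{D\in(0,1) : (\mathrm{ISP})_D \text{ is not true}\}=\{1/2\}.$$ -/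

import Mathlib

open Set Filter Topology MeasureTheory Asymptotics
open scoped ENNReal

noncomputable section

/-- The open intervals of which an open subset `Ω` of the line is made, i.e. its connected
components. -/
def intervalsOf (Ω : Set ℝ) : Set (Set ℝ) :=
  {I | ∃ x ∈ Ω, I = connectedComponentIn Ω x}

/-- A (nontrivial) fractal string: a bounded open subset of the real line which is not a finite
union of intervals, i.e. which has infinitely many connected components. -/
structure FractalString where
  carrier : Set ℝ
  isOpen_carrier : IsOpen carrier
  isBounded_carrier : Bornology.IsBounded carrier
  infinite_intervals : (intervalsOf carrier).Infinite

namespace FractalString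

/-- The inner tube: the points of `Ω` at distance less than `ε` from the boundary of `Ω`. -/
def innerTube (L : FractalString) (ε : ℝ) : Set ℝ :=
  {x ∈ L.carrier | Metric.infDist x (frontier L.carrier) < ε}

/-- The volume `V(ε)` of the inner tube. -/
def tubeVolume (L : FractalString) (ε : ℝ) : ℝ≥0∞ :=
  volume (L.innerTube ε)

/-- The `d`-dimensional upper Minkowski content, with values in `[0, ∞]`. -/
def upperContent (L : FractalString) (d : ℝ) : ℝ≥0∞ :=
  limsup (fun ε : ℝ => L.tubeVolume ε / ENNReal.ofReal (ε ^ (1 - d))) (𝓝[>] 0)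

/-- The `d`-dimensional lower Minkowski content, with values in `[0, ∞]`. -/
def lowerContent (L : FractalString) (d : ℝ) : ℝ≥0∞ :=
  liminf (fun ε : ℝ => L.tubeVolume ε / ENNReal.ofReal (ε ^ (1 - d))) (𝓝[>] 0)

/-- The Minkowski dimension. The set is bounded below by `0` and contains `1`, because `Ω` has
finite length. -/
def dimension (L : FractalString) : ℝ :=
  sInf {d : ℝ | 0 ≤ d ∧ L.upperContent d < ∞}

/-- Minkowski measurability: in dimension `D` the lower and upper Minkowski contents agree, and
their common value is positive and finite. -/
def IsMinkowskiMeasurable (L : FractalString) : Prop :=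
  0 < L.lowerContent L.dimension ∧
    L.lowerContent L.dimension = L.upperContent L.dimension ∧
    L.upperContent L.dimension < ∞

/-- The spectral counting function `N_ν(x)`: the number of frequencies `n / ℓ` not exceeding `x`,
where `n ≥ 1` and `ℓ` is the length of one of the intervals `I` of the string. Multiplicities are
accounted for by counting the pairs `(n, I)`; for each `x` there are finitely many of them, because
the lengths have a finite sum. -/
def spectralCount (L : FractalString) (x : ℝ) : ℕ :=
  Set.ncard {p : ℕ × Set ℝ |
    1 ≤ p.1 ∧ p.2 ∈ intervalsOf L.carrier ∧ (p.1 : ℝ) * (volume.real p.2)⁻¹ ≤ x}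

/-- The Weyl term `W(x)`, i.e. the total length times `x`. -/
def weylTerm (L : FractalString) (x : ℝ) : ℝ :=
  volume.real L.carrier * x

/-- `N_ν(x) = W(x) - C x ^ D + o(x ^ D)` as `x → +∞`, for some nonzero real constant `C`. -/
def HasMonotonicSecondTerm (L : FractalString) (D : ℝ) : Prop :=
  ∃ C : ℝ, C ≠ 0 ∧
    (fun x : ℝ => (L.spectralCount x : ℝ) - (L.weylTerm x - C * x ^ D)) =o[atTop]
      (fun x : ℝ => x ^ D)

end FractalString

/-- The inverse spectral problem in dimension `D` has an affirmative answer: every fractal string of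
dimension `D` whose spectral counting function has an asymptotic second term proportional to `x ^ D`
is Minkowski measurable. -/
def InverseSpectralProblem (D : ℝ) : Prop :=
  ∀ L : FractalString, L.dimension = D → L.HasMonotonicSecondTerm D → L.IsMinkowskiMeasurable

end

/-! Everything is read off from the lengths ℓ_j. With x = 1/(2ε) the tube volume is V(ε) = 2ε Σ
min(ℓ_j x, 1) (`tubeVolume_eq`), while W(x) - N_ν(x) = Σ {ℓ_j x} (`weylTerm_sub_spectralCount`).
Both are multiplicative convolutions of the measure Σ δ_{ℓ_j}, with kernels whose Mellin transforms
at -s, for 0 < Re s < 1, are 1/(s(1-s)) and -ζ(s)/s (`hasMellin_min_one`, `hasMellin_fract`).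
Passing from the spectrum to the geometry in dimension D is division by ζ on the line Re s = D, so
(ISP)_D holds exactly when ζ has no zero there (`inverseSpectralProblem_iff`).

If ζ has no zero on the line, a Tauberian argument of Wiener type applies
(`exists_tendsto_tsum_min`): for a smooth compactly supported G, division by (1-s)ζ(s) keeps G in
that class, so smoothed averages of x^{-D} Σ min(ℓ_j x, 1) converge. This function is Lipschitz in
log x, which removes the smoothing.

If ζ(D + iτ) = 0, lengths are chosen whose counting function is x^D (1 + β cos(τ log x)) up to a
bounded error. In Σ {ℓ_j x} the oscillating term is multiplied by ζ(D + iτ) and disappears; in Σ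
min(ℓ_j x, 1) it survives, so the string is not Minkowski measurable
(`exists_lengths_of_riemannZeta_eq_zero`).

The failure at D = 1/2 then needs one zero on the critical line
(`exists_riemannZeta_eq_zero_on_critical_line`). The Mellin transform of theta along the ray of
e^{iβ} expresses exponential moments of Λ(1/2 + it) through theta near the cusps ±1, where theta is
tiny. The resulting behaviour as β tends to π/2 is incompatible with a constant sign of Λ on the
line. The equivalence with the Riemann hypothesis follows because all nontrivial zeros lie in the
open strip. -/

/-! ### The zeta function in the critical strip and the fractional part -/

/-- The fractional part, cut off below `1`. -/
noncomputable def fractTail : ℝ → ℂ := (Ioi (1 : ℝ)).indicator fun t => ((Int.fract t : ℝ) : ℂ)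

lemma norm_fractTail_le (t : ℝ) : ‖fractTail t‖ ≤ 1 := by
  unfold fractTail
  refine (norm_indicator_le_norm_self _ _).trans ?_
  simp only [Complex.norm_real, Real.norm_eq_abs, Int.abs_fract]
  exact (Int.fract_lt_one t).le

lemma measurable_fractTail : Measurable fractTail :=
  (Complex.measurable_ofReal.comp measurable_fract).indicator measurableSet_Ioi

lemma locallyIntegrableOn_fractTail : LocallyIntegrableOn fractTail (Ioi 0) := by
  refine LocallyIntegrable.locallyIntegrableOn ?_ _
  refine (locallyIntegrable_const (1 : ℝ)).mono measurable_fractTail.aestronglyMeasurable ?_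
  exact Eventually.of_forall fun t => by simpa using norm_fractTail_le t

lemma fractTail_isBigO_atTop : fractTail =O[atTop] fun x : ℝ => x ^ (-(0 : ℝ)) := by
  refine IsBigO.of_bound 1 (Eventually.of_forall fun t => ?_)
  simpa using norm_fractTail_le t

lemma fractTail_isBigO_zero (b : ℝ) : fractTail =O[𝓝[>] 0] fun x : ℝ => x ^ (-b) := by
  refine IsBigO.of_bound 1 ?_
  filter_upwards [mem_nhdsWithin_of_mem_nhds (Iio_mem_nhds (zero_lt_one (α := ℝ)))] with t ht
  have : fractTail t = 0 := indicator_of_notMem (by simpa using le_of_lt ht) _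
  rw [this, norm_zero]
  positivity

lemma mellinConvergent_fractTail {s : ℂ} (hs : 0 < s.re) : MellinConvergent fractTail (-s) :=
  mellinConvergent_of_isBigO_rpow locallyIntegrableOn_fractTail fractTail_isBigO_atTop
    (by simpa using hs) (fractTail_isBigO_zero (-s.re - 1)) (by simp)

lemma differentiableAt_mellin_fractTail {s : ℂ} (hs : 0 < s.re) :
    DifferentiableAt ℂ (fun s => mellin fractTail (-s)) s := by
  have : DifferentiableAt ℂ (mellin fractTail) (-s) :=
    mellin_differentiableAt_of_isBigO_rpow locallyIntegrableOn_fractTail fractTail_isBigO_atTop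
      (by simpa using hs) (fractTail_isBigO_zero (-s.re - 1)) (by simp)
  exact this.comp s (differentiableAt_id.neg)

/-- Summation of `∑ n⁻ˢ` by parts. -/
lemma sum_cpow_neg_eq {s : ℂ} (hs : s ≠ 1) {m : ℕ} (hm : 1 ≤ m) :
    ∑ k ∈ Finset.Icc 1 m, (k : ℂ) ^ (-s) = (m : ℂ) ^ (1 - s) / (1 - s) + s / (s - 1)
      - s * ∫ t in Ioc (1 : ℝ) m, (t : ℂ) ^ (-s - 1) * fractTail t := by
  have hm' : (1 : ℝ) ≤ m := by exact_mod_cast hm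
  have hm0 : (m : ℂ) ≠ 0 := by exact_mod_cast (by omega : m ≠ 0)
  have hderiv : ∀ t : ℝ, 0 < t →
      HasDerivAt (fun t : ℝ => (t : ℂ) ^ (-s)) (-s * (t : ℂ) ^ (-s - 1)) t := by
    intro t ht
    exact ((hasDerivAt_id (t : ℂ)).cpow_const (Or.inl (by simpa using ht))).comp_ofReal.congr_deriv
      (by simp)
  have hcont : ∀ a : ℂ, ContinuousOn (fun t : ℝ => (t : ℂ) ^ a) (Icc (1 : ℝ) m) := fun a t ht =>
    (Complex.continuousAt_ofReal_cpow_const t a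
      (Or.inr (by linarith [ht.1] : t ≠ 0))).continuousWithinAt
  have hdint : IntegrableOn (deriv fun t : ℝ => (t : ℂ) ^ (-s)) (Icc (1 : ℝ) m) := by
    refine IntegrableOn.congr_fun (Integrable.const_mul (hcont (-s - 1)).integrableOn_Icc (-s))
      (fun t ht => ?_) measurableSet_Icc
    exact ((hderiv t (by linarith [ht.1])).deriv).symm
  -- The coefficient at 0 is set to 0, so the value of `0 ^ (-s)` plays no role and the integral can
  -- start at 1.
  let c : ℕ → ℂ := fun k => if k = 0 then 0 else 1
  have hc : ∀ n : ℕ, ∑ k ∈ Finset.Icc 0 n, c k = n := by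
    intro n
    induction n with
    | zero => simp [c]
    | succ n ih => rw [Finset.sum_Icc_succ_top (by omega), ih]; simp [c]
  have key := sum_mul_eq_sub_integral_mul₀' (f := fun t : ℝ => (t : ℂ) ^ (-s)) c (by simp [c]) m
    (fun t ht => (hderiv t (by linarith [ht.1])).differentiableAt) hdint
  have hL : ∑ k ∈ Finset.Icc 0 m, ((k : ℝ) : ℂ) ^ (-s) * c k
      = ∑ k ∈ Finset.Icc 1 m, (k : ℂ) ^ (-s) := by
    symm
    refine Finset.sum_subset_zero_on_sdiff (fun k hk => ?_) (fun k hk => ?_) (fun k hk => ?_)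
    · simp at hk ⊢; omega
    · have : k = 0 := by simp at hk; omega
      simp [this, c]
    · have : k ≠ 0 := by simp at hk; omega
      simp [c, this]
  rw [hL] at key
  rw [key, hc]
  have hI : ∫ t in Ioc (1 : ℝ) m, deriv (fun t : ℝ => (t : ℂ) ^ (-s)) t *
        ∑ k ∈ Finset.Icc 0 ⌊t⌋₊, c k
      = ∫ t in Ioc (1 : ℝ) m, (-s * (t : ℂ) ^ (-s) + s * ((t : ℂ) ^ (-s - 1) * fractTail t)) := by
    refine setIntegral_congr_fun measurableSet_Ioc fun t ht => ?_
    have ht0 : 0 < t := by linarith [ht.1]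
    have ht0' : (t : ℂ) ≠ 0 := by exact_mod_cast ht0.ne'
    have hfl : ((⌊t⌋₊ : ℕ) : ℂ) = (t : ℂ) - fractTail t := by
      have h1 : fractTail t = ((Int.fract t : ℝ) : ℂ) := indicator_of_mem ht.1 _
      rw [h1, ← Complex.ofReal_sub, Int.self_sub_fract]
      rw [← natCast_floor_eq_intCast_floor ht0.le]
      simp
    simp only [(hderiv t ht0).deriv, hc, hfl]
    have : (t : ℂ) ^ (-s) = (t : ℂ) ^ (-s - 1) * t := by
      rw [Complex.cpow_sub _ _ ht0', Complex.cpow_one]; field_simp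
    rw [this]; ring
  have hi1 : IntegrableOn (fun t : ℝ => -s * (t : ℂ) ^ (-s)) (Ioc (1 : ℝ) m) :=
    Integrable.const_mul ((hcont (-s)).integrableOn_Icc.mono_set Ioc_subset_Icc_self) (-s)
  have hi2 : IntegrableOn (fun t : ℝ => s * ((t : ℂ) ^ (-s - 1) * fractTail t)) (Ioc (1 : ℝ) m) := by
    refine (Integrable.mul_bdd (c := 1) ?_ measurable_fractTail.aestronglyMeasurable
      (Eventually.of_forall norm_fractTail_le)).const_mul s
    exact ((hcont (-s - 1)).integrableOn_Icc).mono_set Ioc_subset_Icc_self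
  have hp : ∫ t in Ioc (1 : ℝ) m, (t : ℂ) ^ (-s) = ((m : ℂ) ^ (1 - s) - 1) / (1 - s) := by
    rw [← intervalIntegral.integral_of_le hm', integral_cpow]
    · simp [show -s + 1 = 1 - s by ring]
    · right
      refine ⟨fun h => hs (by linear_combination -h), ?_⟩
      rw [uIcc_of_le hm']
      intro h; linarith [h.1]
  rw [hI, integral_add hi1 hi2, integral_const_mul, integral_const_mul, hp]
  have h1 : (1 : ℂ) - s ≠ 0 := sub_ne_zero.mpr (Ne.symm hs)
  have h2 : s - 1 ≠ 0 := sub_ne_zero.mpr hs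
  have h3 : (m : ℂ) ^ (1 - s) = (m : ℂ) ^ (-s) * m := by
    rw [sub_eq_add_neg, Complex.cpow_add _ _ hm0, Complex.cpow_one]; ring
  push_cast
  rw [h3]
  have h4 : (m : ℂ) ^ (-s) * m * (1 - s) - (-s * (m ^ (-s) * m - 1)) = m ^ (-s) * m - s := by ring
  have h5 : s / (s - 1) = -(s / (1 - s)) := by rw [← neg_sub, div_neg]
  rw [h5]
  field_simp
  ring

lemma tendsto_integral_fractTail {s : ℂ} (hs : 0 < s.re) :
    Tendsto (fun m : ℕ => ∫ t in Ioc (1 : ℝ) m, (t : ℂ) ^ (-s - 1) * fractTail t) atTop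
      (𝓝 (mellin fractTail (-s))) := by
  have hI : IntegrableOn (fun t : ℝ => (t : ℂ) ^ (-s - 1) * fractTail t) (Ioi 0) := by
    simpa [MellinConvergent] using mellinConvergent_fractTail hs
  have hI1 := hI.mono_set (Ioi_subset_Ioi (zero_le_one (α := ℝ)))
  have := intervalIntegral_tendsto_integral_Ioi 1 hI1 tendsto_natCast_atTop_atTop
  have e : mellin fractTail (-s) = ∫ t in Ioi (1 : ℝ), (t : ℂ) ^ (-s - 1) * fractTail t := by
    simp only [mellin, smul_eq_mul]
    rw [← Ioc_union_Ioi_eq_Ioi (zero_le_one (α := ℝ)), setIntegral_union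
      (Ioc_disjoint_Ioi le_rfl) measurableSet_Ioi (hI.mono_set Ioc_subset_Ioi_self) hI1]
    rw [setIntegral_eq_zero_of_forall_eq_zero, zero_add]
    intro t ht
    rw [fractTail, indicator_of_notMem (by simpa using ht.2), mul_zero]
  rw [e]
  refine this.congr' ?_
  filter_upwards [eventually_ge_atTop 1] with m hm
  rw [intervalIntegral.integral_of_le (by exact_mod_cast hm)]

lemma tendsto_sum_cpow_sub {s : ℂ} (hs : 0 < s.re) (hs1 : s ≠ 1) :
    Tendsto (fun m : ℕ => ∑ k ∈ Finset.Icc 1 m, (k : ℂ) ^ (-s) - (m : ℂ) ^ (1 - s) / (1 - s)) atTop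
      (𝓝 (s / (s - 1) - s * mellin fractTail (-s))) := by
  refine ((tendsto_integral_fractTail hs).const_mul s |>.const_sub _).congr' ?_
  filter_upwards [eventually_ge_atTop 1] with m hm
  rw [sum_cpow_neg_eq hs1 hm]
  ring

/-- Here the correction m^{1-s}/(1-s) tends to 0, so the limit of the corrected sums is the
Dirichlet series. This identifies the limit on an open set, from which it is continued. -/
lemma riemannZeta_eq_of_one_lt_re {s : ℂ} (hs : 1 < s.re) :
    riemannZeta s = s / (s - 1) - s * mellin fractTail (-s) := by
  have hs1 : s ≠ 1 := by rintro rfl; simp at hs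
  have h1 := tendsto_sum_cpow_sub (by linarith) hs1
  have h2 : Tendsto (fun m : ℕ => (m : ℂ) ^ (1 - s) / (1 - s)) atTop (𝓝 0) := by
    have : Tendsto (fun m : ℕ => (m : ℂ) ^ (1 - s)) atTop (𝓝 0) := by
      rw [tendsto_zero_iff_norm_tendsto_zero]
      have h3 : Tendsto (fun m : ℕ => (m : ℝ) ^ (-(s.re - 1))) atTop (𝓝 0) :=
        (tendsto_rpow_neg_atTop (by linarith)).comp tendsto_natCast_atTop_atTop
      refine h3.congr' ?_
      filter_upwards [eventually_gt_atTop 0] with m hm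
      rw [Complex.norm_natCast_cpow_of_pos hm]; simp
    simpa using this.div_const (1 - s)
  have h3 : Tendsto (fun m : ℕ => ∑ k ∈ Finset.Icc 1 m, (k : ℂ) ^ (-s)) atTop
      (𝓝 (riemannZeta s)) := by
    rw [zeta_eq_tsum_one_div_nat_add_one_cpow hs]
    have hsum : Summable fun n : ℕ => 1 / ((n : ℂ) + 1) ^ s := by
      have := (summable_nat_add_iff 1).mpr (Complex.summable_one_div_nat_cpow.mpr hs)
      simpa using this
    refine hsum.hasSum.tendsto_sum_nat.congr fun m => ?_
    have := Finset.sum_Ico_add' (fun k : ℕ => (k : ℂ) ^ (-s)) 0 m 1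
    rw [zero_add, ← Finset.range_eq_Ico] at this
    rw [show Finset.Icc 1 m = Finset.Ico 1 (m + 1) from rfl, ← this]
    simp [Complex.cpow_neg]
  have h4 := h1.add h2
  simp only [sub_add_cancel, add_zero] at h4
  exact tendsto_nhds_unique h3 h4

/-- The classical continuation of the zeta function to the right half-plane. -/
theorem riemannZeta_eq_sub_mellin_fractTail {s : ℂ} (hs : 0 < s.re) (hs1 : s ≠ 1) :
    riemannZeta s = s / (s - 1) - s * mellin fractTail (-s) := by
  let U : Set ℂ := {s | 0 < s.re}
  have hU : IsOpen U := isOpen_lt continuous_const Complex.continuous_re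
  have hUc : IsPreconnected U := (convex_halfSpace_re_gt 0).isPreconnected
  -- Multiplying by s - 1 removes the pole, so the identity theorem applies on the whole half-plane.
  have hf : AnalyticOnNhd ℂ riemannZeta₁ U :=
    (differentiable_riemannZeta₁.differentiableOn).analyticOnNhd hU
  have hg : AnalyticOnNhd ℂ (fun s => s - s * (s - 1) * mellin fractTail (-s)) U := by
    refine DifferentiableOn.analyticOnNhd (fun s hs => ?_) hU
    have := differentiableAt_mellin_fractTail hs
    exact DifferentiableAt.differentiableWithinAt (by fun_prop)
  have key := hf.eqOn_of_preconnected_of_eventuallyEq hg hUc (z₀ := 2) (by simp [U]) ?_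
  · have := key hs
    have h1 : s - 1 ≠ 0 := sub_ne_zero.mpr hs1
    rw [riemannZeta_eq_inv_sub_mul hs1, this]
    field_simp
  · have : {s : ℂ | 1 < s.re} ∈ 𝓝 (2 : ℂ) :=
      (isOpen_lt continuous_const Complex.continuous_re).mem_nhds (by simp)
    filter_upwards [this] with z hz
    have hz1 : z ≠ 1 := by rintro rfl; simp at hz
    have h1 : z - 1 ≠ 0 := sub_ne_zero.mpr hz1
    have h2 := riemannZeta_eq_of_one_lt_re hz
    rw [riemannZeta_eq_inv_sub_mul hz1] at h2
    field_simp at h2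
    rw [h2]; ring

/-- The partial sums of `∑ n⁻ˢ`, corrected by the integral, converge to `ζ(s)` for `Re s > 0`. -/
theorem tendsto_sum_cpow_sub_riemannZeta {s : ℂ} (hs : 0 < s.re) (hs1 : s ≠ 1) :
    Tendsto (fun m : ℕ => ∑ k ∈ Finset.Icc 1 m, (k : ℂ) ^ (-s) - (m : ℂ) ^ (1 - s) / (1 - s)) atTop
      (𝓝 (riemannZeta s)) := by
  rw [riemannZeta_eq_sub_mellin_fractTail hs hs1]
  exact tendsto_sum_cpow_sub hs hs1

/-- The Mellin transform of the fractional part in the strip `-1 < Re < 0`. -/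
theorem hasMellin_fract {s : ℂ} (hs : 0 < s.re) (hs1 : s.re < 1) :
    HasMellin (fun t : ℝ => ((Int.fract t : ℝ) : ℂ)) (-s) (-riemannZeta s / s) := by
  have hne : s ≠ 1 := by rintro rfl; simp at hs1
  have hs0 : s ≠ 0 := by rintro rfl; simp at hs
  have h1 := hasMellin_cpow_Ioc 1 (s := -s) (by simpa using hs1)
  have h2 := hasMellin_add h1.1 (mellinConvergent_fractTail hs)
  -- The decomposition fails at t = 1, where the left side is 1 and the fractional part is 0; hence
  -- only almost everywhere.
  have he : ∀ᵐ t : ℝ ∂(volume.restrict (Ioi 0)),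
      (Ioc (0 : ℝ) 1).indicator (fun t : ℝ => (t : ℂ) ^ (1 : ℂ)) t + fractTail t
        = ((Int.fract t : ℝ) : ℂ) := by
    have h1ne : ∀ᵐ t : ℝ ∂(volume.restrict (Ioi 0)), t ≠ 1 :=
      ae_restrict_of_ae (by simp [ae_iff])
    filter_upwards [h1ne, ae_restrict_mem measurableSet_Ioi] with t ht ht0
    rcases lt_or_gt_of_ne ht with h | h
    · rw [indicator_of_mem (show t ∈ Ioc (0 : ℝ) 1 from ⟨ht0, h.le⟩), fractTail,
        indicator_of_notMem (by simpa using h.le), Int.fract_eq_self.mpr ⟨le_of_lt ht0, h⟩]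
      simp
    · rw [indicator_of_notMem (by simp [h]), fractTail, indicator_of_mem (by simpa using h)]
      simp
  have he' : ∀ᵐ t : ℝ ∂(volume.restrict (Ioi 0)),
      (t : ℂ) ^ (-s - 1) • ((Ioc (0 : ℝ) 1).indicator (fun t : ℝ => (t : ℂ) ^ (1 : ℂ)) t
        + fractTail t) = (t : ℂ) ^ (-s - 1) • ((Int.fract t : ℝ) : ℂ) := by
    filter_upwards [he] with t ht
    rw [ht]
  refine ⟨(integrable_congr he').mp h2.1, ?_⟩
  have : mellin (fun t : ℝ => ((Int.fract t : ℝ) : ℂ)) (-s) = _ := (integral_congr_ae he').symm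
  rw [this]
  refine h2.2.trans ?_
  rw [h1.2, riemannZeta_eq_sub_mellin_fractTail hs hne]
  have h3 : s - 1 ≠ 0 := sub_ne_zero.mpr hne
  have h4 : -s + 1 ≠ 0 := fun h => h3 (by linear_combination -h)
  field_simp
  ring

lemma integral_rpow_mul_fract_pos {D : ℝ} (hD : 0 < D) (hD1 : D < 1) :
    0 < ∫ t in Ioi (0 : ℝ), t ^ (-D - 1) * Int.fract t := by
  have hI : IntegrableOn (fun t : ℝ => t ^ (-D - 1) * Int.fract t) (Ioi 0) := by
    have := (hasMellin_fract (s := D) (by simpa) (by simpa)).1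
    have h2 := this.norm
    refine h2.congr ?_
    filter_upwards [ae_restrict_mem measurableSet_Ioi] with t ht
    have ht' : 0 < t := ht
    rw [norm_smul, Complex.norm_cpow_eq_rpow_re_of_pos ht']
    simp
  rw [setIntegral_pos_iff_support_of_nonneg_ae]
  · refine lt_of_lt_of_le ?_ (measure_mono (s := Ioo (0 : ℝ) 1) ?_)
    · simp
    · intro t ht
      refine ⟨?_, ht.1⟩
      simp only [Function.mem_support]
      rw [Int.fract_eq_self.mpr ⟨ht.1.le, ht.2⟩]
      have := ht.1
      positivity
  · filter_upwards [ae_restrict_mem measurableSet_Ioi] with t ht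
    have ht' : 0 < t := ht
    have := Int.fract_nonneg t
    simp only [Pi.zero_apply]
    positivity
  · exact hI

/-- The zeta function is real and negative on the interval `(0, 1)`. -/
theorem exists_riemannZeta_eq_neg {D : ℝ} (hD : 0 < D) (hD1 : D < 1) :
    ∃ z : ℝ, 0 < z ∧ riemannZeta D = -(z : ℂ) := by
  refine ⟨D * ∫ t in Ioi (0 : ℝ), t ^ (-D - 1) * Int.fract t,
    mul_pos hD (integral_rpow_mul_fract_pos hD hD1), ?_⟩
  have h := (hasMellin_fract (s := D) (by simpa) (by simpa)).2
  have h2 : mellin (fun t : ℝ => ((Int.fract t : ℝ) : ℂ)) (-(D : ℂ))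
      = ((∫ t in Ioi (0 : ℝ), t ^ (-D - 1) * Int.fract t : ℝ) : ℂ) := by
    rw [← integral_complex_ofReal]
    refine setIntegral_congr_fun measurableSet_Ioi fun t ht => ?_
    have ht' : 0 < t := ht
    simp [Complex.ofReal_cpow ht'.le]
  rw [h2] at h
  have hD0 : (D : ℂ) ≠ 0 := by exact_mod_cast hD.ne'
  field_simp at h
  push_cast
  linear_combination h

/-! ### The theta function on a ray -/

lemma integrableOn_rpow_mul_exp_neg_mul {σ r : ℝ} (hσ : 0 < σ) (hr : 0 < r) :
    IntegrableOn (fun t : ℝ => t ^ (σ - 1) * Real.exp (-(r * t))) (Ioi 0) := by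
  have := integrableOn_rpow_mul_exp_neg_mul_rpow (p := 1) (s := σ - 1) (by linarith) zero_lt_one hr
  simpa using this

lemma norm_cpow_mul_exp {σ t : ℝ} (ht : 0 < t) (z : ℂ) :
    ‖(t : ℂ) ^ ((σ : ℂ) - 1) * Complex.exp (-(z * t))‖ = t ^ (σ - 1) * Real.exp (-(z.re * t)) := by
  rw [norm_mul, Complex.norm_cpow_eq_rpow_re_of_pos ht, Complex.norm_exp]
  simp

lemma integrableOn_cpow_mul_exp_neg_mul {σ : ℝ} (hσ : 0 < σ) {z : ℂ} (hz : 0 < z.re) :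
    IntegrableOn (fun t : ℝ => (t : ℂ) ^ ((σ : ℂ) - 1) * Complex.exp (-(z * t))) (Ioi 0) := by
  refine (integrableOn_rpow_mul_exp_neg_mul hσ hz).mono' ?_ ?_
  · refine ContinuousOn.aestronglyMeasurable (fun t ht => ?_) measurableSet_Ioi
    refine ContinuousAt.continuousWithinAt ?_
    have ht0 : t ≠ 0 := ne_of_gt ht
    exact (Complex.continuousAt_ofReal_cpow_const t _ (Or.inr ht0)).mul (by fun_prop)
  · filter_upwards [ae_restrict_mem measurableSet_Ioi] with t ht
    exact (norm_cpow_mul_exp ht z).le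

lemma differentiableOn_integral_cpow_mul_exp {σ : ℝ} (hσ : 0 < σ) :
    DifferentiableOn ℂ (fun z : ℂ => ∫ t in Ioi (0 : ℝ),
      (t : ℂ) ^ ((σ : ℂ) - 1) * Complex.exp (-(z * t))) {z | 0 < z.re} := by
  intro z hz
  have hz' : 0 < z.re := hz
  have hs : {w : ℂ | z.re / 2 < w.re} ∈ 𝓝 z :=
    (isOpen_lt continuous_const Complex.continuous_re).mem_nhds (by simpa using half_lt_self hz')
  have hmeas : ∀ w : ℂ, 0 < w.re → AEStronglyMeasurable (fun t : ℝ => (t : ℂ) ^ ((σ : ℂ) - 1) *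
      Complex.exp (-(w * t))) (volume.restrict (Ioi 0)) := fun w hw =>
    (integrableOn_cpow_mul_exp_neg_mul hσ hw).aestronglyMeasurable
  refine DifferentiableAt.differentiableWithinAt ?_
  refine (hasDerivAt_integral_of_dominated_loc_of_deriv_le (s := {w : ℂ | z.re / 2 < w.re})
    (μ := volume.restrict (Ioi (0 : ℝ)))
    (F := fun w t => (t : ℂ) ^ ((σ : ℂ) - 1) * Complex.exp (-(w * t)))
    (F' := fun w t => -((t : ℂ) * ((t : ℂ) ^ ((σ : ℂ) - 1) * Complex.exp (-(w * t)))))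
    -- Differentiation in w costs one factor t, which raises the exponent by one; the real part
    -- stays above half of its value at z.
    (bound := fun t => t ^ (σ + 1 - 1) * Real.exp (-(z.re / 2 * t))) hs ?_
    (integrableOn_cpow_mul_exp_neg_mul hσ hz') ?_ ?_
    (integrableOn_rpow_mul_exp_neg_mul (by linarith) (by linarith)) ?_).2.differentiableAt
  · filter_upwards [hs] with w hw
    exact hmeas w (lt_trans (by linarith) hw)
  · exact ((Complex.continuous_ofReal.aestronglyMeasurable).mul (hmeas z hz')).neg
  · filter_upwards [ae_restrict_mem measurableSet_Ioi] with t ht w hw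
    have ht' : 0 < t := ht
    have hw' : z.re / 2 < w.re := hw
    rw [norm_neg, norm_mul, norm_cpow_mul_exp ht', Complex.norm_real, Real.norm_of_nonneg ht'.le,
      ← mul_assoc]
    have : t ^ (σ + 1 - 1) = t * t ^ (σ - 1) := by
      rw [mul_comm, ← Real.rpow_add_one ht'.ne']; ring_nf
    rw [this]
    gcongr
  · filter_upwards with t w hw
    have h1 : HasDerivAt (fun w : ℂ => Complex.exp (-(w * t))) (Complex.exp (-(w * t)) * -(1 * t)) w :=
      (((hasDerivAt_id w).mul_const (t : ℂ)).neg).cexp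
    exact (h1.const_mul _).congr_deriv (by ring)

/-- Euler's integral for the Gamma function along a ray in the right half-plane. -/
lemma integral_cpow_mul_exp_neg_mul_of_re_pos {σ : ℝ} (hσ : 0 < σ) {z : ℂ} (hz : 0 < z.re) :
    ∫ t in Ioi (0 : ℝ), (t : ℂ) ^ ((σ : ℂ) - 1) * Complex.exp (-(z * t))
      = z ^ (-(σ : ℂ)) * Complex.Gamma σ := by
  let U : Set ℂ := {z | 0 < z.re}
  have hU : IsOpen U := isOpen_lt continuous_const Complex.continuous_re
  have hf := (differentiableOn_integral_cpow_mul_exp hσ).analyticOnNhd hU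
  have hg : AnalyticOnNhd ℂ (fun z : ℂ => z ^ (-(σ : ℂ)) * Complex.Gamma σ) U := by
    refine DifferentiableOn.analyticOnNhd (fun w hw => ?_) hU
    have : w ∈ Complex.slitPlane := Or.inl hw
    exact DifferentiableAt.differentiableWithinAt (by fun_prop (disch := assumption))
  -- The formula is known for real z, and the reals just above 1 accumulate at 1.
  refine hf.eqOn_of_preconnected_of_frequently_eq hg (convex_halfSpace_re_gt 0).isPreconnected
    (z₀ := 1) (by simp) ?_ hz
  have hmap : Tendsto (fun x : ℝ => (x : ℂ)) (𝓝[>] 1) (𝓝[≠] 1) := by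
    refine tendsto_nhdsWithin_iff.mpr ⟨?_, ?_⟩
    · exact (Complex.continuous_ofReal.tendsto 1).mono_left nhdsWithin_le_nhds
    · filter_upwards [self_mem_nhdsWithin] with x hx
      simpa using (ne_of_gt hx : x ≠ 1)
  refine hmap.frequently (Eventually.frequently ?_)
  filter_upwards [self_mem_nhdsWithin] with x hx
  have hx0 : (0 : ℝ) < x := lt_trans zero_lt_one hx
  have h := Complex.integral_cpow_mul_exp_neg_mul_Ioi (a := σ) (r := x) (by simpa) hx0
  rw [h, one_div, Complex.inv_cpow _ _ (by rw [Complex.arg_ofReal_of_nonneg hx0.le]; exact Real.pi_pos.ne), Complex.cpow_neg]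

/-- The theta function `∑ exp (-π n² z x)` along the ray spanned by `z`. -/
noncomputable def rayTheta (z : ℂ) (x : ℝ) : ℂ := jacobiTheta (Complex.I * (z * x))

lemma im_I_mul_mul (z : ℂ) (x : ℝ) : (Complex.I * (z * x)).im = z.re * x := by simp

lemma hasSum_rayTheta {z : ℂ} (hz : 0 < z.re) {x : ℝ} (hx : 0 < x) :
    HasSum (fun n : ℕ => 2 * Complex.exp (-(z * ((Real.pi * (n + 1) ^ 2 : ℝ) * x : ℝ))))
      (rayTheta z x - 1) := by
  have h := hasSum_nat_jacobiTheta (τ := Complex.I * (z * x))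
    (by rw [im_I_mul_mul]; exact mul_pos hz hx)
  have h2 := h.mul_left 2
  rw [mul_div_cancel₀ _ (two_ne_zero' ℂ)] at h2
  have he : (fun n : ℕ => 2 * Complex.exp (-(z * ((Real.pi * (n + 1) ^ 2 : ℝ) * x : ℝ))))
      = fun n : ℕ => 2 * Complex.exp (Real.pi * Complex.I * ((n : ℂ) + 1) ^ 2 *
        (Complex.I * (z * x))) := by
    funext n
    congr 2
    push_cast
    linear_combination (-(Real.pi : ℂ) * ((n : ℂ) + 1) ^ 2 * z * x) * Complex.I_mul_I
  rw [he]
  exact h2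

lemma mellin_exp_neg_mul {σ : ℝ} (hσ : 0 < σ) {z : ℂ} (hz : 0 < z.re) {r : ℝ} (hr : 0 < r) :
    ∫ t in Ioi (0 : ℝ), (t : ℂ) ^ ((σ : ℂ) - 1) * Complex.exp (-(z * (r * t : ℝ)))
      = (r : ℂ) ^ (-(σ : ℂ)) * (z ^ (-(σ : ℂ)) * Complex.Gamma σ) := by
  have := mellin_comp_mul_left (fun t : ℝ => Complex.exp (-(z * t))) σ hr
  simp only [mellin, smul_eq_mul] at this
  rw [this, integral_cpow_mul_exp_neg_mul_of_re_pos hσ hz]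

/-- Termwise integration; σ > 1/2 is what makes Σ (π n²)^{-σ} converge. In each term z occurs only
through the factor z^{-σ}. -/
lemma hasSum_mellin_rayTheta {z : ℂ} (hz : 0 < z.re) {σ : ℝ} (hσ : 1 / 2 < σ) :
    HasSum (fun n : ℕ => 2 * (((Real.pi * (n + 1) ^ 2 : ℝ) : ℂ) ^ (-(σ : ℂ)) *
      (z ^ (-(σ : ℂ)) * Complex.Gamma σ))) (mellin (fun x => rayTheta z x - 1) σ) := by
  have hσ0 : 0 < σ := by linarith
  let r : ℕ → ℝ := fun n => Real.pi * (n + 1) ^ 2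
  have hr : ∀ n, 0 < r n := fun n => by have := Real.pi_pos; positivity
  let F : ℕ → ℝ → ℂ := fun n t =>
    (t : ℂ) ^ ((σ : ℂ) - 1) * (2 * Complex.exp (-(z * (r n * t : ℝ))))
  have hFeq : ∀ n t, F n t = 2 * ((t : ℂ) ^ ((σ : ℂ) - 1) * Complex.exp (-((z * r n) * t))) := by
    intro n t
    simp only [F]
    push_cast
    ring_nf
  have hre : ∀ n, 0 < (z * r n).re := fun n => by simpa using mul_pos hz (hr n)
  have hint : ∀ n, Integrable (F n) (volume.restrict (Ioi 0)) := fun n => by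
    rw [show F n = _ from funext (hFeq n)]
    exact (integrableOn_cpow_mul_exp_neg_mul hσ0 (hre n)).const_mul 2
  have hnorm : ∀ n, ∫ t in Ioi (0 : ℝ), ‖F n t‖
      = (r n) ^ (-σ) * (2 * (z.re ^ (-σ) * Real.Gamma σ)) := by
    intro n
    have : ∫ t in Ioi (0 : ℝ), ‖F n t‖
        = ∫ t in Ioi (0 : ℝ), 2 * (t ^ (σ - 1) * Real.exp (-((z.re * r n) * t))) := by
      refine setIntegral_congr_fun measurableSet_Ioi fun t ht => ?_
      simp only [hFeq]
      rw [norm_mul, norm_cpow_mul_exp ht]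
      simp
    rw [this, integral_const_mul, Real.integral_rpow_mul_exp_neg_mul_Ioi hσ0 (mul_pos hz (hr n)),
      one_div, Real.inv_rpow (mul_pos hz (hr n)).le, ← Real.rpow_neg (mul_pos hz (hr n)).le,
      Real.mul_rpow hz.le (hr n).le]
    ring
  have hsummable : Summable fun n : ℕ => (r n) ^ (-σ) := by
    have h1 : Summable fun n : ℕ => ((n + 1 : ℕ) : ℝ) ^ (-(2 * σ)) :=
      (summable_nat_add_iff 1).mpr (Real.summable_nat_rpow.mpr (by linarith))
    refine (h1.mul_left (Real.pi ^ (-σ))).congr fun n => ?_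
    simp only [r]
    rw [Real.mul_rpow Real.pi_pos.le (by positivity), ← Real.rpow_natCast, ← Real.rpow_mul (by positivity)]
    push_cast
    ring_nf
  have key := hasSum_integral_of_summable_integral_norm hint
    ((hsummable.mul_right _).congr fun n => (hnorm n).symm)
  have e1 : ∫ t in Ioi (0 : ℝ), ∑' n, F n t = mellin (fun x => rayTheta z x - 1) σ := by
    refine setIntegral_congr_fun measurableSet_Ioi fun t ht => ?_
    exact ((hasSum_rayTheta hz ht).mul_left _).tsum_eq
  rw [e1] at key
  convert! key using 2 with n
  rw [← mellin_exp_neg_mul hσ0 hz (hr n), ← integral_const_mul]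
  refine integral_congr_ae (Eventually.of_forall fun t => ?_)
  simp only [F]
  ring

lemma mellin_rayTheta {z : ℂ} (hz : 0 < z.re) {σ : ℝ} (hσ : 1 / 2 < σ) :
    mellin (fun x => rayTheta z x - 1) σ
      = z ^ (-(σ : ℂ)) * mellin (fun x => rayTheta 1 x - 1) σ := by
  have h1 := hasSum_mellin_rayTheta (z := 1) (by simp) hσ
  have h2 := hasSum_mellin_rayTheta hz hσ
  refine h2.unique ?_
  convert! h1.mul_left (z ^ (-(σ : ℂ))) using 2 with n
  rw [Complex.one_cpow]
  ring

lemma rayTheta_one_div {z : ℂ} (hz : 0 < z.re) {x : ℝ} (hx : 0 < x) :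
    rayTheta z (1 / x) = (z ^ (-(1 / 2) : ℂ) * ((x ^ (1 / 2 : ℝ) : ℝ) : ℂ)) * rayTheta z⁻¹ x := by
  have hz0 : z ≠ 0 := by rintro rfl; simp at hz
  have hx0 : (x : ℂ) ≠ 0 := by exact_mod_cast hx.ne'
  unfold rayTheta
  rw [jacobiTheta_eq_jacobiTheta₂, jacobiTheta₂_functional_equation, jacobiTheta_eq_jacobiTheta₂]
  have e1 : -1 / (Complex.I * (z * ((1 / x : ℝ) : ℂ))) = Complex.I * (z⁻¹ * x) := by
    push_cast
    have := Complex.I_mul_I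
    field_simp
    linear_combination -Complex.I_sq
  have e2 : -Complex.I * (Complex.I * (z * ((1 / x : ℝ) : ℂ))) = ((x⁻¹ : ℝ) : ℂ) * z := by
    push_cast
    linear_combination (-z * (1 / x)) * Complex.I_mul_I
  rw [e1, e2, Complex.real_smul.symm]
  have e3 : (x⁻¹ • z) ^ (1 / 2 : ℂ) = ((x⁻¹ : ℝ) : ℂ) ^ (1 / 2 : ℂ) * z ^ (1 / 2 : ℂ) := by
    rw [Complex.cpow_def_of_ne_zero (by simp [hx.ne', hz0]), Complex.real_smul,
      Complex.log_ofReal_mul (inv_pos.mpr hx) hz0, Complex.cpow_def_of_ne_zero (by simp [hx.ne']),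
      Complex.cpow_def_of_ne_zero hz0, ← Complex.exp_add, Complex.ofReal_log (inv_pos.mpr hx).le]
    ring_nf
  rw [e3]
  have e4 : ((x⁻¹ : ℝ) : ℂ) ^ (1 / 2 : ℂ) = (((x ^ (1 / 2 : ℝ) : ℝ)) : ℂ)⁻¹ := by
    rw [show (1 / 2 : ℂ) = ((1 / 2 : ℝ) : ℂ) by push_cast; ring,
      ← Complex.ofReal_cpow (inv_pos.mpr hx).le, Real.inv_rpow hx.le]
    push_cast; ring
  rw [e4, Complex.cpow_neg]
  simp

lemma continuousOn_rayTheta {z : ℂ} (hz : 0 < z.re) : ContinuousOn (rayTheta z) (Ioi 0) := by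
  intro x hx
  refine ContinuousAt.continuousWithinAt ?_
  have h : ContinuousAt jacobiTheta (Complex.I * (z * x)) :=
    continuousAt_jacobiTheta (by rw [im_I_mul_mul]; exact mul_pos hz hx)
  exact ContinuousAt.comp (f := fun x : ℝ => Complex.I * (z * x)) h (by fun_prop)

lemma rayTheta_sub_one_isBigO {z : ℂ} (hz : 0 < z.re) (r : ℝ) :
    (fun x => rayTheta z x - 1) =O[atTop] fun x : ℝ => x ^ r := by
  have ht : Tendsto (fun x : ℝ => Complex.I * (z * x)) atTop (comap Complex.im atTop) := by
    rw [tendsto_comap_iff]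
    simp only [Function.comp_def, im_I_mul_mul]
    exact tendsto_id.const_mul_atTop hz
  have h := isBigO_at_im_infty_jacobiTheta_sub_one.comp_tendsto ht
  simp only [Function.comp_def, im_I_mul_mul] at h
  refine h.trans ?_
  have := (isLittleO_exp_neg_mul_rpow_atTop (a := Real.pi * z.re) (mul_pos Real.pi_pos hz) r).isBigO
  refine this.congr_left fun x => ?_
  ring_nf

/-- The theta functions along the rays of `z` and `z⁻¹`, related by the functional equation. -/
@[simps]
noncomputable def rayThetaPair (z : ℂ) (hz : 0 < z.re) : WeakFEPair ℂ where
  f := rayTheta z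
  g := rayTheta z⁻¹
  k := 1 / 2
  ε := z ^ (-(1 / 2) : ℂ)
  f₀ := 1
  g₀ := 1
  hf_int := (continuousOn_rayTheta hz).locallyIntegrableOn measurableSet_Ioi
  hg_int := (continuousOn_rayTheta (by
    rw [Complex.inv_re]
    exact div_pos hz (Complex.normSq_pos.mpr (by rintro rfl; simp at hz)))).locallyIntegrableOn
    measurableSet_Ioi
  hk := by norm_num
  hε := by
    have : z ≠ 0 := by rintro rfl; simp at hz
    simp [Complex.cpow_eq_zero_iff, this]
  h_feq := fun x hx => by simpa using rayTheta_one_div hz hx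
  hf_top := rayTheta_sub_one_isBigO hz
  hg_top := rayTheta_sub_one_isBigO (by
    rw [Complex.inv_re]
    exact div_pos hz (Complex.normSq_pos.mpr (by rintro rfl; simp at hz)))

/-- Rotating the ray multiplies the Mellin transform of theta by a power. -/
lemma rayThetaPair_Λ {z : ℂ} (hz : 0 < z.re) {s : ℂ} (hs0 : s ≠ 0) (hs1 : s ≠ 1 / 2) :
    (rayThetaPair z hz).Λ s = z ^ (-s) * (rayThetaPair 1 (by simp)).Λ s := by
  have hz0 : z ≠ 0 := by rintro rfl; simp at hz
  -- `A` is s(1/2 - s)Λ(s), with the two poles cleared. It is entire, so the relation known for real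
  -- s > 1/2 extends to the whole plane.
  let A : (w : ℂ) → (hw : 0 < w.re) → ℂ → ℂ := fun w hw s =>
    s * (1 / 2 - s) * (rayThetaPair w hw).Λ₀ s - (1 / 2 - s) - s * w ^ (-(1 / 2) : ℂ)
  have hA : ∀ w hw s, s ≠ 0 → s ≠ 1 / 2 → A w hw s = s * (1 / 2 - s) * (rayThetaPair w hw).Λ s := by
    intro w hw s h0 h1
    have h2 : (1 / 2 : ℂ) - s ≠ 0 := sub_ne_zero.mpr (Ne.symm h1)
    simp only [A, WeakFEPair.Λ, rayThetaPair_f₀, rayThetaPair_ε, rayThetaPair_g₀, rayThetaPair_k,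
      smul_eq_mul, mul_one]
    generalize (rayThetaPair w hw).Λ₀ s = a
    generalize w ^ (-(1 / 2) : ℂ) = b
    rw [show ((1 / 2 : ℝ) : ℂ) = 1 / 2 by norm_num,
      mul_sub (s * (1 / 2 - s)) (a - 1 / s), mul_sub (s * (1 / 2 - s)) a (1 / s),
      show s * (1 / 2 - s) * (1 / s) = 1 / 2 - s by field_simp,
      show s * (1 / 2 - s) * (b / (1 / 2 - s)) = s * b by rw [mul_assoc, mul_div_cancel₀ _ h2]]
  have hAd : ∀ w hw, Differentiable ℂ (A w hw) := by
    intro w hw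
    have := (rayThetaPair w hw).differentiable_Λ₀
    simp only [A]
    fun_prop
  have hf : AnalyticOnNhd ℂ (A z hz) univ := (hAd z hz).differentiableOn.analyticOnNhd isOpen_univ
  have hg : AnalyticOnNhd ℂ (fun s => z ^ (-s) * A 1 (by simp) s) univ := by
    refine DifferentiableOn.analyticOnNhd (Differentiable.differentiableOn ?_) isOpen_univ
    have h1 := hAd 1 (by simp)
    have h2 : Differentiable ℂ fun s : ℂ => z ^ (-s) := fun s =>
      (differentiableAt_id.neg).const_cpow (Or.inl hz0)
    exact h2.mul h1
  have key := hf.eqOn_of_preconnected_of_frequently_eq hg isPreconnected_univ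
    (z₀ := 1) (mem_univ _) ?_ (mem_univ s)
  · simp only [hA _ _ s hs0 hs1] at key
    have h2 : s * ((1 / 2 : ℂ) - s) ≠ 0 := mul_ne_zero hs0 (sub_ne_zero.mpr (Ne.symm hs1))
    refine mul_left_cancel₀ h2 ?_
    rw [key]; ring
  have hmap : Tendsto (fun x : ℝ => (x : ℂ)) (𝓝[>] 1) (𝓝[≠] 1) := by
    refine tendsto_nhdsWithin_iff.mpr ⟨?_, ?_⟩
    · exact (Complex.continuous_ofReal.tendsto 1).mono_left nhdsWithin_le_nhds
    · filter_upwards [self_mem_nhdsWithin] with x hx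
      simpa using (ne_of_gt hx : x ≠ 1)
  refine hmap.frequently (Eventually.frequently ?_)
  filter_upwards [self_mem_nhdsWithin] with x hx
  have hx1 : (1 : ℝ) < x := hx
  have hx0 : (x : ℂ) ≠ 0 := by exact_mod_cast (by linarith : x ≠ 0)
  have hx2 : (x : ℂ) ≠ 1 / 2 := by
    intro h
    have : x = 1 / 2 := by
      have := congrArg Complex.re h
      simpa using this
    linarith
  have hre : (1 / 2 : ℝ) < (x : ℂ).re := by simp; linarith
  rw [hA _ _ _ hx0 hx2, hA _ _ _ hx0 hx2]
  have h1 := ((rayThetaPair z hz).hasMellin (s := x) hre).2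
  have h2 := ((rayThetaPair 1 (by simp)).hasMellin (s := x) hre).2
  simp only [rayThetaPair_f, rayThetaPair_f₀] at h1 h2
  rw [← h1, ← h2, mellin_rayTheta hz (by linarith)]
  ring

/-- For a weak FE-pair, `Λ` in the strip `0 < Re s < k` is the Mellin transform of `f` with both
its asymptotic terms removed. -/
lemma WeakFEPair.hasMellin_strip (P : WeakFEPair ℂ) {s : ℂ} (hs : 0 < s.re) (hs' : s.re < P.k) :
    HasMellin (fun x => P.f x - P.f₀ - P.ε * ((x ^ (-P.k) : ℝ) : ℂ) * P.g₀) s (P.Λ s) := by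
  -- `f_modif` lacks f₀ on (1, ∞) only, and ε x^{-k} g₀ on (0, 1) only. Removing f₀ on (0, 1] and ε
  -- x^{-k} g₀ on (1, ∞) as well subtracts f₀/s and ε g₀/(k - s), which are the polar terms of Λ.
  -- Both integrals converge in the strip.
  have h0 : HasMellin P.f_modif s (P.Λ₀ s) :=
    ⟨(P.isStrongFEPair_toStrongFEPair.hasMellin s).1, rfl⟩
  have h1 := hasMellin_const_smul (hasMellin_one_Ioc hs).1 P.f₀
  rw [(hasMellin_one_Ioc hs).2] at h1
  have hks : (P.k : ℂ) - s ≠ 0 := fun h => by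
    have := congrArg Complex.re h
    simp at this; linarith
  have h2 : HasMellin ((Ioi (1 : ℝ)).indicator fun x => ((x ^ (-P.k) : ℝ) : ℂ)) s
      (1 / (P.k - s)) := by
    have e : ∀ x ∈ Ioi (1 : ℝ), (x : ℂ) ^ (s - 1) • ((x ^ (-P.k) : ℝ) : ℂ)
        = (x : ℂ) ^ (s - 1 - P.k) := by
      intro x hx
      have hx0 : (0 : ℝ) < x := lt_trans zero_lt_one hx
      rw [Complex.ofReal_cpow hx0.le, smul_eq_mul,
        ← Complex.cpow_add _ _ (by exact_mod_cast hx0.ne')]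
      push_cast; ring_nf
    have hre : (s - 1 - P.k).re < -1 := by simp; linarith
    have hi := integrableOn_Ioi_cpow_of_lt hre zero_lt_one
    constructor
    · simp only [MellinConvergent, ← indicator_smul]
      rw [IntegrableOn, integrable_indicator_iff measurableSet_Ioi, IntegrableOn,
        Measure.restrict_restrict_of_subset (Ioi_subset_Ioi zero_le_one)]
      exact hi.congr_fun (fun x hx => (e x hx).symm) measurableSet_Ioi
    · simp only [mellin, ← indicator_smul]
      rw [integral_indicator measurableSet_Ioi,
        Measure.restrict_restrict_of_subset (Ioi_subset_Ioi zero_le_one),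
        setIntegral_congr_fun measurableSet_Ioi e, integral_Ioi_cpow_of_lt hre zero_lt_one]
      have : s - 1 - P.k + 1 = -(P.k - s) := by ring
      rw [this, Complex.ofReal_one, Complex.one_cpow, neg_div_neg_eq]
  have h3 := hasMellin_const_smul h2.1 (P.ε * P.g₀)
  rw [h2.2] at h3
  have h4 := hasMellin_sub h0.1 h1.1
  have h5 := hasMellin_sub h4.1 h3.1
  rw [h4.2, h0.2, h1.2, h3.2] at h5
  have he : ∀ᵐ x : ℝ ∂(volume.restrict (Ioi 0)), (x : ℂ) ^ (s - 1) • (P.f_modif x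
      - P.f₀ • (Ioc (0 : ℝ) 1).indicator (fun _ => (1 : ℂ)) x
      - (P.ε * P.g₀) • (Ioi (1 : ℝ)).indicator (fun x => ((x ^ (-P.k) : ℝ) : ℂ)) x)
      = (x : ℂ) ^ (s - 1) • (P.f x - P.f₀ - P.ε * ((x ^ (-P.k) : ℝ) : ℂ) * P.g₀) := by
    have h1ne : ∀ᵐ t : ℝ ∂(volume.restrict (Ioi 0)), t ≠ 1 :=
      ae_restrict_of_ae (by simp [ae_iff])
    filter_upwards [h1ne, ae_restrict_mem measurableSet_Ioi] with x hx hx0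
    have hx0' : 0 < x := hx0
    congr 1
    simp only [WeakFEPair.f_modif, Pi.add_apply, indicator_apply, mem_Ioi, mem_Ioo, mem_Ioc, hx0',
      true_and, smul_eq_mul]
    rcases lt_or_gt_of_ne hx with h | h
    · simp only [h, h.le, not_lt.mpr h.le, if_true, if_false]; ring
    · simp only [h, not_lt.mpr h.le, not_le.mpr h, if_true, if_false]; ring
  refine ⟨(integrable_congr he).mp h5.1, ?_⟩
  have : mellin (fun x => P.f x - P.f₀ - P.ε * ((x ^ (-P.k) : ℝ) : ℂ) * P.g₀) s = _ :=
    (integral_congr_ae he).symm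
  rw [this]
  refine h5.2.trans ?_
  simp only [WeakFEPair.Λ, smul_eq_mul]
  field_simp

/-- The pair at `z = 1` gives the completed zeta function. -/
lemma rayThetaPair_one_Λ (s : ℂ) :
    (rayThetaPair 1 (by simp)).Λ s = 2 * completedRiemannZeta (2 * s) := by
  have hf : ∀ x ∈ Ioi (0 : ℝ), (rayThetaPair 1 (by simp)).f x
      = (HurwitzZeta.hurwitzEvenFEPair 0).f x := by
    intro x hx
    have := HurwitzZeta.evenKernel_def 0 x
    simp [HurwitzZeta.hurwitzEvenFEPair, rayTheta, jacobiTheta_eq_jacobiTheta₂] at this ⊢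
    exact this.symm
  have hΛ₀ : (rayThetaPair 1 (by simp)).Λ₀ s = (HurwitzZeta.hurwitzEvenFEPair 0).Λ₀ s := by
    refine setIntegral_congr_fun measurableSet_Ioi fun x hx => ?_
    simp only [WeakFEPair.f_modif, Pi.add_apply, indicator_apply, hf x hx]
    simp [HurwitzZeta.hurwitzEvenFEPair]
  rw [completedRiemannZeta, HurwitzZeta.completedHurwitzZetaEven, WeakFEPair.Λ, hΛ₀, WeakFEPair.Λ]
  simp [HurwitzZeta.hurwitzEvenFEPair]
  ring

/-! ### Decay of theta at the cusp `1` -/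

/-- The shift inserts the sign (-1)^{n²}, which is twice the indicator of even n minus 1, and the
even terms sum to θ(4w). -/
lemma jacobiTheta_add_one {w : ℂ} (hw : 0 < w.im) :
    jacobiTheta (w + 1) = 2 * jacobiTheta (4 * w) - jacobiTheta w := by
  have h4 : 0 < (4 * w).im := by simpa using hw
  have h1 : 0 < (w + 1).im := by simpa using hw
  have hs : ∀ τ : ℂ, 0 < τ.im → HasSum (fun n : ℤ => Complex.exp (Real.pi * Complex.I * (n : ℂ) ^ 2 * τ))
      (jacobiTheta τ) := fun τ hτ => by
    have := (hasSum_jacobiTheta₂_term 0 hτ)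
    rw [← jacobiTheta_eq_jacobiTheta₂] at this
    simpa [jacobiTheta₂_term] using this
  let a : ℤ → ℂ := fun n => Complex.exp (Real.pi * Complex.I * (n : ℂ) ^ 2 * w)
  let e : ℤ → ℂ := fun n => if Even n then a n else 0
  have heven : HasSum e (jacobiTheta (4 * w)) := by
    have hinj : Function.Injective fun n : ℤ => 2 * n := fun m n h => by simpa using h
    rw [← hinj.hasSum_iff]
    · convert! hs _ h4 using 2 with n
      simp only [Function.comp_apply, e, a, even_two, Even.mul_right, if_true]
      congr 1
      push_cast
      ring
    · intro n hn
      refine if_neg fun h => hn ?_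
      obtain ⟨m, rfl⟩ := h
      exact ⟨m, by simp only; ring⟩
  have h := (heven.mul_left 2).sub (hs _ hw)
  refine (hs _ h1).unique ?_
  convert! h using 2 with n
  have hadd : Complex.exp (Real.pi * Complex.I * (n : ℂ) ^ 2 * (w + 1))
      = a n * Complex.exp ((n ^ 2 : ℤ) * (Real.pi * Complex.I)) := by
    rw [← Complex.exp_add]; congr 1; push_cast; ring
  rw [hadd, Complex.exp_int_mul, Complex.exp_pi_mul_I]
  by_cases hn : Even n
  · have : Even (n ^ 2) := by simpa [Int.even_pow] using hn
    simp only [e, if_pos hn, this.neg_one_zpow]; simp only [a]; ring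
  · have : Odd (n ^ 2) := by
      rw [← Int.not_even_iff_odd]; simpa [Int.even_pow] using hn
    simp only [e, if_neg hn, this.neg_one_zpow]; simp only [a]; ring

lemma jacobiTheta_eq_mul_neg_one_div (w : ℂ) :
    jacobiTheta w = 1 / (-Complex.I * w) ^ (1 / 2 : ℂ) * jacobiTheta (-1 / w) := by
  rw [jacobiTheta_eq_jacobiTheta₂, jacobiTheta₂_functional_equation, jacobiTheta_eq_jacobiTheta₂]
  simp

/-- Inversion is applied to both θ(4w) and θ(w). Since √4 = 2, the two constant terms 1 cancel, and
only the exponentially small tails remain. -/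
lemma norm_jacobiTheta_add_one_le {w : ℂ} (hw : 0 < w.im) :
    ‖jacobiTheta (w + 1)‖ ≤ ‖w‖ ^ (-(1 / 2) : ℝ) *
      (‖jacobiTheta (-1 / (4 * w)) - 1‖ + ‖jacobiTheta (-1 / w) - 1‖) := by
  have hw0 : w ≠ 0 := by rintro rfl; simp at hw
  have h4 : 0 < (4 * w).im := by simpa using hw
  have e : (-Complex.I * (4 * w)) ^ (1 / 2 : ℂ) = 2 * (-Complex.I * w) ^ (1 / 2 : ℂ) := by
    have h1 : -Complex.I * (4 * w) = ((4 : ℝ) : ℂ) * (-Complex.I * w) := by push_cast; ring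
    have h2 : -Complex.I * w ≠ 0 := by simp [hw0]
    rw [h1, Complex.cpow_def_of_ne_zero (by simp [hw0]), Complex.log_ofReal_mul (by norm_num) h2,
      Complex.cpow_def_of_ne_zero h2, add_mul, Complex.exp_add]
    congr 1
    have : Real.log 4 = 2 * Real.log 2 := by
      rw [show (4 : ℝ) = 2 ^ 2 by norm_num, Real.log_pow]; norm_num
    rw [this]
    push_cast
    rw [show (2 * (Real.log 2 : ℂ) * (1 / 2) : ℂ) = ((Real.log 2 : ℝ) : ℂ) by ring,
      ← Complex.ofReal_exp, Real.exp_log two_pos]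
    norm_num
  rw [jacobiTheta_add_one hw, jacobiTheta_eq_mul_neg_one_div w, jacobiTheta_eq_mul_neg_one_div (4 * w), e]
  have h3 : 2 * (1 / (2 * (-Complex.I * w) ^ (1 / 2 : ℂ)) * jacobiTheta (-1 / (4 * w)))
      - 1 / (-Complex.I * w) ^ (1 / 2 : ℂ) * jacobiTheta (-1 / w)
      = ((-Complex.I * w) ^ (1 / 2 : ℂ))⁻¹ *
        ((jacobiTheta (-1 / (4 * w)) - 1) - (jacobiTheta (-1 / w) - 1)) := by
    rw [one_div, one_div, mul_inv]; ring
  rw [h3, norm_mul, norm_inv]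
  have h4 : ‖(-Complex.I * w) ^ (1 / 2 : ℂ)‖ = ‖w‖ ^ (1 / 2 : ℝ) := by
    have := Complex.norm_cpow_real (-Complex.I * w) (1 / 2)
    push_cast at this
    rw [this]; simp
  rw [h4, Real.rpow_neg (norm_nonneg _)]
  gcongr
  exact norm_sub_le _ _

/-- Exponential decay is weakened to cubic decay: even after a loss of δ⁻¹ from the inversion
factor, a bound of order δ² is left. -/
lemma norm_jacobiTheta_sub_one_le_of_one_le {τ : ℂ} (hτ : 1 ≤ τ.im) :
    ‖jacobiTheta τ - 1‖ ≤ 24 * τ.im ^ (-3 : ℤ) := by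
  have h0 : 0 < τ.im := by linarith
  refine (norm_jacobiTheta_sub_one_le h0).trans ?_
  have hpi := Real.pi_gt_three
  have h1 : Real.exp (-Real.pi * τ.im) ≤ 1 / 2 := by
    rw [neg_mul, Real.exp_neg, inv_le_comm₀ (Real.exp_pos _) (by norm_num)]
    have := Real.add_one_le_exp (Real.pi * τ.im)
    nlinarith
  have h2 : Real.exp (-Real.pi * τ.im) ≤ 6 * τ.im ^ (-3 : ℤ) := by
    have := Real.pow_div_factorial_le_exp (x := Real.pi * τ.im) (by positivity) 3
    rw [neg_mul, Real.exp_neg, zpow_neg, ← div_eq_mul_inv, inv_le_comm₀ (Real.exp_pos _) (by positivity)]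
    refine le_trans ?_ this
    rw [inv_div]
    norm_num [Nat.factorial]
    have : (1:ℝ) ≤ Real.pi ^ 3 := one_le_pow₀ (by linarith)
    rw [mul_pow]
    have h3 : 0 < τ.im ^ 3 := by positivity
    nlinarith
  have h3 : 2 / (1 - Real.exp (-Real.pi * τ.im)) ≤ 4 := by
    rw [div_le_iff₀ (by linarith)]; linarith
  calc _ ≤ 4 * (6 * τ.im ^ (-3 : ℤ)) := by gcongr
    _ = _ := by ring

/-- Near the cusp `-1`, approached along the unit circle, theta vanishes to second order. -/
lemma norm_jacobiTheta_neg_exp_le {δ : ℝ} (h0 : 0 < δ) (h1 : δ ≤ 1 / 8) :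
    ‖jacobiTheta (-Complex.exp (-(δ * Complex.I)))‖ ≤ 10 ^ 6 * δ ^ 2 := by
  set w : ℂ := 1 - Complex.exp (-(δ * Complex.I)) with hw
  have hpi := Real.pi_gt_three
  have hpi4 := Real.pi_lt_four
  have hexp : Complex.exp (-(δ * Complex.I)) = ⟨Real.cos δ, -Real.sin δ⟩ := by
    rw [← neg_mul, ← Complex.ofReal_neg, Complex.exp_mul_I]
    apply Complex.ext <;> simp [← Complex.ofReal_cos, ← Complex.ofReal_sin]
  have hre : w.re = 1 - Real.cos δ := by rw [hw, hexp]; simp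
  have him : w.im = Real.sin δ := by rw [hw, hexp]; simp
  have hsin : δ / 2 ≤ Real.sin δ := by
    have := Real.mul_le_sin h0.le (by linarith)
    refine le_trans ?_ this
    rw [div_mul_eq_mul_div, le_div_iff₀ Real.pi_pos]
    nlinarith
  have hsin' : 0 < Real.sin δ := by linarith
  have hnsq : Complex.normSq w ≤ δ ^ 2 := by
    rw [Complex.normSq_apply, hre, him]
    have := Real.one_sub_sq_div_two_le_cos (x := δ)
    have := Real.sin_sq_add_cos_sq δ
    nlinarith
  have hnsq0 : 0 < Complex.normSq w := by
    rw [Complex.normSq_pos]; intro h; rw [h] at him; simp at him; linarith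
  -- The imaginary part is sin δ / (a|w|²), and sin δ ≥ δ/2, |w| ≤ δ, a ≤ 4 give 1/(8δ).
  have hY : ∀ a : ℝ, 0 < a → a ≤ 4 → (1 : ℝ) / (8 * δ) ≤ (-1 / (a * w)).im := by
    intro a ha ha4
    have : (-1 / (a * w)).im = Real.sin δ / (a * Complex.normSq w) := by
      rw [neg_div, one_div, Complex.neg_im, Complex.inv_im, Complex.normSq_mul]
      simp [him]
      field_simp
    rw [this, div_le_div_iff₀ (by positivity) (by positivity)]
    nlinarith [mul_le_mul ha4 hnsq hnsq0.le (by norm_num)]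
  have hbound : ∀ a : ℝ, 0 < a → a ≤ 4 → ‖jacobiTheta (-1 / (a * w)) - 1‖ ≤ 24 * (8 * δ) ^ 3 := by
    intro a ha ha4
    have hy := hY a ha ha4
    have hy1 : 1 ≤ 1 / (8 * δ) := by rw [le_div_iff₀ (by positivity)]; linarith
    refine (norm_jacobiTheta_sub_one_le_of_one_le (hy1.trans hy)).trans ?_
    gcongr
    rw [zpow_neg, inv_le_comm₀ (by have := hy1.trans hy; positivity) (by positivity)]
    have : ((8 * δ) ^ 3)⁻¹ = (1 / (8 * δ)) ^ 3 := by rw [one_div, inv_pow]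
    rw [this]
    exact pow_le_pow_left₀ (by positivity) hy 3
  have key := norm_jacobiTheta_add_one_le (w := w) (by rw [him]; exact hsin')
  have hper : jacobiTheta (-Complex.exp (-(δ * Complex.I))) = jacobiTheta (w + 1) := by
    rw [← jacobiTheta_two_add]; congr 1; rw [hw]; ring
  rw [hper]
  have b4 := hbound 4 (by norm_num) le_rfl
  have b1 := hbound 1 (by norm_num) (by norm_num)
  norm_num at b4 b1
  have hwn : δ / 2 ≤ ‖w‖ := by
    refine hsin.trans ?_
    rw [← him]
    exact (le_abs_self _).trans (Complex.abs_im_le_norm w)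
  -- The exponent -1/2 is replaced by the cruder -1. The final constant is 2 · 48 · 8³ = 49152,
  -- below 10⁶.
  have hp : ‖w‖ ^ (-(1 / 2) : ℝ) ≤ 2 / δ := by
    calc ‖w‖ ^ (-(1 / 2) : ℝ) ≤ (δ / 2) ^ (-(1 / 2) : ℝ) :=
          Real.rpow_le_rpow_of_nonpos (by positivity) hwn (by norm_num)
      _ ≤ (δ / 2) ^ (-1 : ℝ) :=
          Real.rpow_le_rpow_of_exponent_ge (by positivity) (by linarith) (by norm_num)
      _ = 2 / δ := by rw [Real.rpow_neg_one, inv_div]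
  refine key.trans ?_
  calc ‖w‖ ^ (-(1 / 2) : ℝ) * (‖jacobiTheta (-1 / (4 * w)) - 1‖ + ‖jacobiTheta (-1 / w) - 1‖)
      ≤ 2 / δ * (24 * (8 * δ) ^ 3 + 24 * (8 * δ) ^ 3) := by gcongr
    _ ≤ _ := by
      rw [div_mul_eq_mul_div, div_le_iff₀ h0]
      nlinarith [pow_pos h0 3]

/-- The cusp 1 is the mirror image of -1 under τ ↦ -conj τ, which conjugates theta. -/
lemma norm_jacobiTheta_exp_le {δ : ℝ} (h0 : 0 < δ) (h1 : δ ≤ 1 / 8) :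
    ‖jacobiTheta (Complex.exp (δ * Complex.I))‖ ≤ 10 ^ 6 * δ ^ 2 := by
  have h := jacobiTheta₂_conj 0 (-Complex.exp (-(δ * Complex.I)))
  rw [map_zero, map_neg, neg_neg, ← Complex.exp_conj, ← jacobiTheta_eq_jacobiTheta₂,
    ← jacobiTheta_eq_jacobiTheta₂] at h
  have e : (starRingEnd ℂ) (-(δ * Complex.I)) = δ * Complex.I := by simp
  rw [e] at h
  rw [← h, Complex.norm_conj]
  exact norm_jacobiTheta_neg_exp_le h0 h1

/-! ### A zero on the critical line -/

open FourierTransform in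
/-- Fourier inversion at `0` with Gaussian summation. -/
lemma tendsto_integral_gaussian_mul_fourier {f : ℝ → ℂ} (hf : Integrable f) (h0 : ContinuousAt f 0) :
    Tendsto (fun c : ℝ => ∫ t : ℝ, Complex.exp (-c⁻¹ * t ^ 2) * 𝓕 f t) atTop (𝓝 (f 0)) := by
  refine (Real.tendsto_integral_gaussian_smul' hf h0).congr' ?_
  filter_upwards [Ioi_mem_atTop 0] with c (hc : 0 < c)
  have J : Integrable (fun w : ℝ => Complex.exp (-(c : ℂ)⁻¹ * ‖w‖ ^ 2 + 2 * Real.pi * Complex.I *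
      (inner ℝ (0 : ℝ) w : ℝ))) :=
    GaussianFourier.integrable_cexp_neg_mul_sq_norm_add (by simpa) _ _
  -- The Fourier transform is moved from the Gaussian to f by self-adjointness.
  have h := VectorFourier.integral_fourierIntegral_smul_eq_flip (L := innerₗ ℝ)
      Real.continuous_fourierChar continuous_inner J hf
  have h1 : ∀ w, VectorFourier.fourierIntegral Real.fourierChar volume (innerₗ ℝ)
      (fun w : ℝ => Complex.exp (-(c : ℂ)⁻¹ * ‖w‖ ^ 2 + 2 * Real.pi * Complex.I *
      (inner ℝ (0 : ℝ) w : ℝ))) w = (Real.pi * c : ℂ) ^ (Module.finrank ℝ ℝ / 2 : ℂ) *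
        Complex.exp (-Real.pi ^ 2 * c * ‖(0 : ℝ) - w‖ ^ 2) := by
    intro w
    have := fourier_gaussian_innerProductSpace' (V := ℝ) (b := (c : ℂ)⁻¹) (by simpa) 0 w
    refine Eq.trans ?_ (this.trans ?_)
    · rfl
    · congr
      · simp
      · simp; ring
  simp only [h1] at h
  rw [h]
  refine integral_congr_ae (Eventually.of_forall fun t => ?_)
  have hflip : (innerₗ ℝ).flip = innerₗ ℝ := by
    ext; simp
  simp only [inner_zero_left, smul_eq_mul, hflip]
  congr 2
  simp [← Complex.ofReal_pow]

/-- Substitution x = e^{-u}: Mellin convergence on a vertical line is integrability on the additive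
group. -/
lemma integrable_mellin_kernel {f : ℝ → ℂ} {σ : ℝ} (hf : MellinConvergent f σ) :
    Integrable fun u : ℝ => Real.exp (-σ * u) • f (Real.exp (-u)) := by
  have himg : Real.exp ∘ Neg.neg '' univ = Ioi 0 := by
    rw [image_comp, image_univ_of_surjective neg_surjective, image_univ, Real.range_exp]
  have hinj : univ.InjOn (Real.exp ∘ Neg.neg) :=
    Real.exp_injective.injOn.comp neg_injective.injOn (univ.mapsTo_univ _)
  have hder : ∀ x ∈ univ, HasDerivWithinAt (Real.exp ∘ Neg.neg) (-Real.exp (-x)) univ x := by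
    intro x _
    have := ((Real.hasDerivAt_exp (-x)).comp x (hasDerivAt_neg x)).hasDerivWithinAt (s := univ)
    exact this.congr_deriv (by ring)
  rw [MellinConvergent, ← himg, integrableOn_image_iff_integrableOn_abs_deriv_smul
      MeasurableSet.univ hder hinj, integrableOn_univ] at hf
  refine hf.congr (Eventually.of_forall fun x => ?_)
  simp only [Function.comp_apply, abs_neg, Real.abs_exp, smul_eq_mul, Complex.real_smul]
  rw [← mul_assoc]
  congr 1
  rw [← Complex.ofReal_one, ← Complex.ofReal_sub, ← Complex.ofReal_cpow (Real.exp_pos _).le,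
    ← Complex.ofReal_mul, ← Real.exp_mul, ← Real.exp_add]
  congr 2; ring

/-- The real-valued function `-2 Λ(1/2 + 4 π i t)`. -/
noncomputable def criticalXi (t : ℝ) : ℝ :=
  -2 * (completedRiemannZeta (1 / 2 + 4 * Real.pi * t * Complex.I)).re

lemma completedRiemannZeta_conj {s : ℂ} (hs : 0 < s.re) :
    completedRiemannZeta ((starRingEnd ℂ) s) = (starRingEnd ℂ) (completedRiemannZeta s) := by
  have key : ∀ s : ℂ, 0 < s.re → completedRiemannZeta s = riemannZeta s * Complex.Gammaℝ s := by
    intro s hs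
    have h0 : s ≠ 0 := by rintro rfl; simp at hs
    rw [riemannZeta_def_of_ne_zero h0, div_mul_cancel₀ _ (Complex.Gammaℝ_ne_zero_of_re_pos hs)]
  rw [key s hs, key _ (by simpa using hs), map_mul, riemannZeta_conj]
  congr 1
  rw [Complex.Gammaℝ_def, Complex.Gammaℝ_def, map_mul, ← Complex.Gamma_conj]
  congr 1
  · have h2 : (starRingEnd ℂ) (-s / 2) = -(starRingEnd ℂ) s / 2 := by
      rw [map_div₀, map_neg, Complex.conj_ofNat]
    have := Complex.conj_cpow (Real.pi : ℂ) (-(starRingEnd ℂ) s / 2)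
      (by rw [Complex.arg_ofReal_of_nonneg Real.pi_pos.le]; exact Real.pi_pos.ne)
    rw [Complex.conj_ofReal] at this
    rw [this, ← h2, Complex.conj_conj]
  · rw [map_div₀, Complex.conj_ofNat]

/-- On the critical line conj s = 1 - s, so the functional equation together with conjugation
symmetry makes Λ real there. -/
lemma criticalXi_eq (t : ℝ) :
    (criticalXi t : ℂ) = -2 * completedRiemannZeta (1 / 2 + 4 * Real.pi * t * Complex.I) := by
  set s : ℂ := 1 / 2 + 4 * Real.pi * t * Complex.I with hs
  have hre : 0 < s.re := by rw [hs]; simp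
  have h := completedRiemannZeta_conj hre
  have h2 : (starRingEnd ℂ) s = 1 - s := by
    rw [hs]; apply Complex.ext <;> simp; norm_num
  rw [h2, completedRiemannZeta_one_sub] at h
  rw [criticalXi, ← hs]
  have := Complex.conj_eq_iff_re.mp h.symm
  push_cast
  rw [this]

lemma continuous_criticalXi : Continuous criticalXi := by
  unfold criticalXi
  refine continuous_const.mul (Complex.continuous_re.comp ?_)
  refine continuous_iff_continuousAt.mpr fun t => ?_
  have h : ContinuousAt completedRiemannZeta (1 / 2 + 4 * Real.pi * t * Complex.I) := by
    refine (differentiableAt_completedZeta ?_ ?_).continuousAt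
    · intro h; have := congrArg Complex.re h; simp at this
    · intro h; have := congrArg Complex.re h; simp at this
  exact ContinuousAt.comp (f := fun t : ℝ => (1 / 2 + 4 * Real.pi * t * Complex.I : ℂ)) h
    (by fun_prop)

lemma exists_criticalXi_eq_zero_imp (h : ∃ t, criticalXi t = 0) :
    ∃ t : ℝ, riemannZeta (1 / 2 + t * Complex.I) = 0 := by
  obtain ⟨t, ht⟩ := h
  refine ⟨4 * Real.pi * t, ?_⟩
  have h1 := criticalXi_eq t
  rw [ht] at h1
  have h2 : completedRiemannZeta (1 / 2 + 4 * Real.pi * t * Complex.I) = 0 := by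
    simpa using h1.symm
  rw [riemannZeta_def_of_ne_zero]
  · push_cast; rw [h2, zero_div]
  · intro h; have := congrArg Complex.re h; simp at this

open FourierTransform in
/-- The function whose Fourier transform is `Λ` along the critical line, rotated by `z`. -/
lemma exists_fourier_eq_criticalXi {β : ℝ} (hβ : |β| < Real.pi / 2) :
    ∃ φ : ℝ → ℂ, Integrable φ ∧ ContinuousAt φ 0 ∧
      φ 0 = jacobiTheta (Complex.I * Complex.exp (β * Complex.I)) - 1
        - Complex.exp (-(β / 2) * Complex.I) ∧
      ∀ t : ℝ, 𝓕 φ t = -(Complex.exp (-(β / 4) * Complex.I) *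
        ((Real.exp (2 * Real.pi * β * t) * criticalXi t : ℝ) : ℂ)) := by
  set z : ℂ := Complex.exp (β * Complex.I) with hzdef
  have hβ' := abs_lt.mp hβ
  have hz : 0 < z.re := by
    rw [hzdef, Complex.exp_ofReal_mul_I_re]
    exact Real.cos_pos_of_mem_Ioo ⟨by linarith, hβ'.2⟩
  have hz0 : z ≠ 0 := Complex.exp_ne_zero _
  have hlog : Complex.log z = β * Complex.I := by
    rw [hzdef, Complex.log_exp] <;> simp <;> linarith [Real.pi_pos]
  set P := rayThetaPair z hz with hP
  let G : ℝ → ℂ := fun x => P.f x - P.f₀ - P.ε * ((x ^ (-P.k) : ℝ) : ℂ) * P.g₀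
  let φ : ℝ → ℂ := fun u => Real.exp (-(1 / 4) * u) • G (Real.exp (-u))
  have hG : ∀ s : ℂ, s.re = 1 / 4 → HasMellin G s (P.Λ s) := fun s hs =>
    P.hasMellin_strip (by rw [hs]; norm_num) (by rw [hs]; norm_num [hP])
  refine ⟨φ, ?_, ?_, ?_, ?_⟩
  · exact integrable_mellin_kernel (hG ((1 / 4 : ℝ) : ℂ) (by simp)).1
  · have hGc : ContinuousAt G (Real.exp (-0)) := by
      rw [neg_zero, Real.exp_zero]
      have h1 : ContinuousAt P.f 1 :=
        (continuousOn_rayTheta hz).continuousAt (Ioi_mem_nhds zero_lt_one)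
      have h2 : ContinuousAt (fun x : ℝ => x ^ (-P.k)) 1 :=
        Real.continuousAt_rpow_const _ _ (Or.inl one_ne_zero)
      have h3 : ContinuousAt (fun x : ℝ => ((x ^ (-P.k) : ℝ) : ℂ)) 1 :=
        Complex.continuous_ofReal.continuousAt.comp h2
      exact (h1.sub continuousAt_const).sub ((continuousAt_const.mul h3).mul continuousAt_const)
    refine ContinuousAt.fun_smul (by fun_prop) ?_
    exact ContinuousAt.comp (f := fun u : ℝ => Real.exp (-u)) hGc (by fun_prop)
  · simp only [φ, G, hP]
    simp only [mul_zero, Real.exp_zero, one_smul, neg_zero, rayThetaPair_f, rayThetaPair_f₀,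
      rayThetaPair_ε, rayThetaPair_g₀, Real.one_rpow, Complex.ofReal_one, mul_one, rayTheta]
    congr 1
    rw [Complex.cpow_def_of_ne_zero hz0, hlog]
    congr 1; ring
  · intro t
    -- The theta pair has Λ-function 2Λ(2s), so the critical line is Re s = 1/4; with frequency t
    -- the argument is 2s = 1/2 + 4πit.
    let s : ℂ := 1 / 4 + 2 * Real.pi * t * Complex.I
    have hsre : s.re = 1 / 4 := by simp [s]
    have hsim : s.im = 2 * Real.pi * t := by simp [s]
    have h1 := (hG s hsre).2
    rw [mellin_eq_fourier, hsre, hsim, mul_div_cancel_left₀ _ (by positivity)] at h1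
    have h2 : 𝓕 φ t = P.Λ s := h1
    rw [h2, hP, rayThetaPair_Λ hz, rayThetaPair_one_Λ]
    · have h3 : 2 * completedRiemannZeta (2 * s) = -(criticalXi t : ℂ) := by
        rw [criticalXi_eq]
        have : 2 * s = 1 / 2 + 4 * Real.pi * t * Complex.I := by simp only [s]; ring
        rw [this]; ring
      -- Rotating the ray by β produces the exponential weight e^{2πβt}.
      have h4 : z ^ (-s) = Complex.exp (-(β / 4) * Complex.I) * (Real.exp (2 * Real.pi * β * t) : ℂ) := by
        rw [Complex.cpow_def_of_ne_zero hz0, hlog, Complex.ofReal_exp, ← Complex.exp_add]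
        congr 1
        simp only [s]
        push_cast
        linear_combination (-(β : ℂ) * 2 * Real.pi * t) * Complex.I_mul_I
      rw [h3, h4]
      push_cast
      ring
    · intro h; rw [h] at hsre; norm_num at hsre
    · intro h; rw [h] at hsre; norm_num at hsre

/-- The limit of the Gaussian means of the exponential moments of `criticalXi`. -/
noncomputable def xiMoment (β : ℝ) : ℝ :=
  2 * Real.cos (β / 4) - (Complex.exp (β / 4 * Complex.I) *
    jacobiTheta (Complex.I * Complex.exp (β * Complex.I))).re

open FourierTransform in
-- The weighted `criticalXi` has the modulus of the Fourier transform of an integrable function,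
-- hence is bounded; no growth estimate for ζ is required.
lemma integrable_gaussian_mul_criticalXi {β : ℝ} (hβ : |β| < Real.pi / 2) {c : ℝ} (hc : 0 < c) :
    Integrable fun t : ℝ =>
      Real.exp (-c⁻¹ * t ^ 2) * (Real.exp (2 * Real.pi * β * t) * criticalXi t) := by
  obtain ⟨φ, hφ, -, -, hF⟩ := exists_fourier_eq_criticalXi hβ
  have hb : ∀ t, ‖Real.exp (2 * Real.pi * β * t) * criticalXi t‖ ≤ ∫ v, ‖φ v‖ := by
    intro t
    have h1 : ‖𝓕 φ t‖ ≤ ∫ v, ‖φ v‖ :=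
      VectorFourier.norm_fourierIntegral_le_integral_norm _ _ _ _ _
    rw [hF, norm_neg, norm_mul, Complex.norm_real] at h1
    have h2 : ‖Complex.exp (-(β / 4) * Complex.I)‖ = 1 := by
      have := Complex.norm_exp_ofReal_mul_I (-(β / 4))
      push_cast at this; exact this
    rwa [h2, one_mul] at h1
  refine (integrable_exp_neg_mul_sq (inv_pos.mpr hc)).mul_bdd (c := ∫ v, ‖φ v‖) ?_
    (Eventually.of_forall hb)
  exact (Continuous.mul (by fun_prop) continuous_criticalXi).aestronglyMeasurable

open FourierTransform in
-- Fourier inversion at 0, with Gaussian means replacing integrability of the transform. The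
-- unimodular factor e^{iβ/4} makes the integrand real.
lemma tendsto_gaussian_mul_criticalXi {β : ℝ} (hβ : |β| < Real.pi / 2) :
    Tendsto (fun c : ℝ => ∫ t : ℝ,
      Real.exp (-c⁻¹ * t ^ 2) * (Real.exp (2 * Real.pi * β * t) * criticalXi t)) atTop
      (𝓝 (xiMoment β)) := by
  obtain ⟨φ, hφ, hφ0, hφv, hF⟩ := exists_fourier_eq_criticalXi hβ
  have h := (tendsto_integral_gaussian_mul_fourier hφ hφ0).const_mul
    (-Complex.exp (β / 4 * Complex.I))
  have hre := (Complex.continuous_re.tendsto _).comp h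
  have e1 : (-Complex.exp (β / 4 * Complex.I) * φ 0).re = xiMoment β := by
    have h1 : -Complex.exp (β / 4 * Complex.I) * φ 0
        = 2 * Complex.cos (β / 4) - Complex.exp (β / 4 * Complex.I) *
          jacobiTheta (Complex.I * Complex.exp (β * Complex.I)) := by
      rw [hφv, Complex.two_cos]
      have : Complex.exp (-(β / 4 : ℂ) * Complex.I)
          = Complex.exp (β / 4 * Complex.I) * Complex.exp (-(β / 2) * Complex.I) := by
        rw [← Complex.exp_add]; congr 1; ring
      rw [this]; ring
    rw [h1, Complex.sub_re, xiMoment]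
    congr 1
    have : (2 * Complex.cos (β / 4) : ℂ) = ((2 * Real.cos (β / 4) : ℝ) : ℂ) := by push_cast; ring
    rw [this, Complex.ofReal_re]
  rw [e1] at hre
  refine hre.congr fun c => ?_
  simp only [Function.comp_apply]
  rw [← integral_const_mul]
  have : ∀ t : ℝ, -Complex.exp (β / 4 * Complex.I) * (Complex.exp (-c⁻¹ * t ^ 2) * 𝓕 φ t)
      = ((Real.exp (-c⁻¹ * t ^ 2) * (Real.exp (2 * Real.pi * β * t) * criticalXi t) : ℝ) : ℂ) := by
    intro t
    rw [hF]
    have h1 : Complex.exp (β / 4 * Complex.I) * Complex.exp (-(β / 4) * Complex.I) = 1 := by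
      rw [← Complex.exp_add]; simp
    have h2 : Complex.exp (-c⁻¹ * t ^ 2) = ((Real.exp (-c⁻¹ * t ^ 2) : ℝ) : ℂ) := by push_cast; rfl
    rw [h2]
    rw [Complex.ofReal_mul (Real.exp (-c⁻¹ * t ^ 2))]
    linear_combination ((Real.exp (-c⁻¹ * t ^ 2) : ℝ) : ℂ) * ((Real.exp (2 * Real.pi * β * t) * criticalXi t : ℝ) : ℂ) * h1
  simp only [this]
  rw [integral_complex_ofReal, Complex.ofReal_re]

/-- As β tends to π/2 or -π/2, the point i e^{iβ} tends to the cusp -1 or 1 along the unit circle,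
and the theta term is O(δ²). -/
lemma abs_xiMoment_sub_le {δ : ℝ} (h0 : 0 < δ) (h1 : δ ≤ 1 / 8) :
    |xiMoment (Real.pi / 2 - δ) - 2 * Real.cos (Real.pi / 8 - δ / 4)| ≤ 10 ^ 6 * δ ^ 2 ∧
    |xiMoment (-(Real.pi / 2 - δ)) - 2 * Real.cos (Real.pi / 8 - δ / 4)| ≤ 10 ^ 6 * δ ^ 2 := by
  have key : ∀ β : ℝ, Real.cos (β / 4) = Real.cos (Real.pi / 8 - δ / 4) →
      ‖jacobiTheta (Complex.I * Complex.exp (β * Complex.I))‖ ≤ 10 ^ 6 * δ ^ 2 →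
      |xiMoment β - 2 * Real.cos (Real.pi / 8 - δ / 4)| ≤ 10 ^ 6 * δ ^ 2 := by
    intro β hc hj
    rw [xiMoment, hc, sub_sub_cancel_left, abs_neg]
    refine (Complex.abs_re_le_norm _).trans ?_
    rw [norm_mul]
    have h2 : ‖Complex.exp (β / 4 * Complex.I)‖ = 1 := by
      have := Complex.norm_exp_ofReal_mul_I (β / 4)
      push_cast at this; exact this
    rw [h2, one_mul]
    exact hj
  have hI : Complex.exp (Real.pi / 2 * Complex.I) = Complex.I := Complex.exp_pi_div_two_mul_I
  constructor
  · refine key _ (by congr 1; ring) ?_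
    have : Complex.I * Complex.exp (((Real.pi / 2 - δ : ℝ) : ℂ) * Complex.I)
        = -Complex.exp (-(δ * Complex.I)) := by
      rw [show (((Real.pi / 2 - δ : ℝ) : ℂ) * Complex.I) = Real.pi / 2 * Complex.I + -(δ * Complex.I) by
        push_cast; ring, Complex.exp_add, hI, ← mul_assoc, Complex.I_mul_I]; ring
    rw [this]
    exact norm_jacobiTheta_neg_exp_le h0 h1
  · refine key _ (by rw [← Real.cos_neg]; congr 1; ring) ?_
    have : Complex.I * Complex.exp (((-(Real.pi / 2 - δ) : ℝ) : ℂ) * Complex.I)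
        = Complex.exp (δ * Complex.I) := by
      rw [show (((-(Real.pi / 2 - δ) : ℝ) : ℂ) * Complex.I) = δ * Complex.I + -(Real.pi / 2 * Complex.I)
        by push_cast; ring, Complex.exp_add, Complex.exp_neg, hI, Complex.inv_I]
      linear_combination (-Complex.exp (δ * Complex.I)) * Complex.I_mul_I
    rw [this]
    exact norm_jacobiTheta_exp_le h0 h1

/-- Adding the moments at β and -β turns the weight into 2 cosh(2πβt), which increases with |β|. -/
lemma xiMoment_add_le_of_nonneg (h : ∀ t, 0 ≤ criticalXi t) {a b : ℝ} (ha : 0 ≤ a) (hab : a ≤ b)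
    (hb : b < Real.pi / 2) : xiMoment a + xiMoment (-a) ≤ xiMoment b + xiMoment (-b) := by
  have hA : |a| < Real.pi / 2 := by rw [abs_of_nonneg ha]; linarith
  have hB : |b| < Real.pi / 2 := by rw [abs_of_nonneg (ha.trans hab)]; linarith
  have hA' : |-a| < Real.pi / 2 := by rwa [abs_neg]
  have hB' : |-b| < Real.pi / 2 := by rwa [abs_neg]
  refine le_of_tendsto_of_tendsto
    ((tendsto_gaussian_mul_criticalXi hA).add (tendsto_gaussian_mul_criticalXi hA'))
    ((tendsto_gaussian_mul_criticalXi hB).add (tendsto_gaussian_mul_criticalXi hB')) ?_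
  filter_upwards [Ioi_mem_atTop 0] with c (hc : 0 < c)
  rw [← integral_add (integrable_gaussian_mul_criticalXi hA hc)
    (integrable_gaussian_mul_criticalXi hA' hc), ← integral_add
    (integrable_gaussian_mul_criticalXi hB hc) (integrable_gaussian_mul_criticalXi hB' hc)]
  refine integral_mono ((integrable_gaussian_mul_criticalXi hA hc).add
    (integrable_gaussian_mul_criticalXi hA' hc)) ((integrable_gaussian_mul_criticalXi hB hc).add
    (integrable_gaussian_mul_criticalXi hB' hc)) fun t => ?_
  have key : ∀ β : ℝ, Real.exp (-c⁻¹ * t ^ 2) * (Real.exp (2 * Real.pi * β * t) * criticalXi t) +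
      Real.exp (-c⁻¹ * t ^ 2) * (Real.exp (2 * Real.pi * (-β) * t) * criticalXi t)
      = Real.exp (-c⁻¹ * t ^ 2) * criticalXi t * (2 * Real.cosh (2 * Real.pi * β * t)) := by
    intro β
    rw [Real.cosh_eq, show 2 * Real.pi * (-β) * t = -(2 * Real.pi * β * t) by ring]
    ring
  simp only
  rw [key, key]
  have := h t
  gcongr ?_ * (2 * ?_)
  rw [Real.cosh_le_cosh, abs_mul _ t, abs_mul _ t, abs_mul _ a, abs_mul _ b,
    abs_of_nonneg ha, abs_of_nonneg (ha.trans hab)]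
  gcongr

lemma xiMoment_nonpos (h : ∀ t, criticalXi t ≤ 0) {β : ℝ} (hβ : |β| < Real.pi / 2) :
    xiMoment β ≤ 0 := by
  refine le_of_tendsto (tendsto_gaussian_mul_criticalXi hβ) (Eventually.of_forall fun c => ?_)
  refine integral_nonpos fun t => ?_
  exact mul_nonpos_of_nonneg_of_nonpos (Real.exp_pos _).le
    (mul_nonpos_of_nonneg_of_nonpos (Real.exp_pos _).le (h t))

/-- The zeta function has a zero on the critical line. -/
theorem exists_riemannZeta_eq_zero_on_critical_line :
    ∃ t : ℝ, riemannZeta (1 / 2 + t * Complex.I) = 0 := by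
  refine exists_criticalXi_eq_zero_imp ?_
  by_contra! hne
  have hsign : (∀ t, 0 ≤ criticalXi t) ∨ ∀ t, criticalXi t ≤ 0 := by
    by_contra! hcon
    obtain ⟨⟨a, ha⟩, ⟨b, hb⟩⟩ := hcon
    obtain ⟨c, hc⟩ := mem_range_of_exists_le_of_exists_ge continuous_criticalXi ⟨a, ha.le⟩ ⟨b, hb.le⟩
    exact hne c hc
  have hpi := Real.pi_gt_three
  let q : ℝ → ℝ := fun δ => 4 * Real.cos (Real.pi / 8 - δ / 4) - 2 * 10 ^ 6 * δ ^ 2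
  have hqc : Continuous q := by fun_prop
  have hev : ∀ᶠ δ in 𝓝[>] (0 : ℝ), 0 < δ ∧ δ ≤ 1 / 8 := by
    filter_upwards [Ioc_mem_nhdsGT (show (0 : ℝ) < 1 / 8 by norm_num)] with δ hδ using hδ
  have hq0 : q 0 = 4 * Real.cos (Real.pi / 8) := by simp [q]
  have hqlim : Tendsto q (𝓝[>] 0) (𝓝 (q 0)) := hqc.continuousAt.mono_left nhdsWithin_le_nhds
  rcases hsign with h | h
  -- Nonnegative case. Monotonicity of the symmetric moments, with the inner endpoint ε sent to 0,
  -- gives a maximum of q at 0. But the derivative of q at 0 is sin(π/8) > 0, since the theta error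
  -- is only quadratic in δ.
  · have hle : ∀ δ, 0 < δ → δ ≤ 1 / 8 → q δ ≤ q 0 := by
      intro δ h0 h1
      let p : ℝ → ℝ := fun δ => 4 * Real.cos (Real.pi / 8 - δ / 4) + 2 * 10 ^ 6 * δ ^ 2
      have hpc : Continuous p := by fun_prop
      have hplim : Tendsto p (𝓝[>] 0) (𝓝 (q 0)) := by
        have := (hpc.tendsto 0).mono_left (nhdsWithin_le_nhds (s := Ioi 0))
        simpa [p, q] using this
      refine ge_of_tendsto hplim ?_
      filter_upwards [Ioc_mem_nhdsGT h0] with ε hε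
      have m := xiMoment_add_le_of_nonneg h (a := Real.pi / 2 - δ) (b := Real.pi / 2 - ε)
        (by linarith) (by linarith [hε.2]) (by linarith [hε.1])
      have b1 := abs_xiMoment_sub_le h0 h1
      have b2 := abs_xiMoment_sub_le hε.1 (hε.2.trans h1)
      simp only [abs_le] at b1 b2
      simp only [q, p]
      linarith [b1.1.1, b1.2.1, b2.1.2, b2.2.2]
    have hder : HasDerivAt q (Real.sin (Real.pi / 8)) 0 := by
      have h1 : HasDerivAt (fun δ : ℝ => Real.pi / 8 - δ / 4) (-(1 / 4)) 0 :=
        ((hasDerivAt_id (0 : ℝ)).div_const 4).const_sub _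
      have h2 := (h1.cos.const_mul 4).sub (((hasDerivAt_id (0 : ℝ)).pow 2).const_mul (2 * 10 ^ 6))
      refine h2.congr_deriv ?_
      simp only [id]
      ring_nf
    have hslope := hder.tendsto_slope_zero_right
    have hs : 0 < Real.sin (Real.pi / 8) := Real.sin_pos_of_pos_of_lt_pi (by linarith) (by linarith)
    refine absurd (le_of_tendsto hslope (b := 0) ?_) (not_le.mpr hs)
    filter_upwards [hev] with δ hδ
    rw [zero_add, smul_eq_mul]
    exact mul_nonpos_of_nonneg_of_nonpos (inv_pos.mpr hδ.1).le
      (sub_nonpos.mpr (hle δ hδ.1 hδ.2))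
  -- Nonpositive case: all moments are nonpositive, yet their symmetric sum tends to 4 cos(π/8) > 0.
  · have hle : q 0 ≤ 0 := by
      refine le_of_tendsto hqlim ?_
      filter_upwards [hev] with δ hδ
      have hA : |Real.pi / 2 - δ| < Real.pi / 2 := by
        rw [abs_lt]; constructor <;> linarith [hδ.1, hδ.2]
      have b := abs_xiMoment_sub_le hδ.1 hδ.2
      simp only [abs_le] at b
      have m1 := xiMoment_nonpos h hA
      have m2 := xiMoment_nonpos h (β := -(Real.pi / 2 - δ)) (by rwa [abs_neg])
      simp only [q]
      linarith [b.1.1, b.2.1]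
    rw [hq0] at hle
    have : 0 < Real.cos (Real.pi / 8) := Real.cos_pos_of_mem_Ioo ⟨by linarith, by linarith⟩
    linarith

/-! ### A Tauberian theorem for sums over lengths -/

section Tauberian

open FourierTransform

variable {ι : Type*}

/-- The normalized sum `x⁻ᴰ ∑ ψ (ℓ x)` at `x = exp X`. -/
noncomputable def lengthSum (ℓ : ι → ℝ) (ψ : ℝ → ℝ) (D X : ℝ) : ℝ :=
  ∑' i, Real.exp (-D * X) * ψ (ℓ i * Real.exp X)

/-- The fractional part, the truncation and the indicator of [1, ∞) are all dominated by min(u, 1),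
so this serves for the three kernels. -/
lemma summable_comp_of_abs_le_min {ℓ : ι → ℝ} (hpos : ∀ i, 0 < ℓ i) (hsum : Summable ℓ) {ψ : ℝ → ℝ}
    (hψ : ∀ u, 0 < u → |ψ u| ≤ min u 1) {x : ℝ} (hx : 0 < x) : Summable fun i => ψ (ℓ i * x) := by
  refine Summable.of_norm_bounded (hsum.mul_right x) fun i => ?_
  exact (hψ _ (mul_pos (hpos i) hx)).trans (min_le_left _ _)

lemma abs_fract_le_min {u : ℝ} (hu : 0 < u) : |Int.fract u| ≤ min u 1 := by
  rw [Int.abs_fract]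
  refine le_min ?_ (Int.fract_lt_one u).le
  have : (0 : ℝ) ≤ ⌊u⌋ := by exact_mod_cast Int.floor_nonneg.mpr hu.le
  linarith [Int.self_sub_floor u]

lemma abs_min_one_le {u : ℝ} (hu : 0 < u) : |min u 1| ≤ min u 1 :=
  (abs_of_pos (lt_min hu zero_lt_one)).le

/-- One dyadic step: for u < 1 the term {u} suffices, for 1 ≤ u < 2 the term 2{u/2} = u does, and
for u ≥ 2 both truncations equal 1. -/
lemma min_one_le_add_fract {u : ℝ} (hu : 0 < u) :
    min u 1 ≤ min (u / 2) 1 + (Int.fract u + 2 * Int.fract (u / 2)) := by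
  have h1 := Int.fract_nonneg u
  have h2 := Int.fract_nonneg (u / 2)
  have h3 : 0 < min (u / 2) 1 := lt_min (by linarith) zero_lt_one
  rcases lt_or_ge u 1 with h | h
  · rw [Int.fract_eq_self.mpr ⟨hu.le, h⟩]
    linarith [min_le_left u 1]
  · rcases lt_or_ge u 2 with h' | h'
    · have := Int.fract_eq_self.mpr (⟨by linarith, by linarith⟩ : 0 ≤ u / 2 ∧ u / 2 < 1)
      rw [this]
      linarith [min_le_right u 1]
    · rw [min_eq_right (by linarith : (1 : ℝ) ≤ u / 2)]
      linarith [min_le_right u 1]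

/-- A bound `O(xᴰ)` for the sum of fractional parts gives one for the sum of `min (ℓ x) 1`. -/
lemma exists_tsum_min_le {ℓ : ι → ℝ} (hpos : ∀ i, 0 < ℓ i) (hsum : Summable ℓ) {D : ℝ} (hD : 0 < D)
    (hD1 : D < 1) (hO : (fun x : ℝ => ∑' i, Int.fract (ℓ i * x)) =O[atTop] fun x : ℝ => x ^ D) :
    ∃ B, 0 ≤ B ∧ ∀ x, 0 < x → ∑' i, min (ℓ i * x) 1 ≤ B * x ^ D := by
  have hs1 : ∀ x, 0 < x → Summable fun i => Int.fract (ℓ i * x) := fun x hx =>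
    summable_comp_of_abs_le_min hpos hsum (fun u hu => abs_fract_le_min hu) hx
  have hs2 : ∀ x, 0 < x → Summable fun i => min (ℓ i * x) 1 := fun x hx =>
    summable_comp_of_abs_le_min (ψ := fun u => min u 1) hpos hsum (fun u hu => abs_min_one_le hu) hx
  have hle : ∀ x, 0 < x → ∀ ψ : ℝ → ℝ, (∀ u, 0 < u → |ψ u| ≤ min u 1) →
      ∑' i, ψ (ℓ i * x) ≤ (∑' i, ℓ i) * x := by
    intro x hx ψ hψ
    rw [← tsum_mul_right]
    refine Summable.tsum_le_tsum (fun i => ?_) (summable_comp_of_abs_le_min hpos hsum hψ hx)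
      (hsum.mul_right x)
    exact (le_abs_self _).trans ((hψ _ (mul_pos (hpos i) hx)).trans (min_le_left _ _))
  have hL : 0 ≤ ∑' i, ℓ i := tsum_nonneg fun i => (hpos i).le
  have hpow : ∀ x : ℝ, 0 < x → x ≤ 1 → x ≤ x ^ D := fun x hx hx1 => by
    simpa using Real.rpow_le_rpow_of_exponent_ge hx hx1 hD1.le
  -- The bound at infinity is made uniform on x > 0, since the dyadic descent reaches small x; there
  -- the trivial bound x Σ ℓ_i is used.
  obtain ⟨C, hC⟩ : ∃ C, 0 ≤ C ∧ ∀ x, 0 < x → ∑' i, Int.fract (ℓ i * x) ≤ C * x ^ D := by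
    obtain ⟨c, hc⟩ := hO.bound
    obtain ⟨R, hR⟩ := eventually_atTop.mp hc
    set R' := max R 1 with hR'
    have hR1 : 1 ≤ R' := le_max_right _ _
    refine ⟨max c ((∑' i, ℓ i) * R'), le_max_of_le_right (by positivity), fun x hx => ?_⟩
    rcases le_total R' x with h | h
    · have := hR x ((le_max_left _ _).trans h)
      rw [Real.norm_of_nonneg (Real.rpow_nonneg hx.le D)] at this
      refine (le_abs_self _).trans (this.trans ?_)
      gcongr
      exact le_max_left _ _
    · refine (hle x hx _ fun u hu => abs_fract_le_min hu).trans ?_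
      have h1 : x ≤ R' * x ^ D := by
        rcases le_total x 1 with h2 | h2
        · have := hpow x hx h2
          have := Real.rpow_nonneg hx.le D
          nlinarith
        · have : 1 ≤ x ^ D := Real.one_le_rpow h2 hD.le
          nlinarith
      calc (∑' i, ℓ i) * x ≤ (∑' i, ℓ i) * (R' * x ^ D) := by gcongr
        _ = ((∑' i, ℓ i) * R') * x ^ D := by ring
        _ ≤ _ := by gcongr; exact le_max_right _ _
  have h2D : (2 : ℝ) ^ (-D) < 1 := Real.rpow_lt_one_of_one_lt_of_neg one_lt_two (by linarith)
  -- `B` is large enough that 2^{-D} B + 3C ≤ B, which closes the passage from x/2 to x; the first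
  -- entry handles x ≤ 1.
  set B := max (∑' i, ℓ i) (3 * C / (1 - 2 ^ (-D))) with hB
  refine ⟨B, le_max_of_le_left hL, ?_⟩
  have main : ∀ n : ℕ, ∀ x : ℝ, 0 < x → x ≤ 2 ^ n → ∑' i, min (ℓ i * x) 1 ≤ B * x ^ D := by
    intro n
    induction n with
    | zero =>
      intro x hx hx1
      refine (hle x hx (fun u => min u 1) fun u hu => abs_min_one_le hu).trans ?_
      have := hpow x hx (by simpa using hx1)
      calc (∑' i, ℓ i) * x ≤ (∑' i, ℓ i) * x ^ D := by gcongr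
        _ ≤ _ := by gcongr; exact le_max_left _ _
    | succ n ih =>
      intro x hx hxn
      have hx2 : 0 < x / 2 := by linarith
      have h1 := ih (x / 2) hx2 (by rw [pow_succ] at hxn; linarith)
      have h2 : ∑' i, min (ℓ i * x) 1 ≤ ∑' i, (min (ℓ i * (x / 2)) 1 +
          (Int.fract (ℓ i * x) + 2 * Int.fract (ℓ i * (x / 2)))) := by
        refine Summable.tsum_le_tsum (fun i => ?_) (hs2 x hx)
          ((hs2 _ hx2).add ((hs1 x hx).add ((hs1 _ hx2).mul_left 2)))
        have := min_one_le_add_fract (mul_pos (hpos i) hx)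
        rwa [mul_div_assoc] at this
      rw [Summable.tsum_add (hs2 _ hx2) ((hs1 x hx).add ((hs1 _ hx2).mul_left 2)),
        Summable.tsum_add (hs1 x hx) ((hs1 _ hx2).mul_left 2), tsum_mul_left] at h2
      have h3 := hC.2 x hx
      have h4 := hC.2 (x / 2) hx2
      have h5 : (x / 2) ^ D = 2 ^ (-D) * x ^ D := by
        rw [Real.div_rpow hx.le two_pos.le, Real.rpow_neg two_pos.le]; field_simp
      have hxD : 0 ≤ x ^ D := Real.rpow_nonneg hx.le D
      have h6 : (x / 2) ^ D ≤ x ^ D := Real.rpow_le_rpow hx2.le (by linarith) hD.le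
      have h7 : 3 * C ≤ B * (1 - 2 ^ (-D)) := by
        rw [← div_le_iff₀ (by linarith)]; exact le_max_right _ _
      have h8 : C * (x / 2) ^ D ≤ C * x ^ D := by gcongr; exact hC.1
      rw [h5] at h1
      nlinarith [mul_le_mul_of_nonneg_right h7 hxD]
  intro x hx
  obtain ⟨n, hn⟩ := pow_unbounded_of_one_lt x one_lt_two
  exact main n x hx hn.le

lemma lengthSum_eq (ℓ : ι → ℝ) (ψ : ℝ → ℝ) (D X : ℝ) :
    lengthSum ℓ ψ D X = Real.exp (-D * X) * ∑' i, ψ (ℓ i * Real.exp X) := tsum_mul_left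

lemma lengthSum_eq_rpow (ℓ : ι → ℝ) (ψ : ℝ → ℝ) (D : ℝ) {x : ℝ} (hx : 0 < x) :
    lengthSum ℓ ψ D (Real.log x) = x ^ (-D) * ∑' i, ψ (ℓ i * x) := by
  rw [lengthSum_eq, Real.exp_log hx, Real.rpow_def_of_pos hx, mul_comm (-D)]

/-- The kernel on the additive group attached to `ψ`. -/
noncomputable def lengthKernel (ψ : ℝ → ℝ) (D u : ℝ) : ℂ :=
  Real.exp (D * u) • ((ψ (Real.exp (-u)) : ℝ) : ℂ)

/-- In the variable log x every length contributes a translate of one kernel, shifted by log ℓ and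
weighted by ℓ^D. -/
lemma ofReal_summand_eq (ψ : ℝ → ℝ) {l : ℝ} (hl : 0 < l) (D X y : ℝ) :
    ((Real.exp (-D * (X - y)) * ψ (l * Real.exp (X - y)) : ℝ) : ℂ)
      = (l ^ D : ℝ) * lengthKernel ψ D (y - (X + Real.log l)) := by
  have h1 : Real.exp (-(y - (X + Real.log l))) = l * Real.exp (X - y) := by
    rw [show -(y - (X + Real.log l)) = Real.log l + (X - y) by ring, Real.exp_add, Real.exp_log hl]
  have h2 : Real.exp (-D * (X - y)) = l ^ D * Real.exp (D * (y - (X + Real.log l))) := by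
    rw [Real.rpow_def_of_pos hl, ← Real.exp_add]; congr 1; ring
  rw [lengthKernel, h1, h2, Complex.real_smul]
  push_cast
  ring

/-- The multiplication formula for the Fourier transform, the translation by v becoming a phase. The
right side depends on κ and G only through the product of G with the transform of κ, so a factor can
be moved from one to the other. -/
lemma integral_comp_sub_mul_fourier {κ : ℝ → ℂ} (hκ : Integrable κ) {G : ℝ → ℂ}
    (hG : Integrable G) (v : ℝ) :
    ∫ y, κ (y - v) * 𝓕 G y
      = ∫ ξ : ℝ, Complex.exp (-(2 * Real.pi * v * ξ) * Complex.I) * (𝓕 κ ξ * G ξ) := by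
  have hκv : Integrable fun y => κ (y - v) := hκ.comp_sub_right v
  have h := VectorFourier.integral_fourierIntegral_smul_eq_flip (L := innerₗ ℝ)
      Real.continuous_fourierChar continuous_inner hκv hG
  have hflip : (innerₗ ℝ).flip = innerₗ ℝ := by ext; simp
  rw [hflip] at h
  refine Eq.trans ?_ (h.symm.trans ?_)
  · rfl
  · refine integral_congr_ae (Eventually.of_forall fun ξ => ?_)
    simp only [smul_eq_mul]
    rw [← mul_assoc]
    congr 1
    change 𝓕 (fun y => κ (y - v)) ξ = _
    rw [Real.fourier_eq', Real.fourier_eq', ← integral_const_mul]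
    conv_lhs => rw [← integral_add_right_eq_self _ v]
    refine integral_congr_ae (Eventually.of_forall fun y => ?_)
    simp only [smul_eq_mul, ← mul_assoc, ← Complex.exp_add, RCLike.inner_apply, conj_trivial,
      add_sub_cancel_right]
    congr 2
    push_cast; ring

/-- All finite partial sums of ‖F i y‖ are at most B‖g y‖; this justifies the interchange without
any convergence of Σ ℓ^D. -/
lemma lengthSum_integral_eq_tsum [Countable ι] {ℓ : ι → ℝ} (hpos : ∀ i, 0 < ℓ i)
    (hsum : Summable ℓ) {D B : ℝ}
    (hB : ∀ X, lengthSum ℓ (fun u => min u 1) D X ≤ B) {ψ : ℝ → ℝ} (hψm : Measurable ψ)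
    (hψ : ∀ u, 0 < u → |ψ u| ≤ min u 1) {g : ℝ → ℂ} (hg : Integrable g) (X : ℝ) :
    ∫ y, ((lengthSum ℓ ψ D (X - y) : ℝ) : ℂ) * g y
      = ∑' i, ((ℓ i ^ D : ℝ) : ℂ) * ∫ y, lengthKernel ψ D (y - (X + Real.log (ℓ i))) * g y := by
  let F : ι → ℝ → ℂ := fun i y =>
    ((Real.exp (-D * (X - y)) * ψ (ℓ i * Real.exp (X - y)) : ℝ) : ℂ) * g y
  have hs : ∀ (φ : ℝ → ℝ), (∀ u, 0 < u → |φ u| ≤ min u 1) → ∀ Y,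
      Summable fun i => Real.exp (-D * Y) * φ (ℓ i * Real.exp Y) := fun φ hφ Y =>
    (summable_comp_of_abs_le_min hpos hsum hφ (Real.exp_pos Y)).mul_left _
  have hsmin := hs (fun u => min u 1) fun u hu => abs_min_one_le hu
  have hFn : ∀ i y, ‖F i y‖ ≤ (Real.exp (-D * (X - y)) * min (ℓ i * Real.exp (X - y)) 1) * ‖g y‖ := by
    intro i y
    simp only [F, norm_mul, Complex.norm_real, Real.norm_eq_abs, Real.abs_exp]
    gcongr
    exact hψ _ (mul_pos (hpos i) (Real.exp_pos _))
  have hsumB : ∀ (s : Finset ι) y, ∑ i ∈ s, ‖F i y‖ ≤ B * ‖g y‖ := by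
    intro s y
    refine (Finset.sum_le_sum fun i _ => hFn i y).trans ?_
    rw [← Finset.sum_mul]
    gcongr
    refine le_trans ?_ (hB (X - y))
    refine (hsmin (X - y)).sum_le_tsum s fun i _ => ?_
    have := mul_pos (hpos i) (Real.exp_pos (X - y))
    positivity
  have hFm : ∀ i, AEStronglyMeasurable (F i) volume := by
    intro i
    refine AEStronglyMeasurable.mul (Measurable.aestronglyMeasurable ?_) hg.1
    refine Complex.measurable_ofReal.comp ?_
    fun_prop
  have hFi : ∀ i, Integrable (F i) := fun i => by
    refine (hg.norm.const_mul B).mono' (hFm i) (Eventually.of_forall fun y => ?_)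
    simpa using hsumB {i} y
  have hFs : Summable fun i => ∫ y, ‖F i y‖ := by
    refine summable_of_sum_le (c := ∫ y, B * ‖g y‖) (fun i => integral_nonneg fun y => norm_nonneg _)
      fun s => ?_
    rw [← integral_finsetSum _ fun i _ => (hFi i).norm]
    exact integral_mono (integrable_finsetSum _ fun i _ => (hFi i).norm) (hg.norm.const_mul B)
      fun y => hsumB s y
  have key := (hasSum_integral_of_summable_integral_norm hFi hFs).tsum_eq
  have e1 : ∀ y, ∑' i, F i y = ((lengthSum ℓ ψ D (X - y) : ℝ) : ℂ) * g y := by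
    intro y
    simp only [F, lengthSum]
    rw [tsum_mul_right, Complex.ofReal_tsum]
  simp only [e1] at key
  rw [← key]
  refine tsum_congr fun i => ?_
  rw [← integral_const_mul]
  refine integral_congr_ae (Eventually.of_forall fun y => ?_)
  simp only [F]
  rw [ofReal_summand_eq ψ (hpos i), mul_assoc]

/-- Σ min(ℓx, 1) increases in x and its quotient by x decreases, so the logarithmic slope of the
normalized sum lies between -D and 1 - D; boundedness by B turns this into a Lipschitz bound. -/
lemma abs_lengthSum_min_sub_le {ℓ : ι → ℝ} (hpos : ∀ i, 0 < ℓ i) (hsum : Summable ℓ) {D B : ℝ}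
    (hD : 0 < D) (hD1 : D < 1) (hB : ∀ X, lengthSum ℓ (fun u => min u 1) D X ≤ B) (X Y : ℝ) :
    |lengthSum ℓ (fun u => min u 1) D X - lengthSum ℓ (fun u => min u 1) D Y| ≤ B * |X - Y| := by
  set Φ := lengthSum ℓ (fun u => min u 1) D with hΦ
  have hΦ0 : ∀ X, 0 ≤ Φ X := fun X => tsum_nonneg fun i => by
    have := mul_pos (hpos i) (Real.exp_pos X)
    positivity
  have hs : ∀ Y, Summable fun i => min (ℓ i * Real.exp Y) 1 := fun Y =>
    summable_comp_of_abs_le_min (ψ := fun u => min u 1) hpos hsum (fun u hu => abs_min_one_le hu)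
      (Real.exp_pos Y)
  have hexp : ∀ a t : ℝ, 0 ≤ a → a ≤ 1 → 0 ≤ t → 1 - t ≤ Real.exp (-(a * t)) := fun a t ha ha1 ht => by
    have := Real.add_one_le_exp (-(a * t))
    nlinarith
  have key : ∀ X Y, X ≤ Y → |Φ X - Φ Y| ≤ B * (Y - X) := by
    intro X Y hXY
    have ht : 0 ≤ Y - X := by linarith
    have h1 : Real.exp (-(D * (Y - X))) * Φ X ≤ Φ Y := by
      rw [hΦ, lengthSum_eq, lengthSum_eq, ← mul_assoc, ← Real.exp_add,
        show -(D * (Y - X)) + -D * X = -D * Y by ring]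
      gcongr
      · exact hs X
      · exact hs Y
      · exact (hpos _).le
    have h2 : Real.exp (-((1 - D) * (Y - X))) * Φ Y ≤ Φ X := by
      rw [hΦ, lengthSum_eq, lengthSum_eq, ← mul_assoc, ← Real.exp_add,
        show -((1 - D) * (Y - X)) + -D * Y = -D * X + -(Y - X) by ring, Real.exp_add, mul_assoc,
        ← tsum_mul_left]
      gcongr ?_ * ?_
      refine Summable.tsum_le_tsum (fun i => ?_) ((hs Y).mul_left _) (hs X)
      have e : Real.exp (-(Y - X)) * Real.exp Y = Real.exp X := by rw [← Real.exp_add]; congr 1; ring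
      refine le_min ?_ ?_
      · calc _ ≤ Real.exp (-(Y - X)) * (ℓ i * Real.exp Y) := by gcongr; exact min_le_left _ _
          _ = _ := by rw [← e]; ring
      · have hY := mul_pos (hpos i) (Real.exp_pos Y)
        exact mul_le_one₀ (Real.exp_le_one_iff.mpr (by linarith)) (by positivity)
          (min_le_right _ _)
    have h3 := hexp D (Y - X) hD.le hD1.le ht
    have h4 := hexp (1 - D) (Y - X) (by linarith) (by linarith) ht
    have h5 := mul_le_mul_of_nonneg_right h3 (hΦ0 X)
    have h6 := mul_le_mul_of_nonneg_right h4 (hΦ0 Y)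
    have h7 := mul_le_mul_of_nonneg_right (hB X) ht
    have h8 := mul_le_mul_of_nonneg_right (hB Y) ht
    rw [abs_le]
    constructor <;> nlinarith
  rcases le_total X Y with h | h
  · rw [abs_of_nonpos (by linarith : X - Y ≤ 0), neg_sub]
    exact key X Y h
  · rw [abs_sub_comm, abs_of_nonneg (by linarith : 0 ≤ X - Y)]
    exact key Y X h

end Tauberian

/-! ### Mellin transforms of the kernels, smoothing, and the Tauberian theorem. -/

section Tauberian

open FourierTransform

variable {ι : Type*}

lemma hasMellin_min_one {s : ℂ} (hs : 0 < s.re) (hs1 : s.re < 1) :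
    HasMellin (fun t : ℝ => ((min t 1 : ℝ) : ℂ)) (-s) (1 / (s * (1 - s))) := by
  have hne : 1 - s ≠ 0 := fun h => by
    have := congrArg Complex.re h; simp at this; linarith
  have hs0 : s ≠ 0 := by rintro rfl; simp at hs
  have h1 := hasMellin_cpow_Ioc 1 (s := -s) (by simpa using hs1)
  have h2 : HasMellin ((Ioi (1 : ℝ)).indicator fun _ => (1 : ℂ)) (-s) (1 / s) := by
    have hre : (-s - 1).re < -1 := by simp only [Complex.sub_re, Complex.neg_re, Complex.one_re]; linarith
    have hi := integrableOn_Ioi_cpow_of_lt hre zero_lt_one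
    constructor
    · simp only [MellinConvergent, ← indicator_smul]
      rw [IntegrableOn, integrable_indicator_iff measurableSet_Ioi, IntegrableOn,
        Measure.restrict_restrict_of_subset (Ioi_subset_Ioi zero_le_one)]
      exact hi.congr_fun (fun x _ => (mul_one _).symm) measurableSet_Ioi
    · simp only [mellin, ← indicator_smul]
      rw [integral_indicator measurableSet_Ioi,
        Measure.restrict_restrict_of_subset (Ioi_subset_Ioi zero_le_one)]
      simp only [smul_eq_mul, mul_one]
      rw [integral_Ioi_cpow_of_lt hre zero_lt_one, sub_add_cancel, Complex.ofReal_one,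
        Complex.one_cpow, neg_div_neg_eq]
  have h3 := hasMellin_add h1.1 h2.1
  rw [h1.2, h2.2] at h3
  have he : ∀ t ∈ Ioi (0 : ℝ), (t : ℂ) ^ (-s - 1) •
      ((Ioc (0 : ℝ) 1).indicator (fun t : ℝ => (t : ℂ) ^ (1 : ℂ)) t
        + (Ioi (1 : ℝ)).indicator (fun _ => (1 : ℂ)) t)
      = (t : ℂ) ^ (-s - 1) • ((min t 1 : ℝ) : ℂ) := by
    intro t ht
    have ht0 : 0 < t := ht
    congr 1
    rcases le_or_gt t 1 with h | h
    · simp [ht0, h, not_lt.mpr h]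
    · simp [h, not_le.mpr h, h.le]
  refine ⟨h3.1.congr_fun he measurableSet_Ioi, ?_⟩
  have : mellin (fun t : ℝ => ((min t 1 : ℝ) : ℂ)) (-s) = _ :=
    (setIntegral_congr_fun measurableSet_Ioi he).symm
  rw [this]
  refine h3.2.trans ?_
  have h4 : -s + 1 ≠ 0 := fun h => hne (by linear_combination h)
  field_simp
  ring

lemma integrable_lengthKernel {ψ : ℝ → ℝ} {D : ℝ}
    (h : MellinConvergent (fun t => ((ψ t : ℝ) : ℂ)) (-(D : ℂ))) :
    Integrable (lengthKernel ψ D) := by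
  have := integrable_mellin_kernel (σ := -D) (by simpa using h)
  refine this.congr (Eventually.of_forall fun u => ?_)
  simp only [lengthKernel, neg_neg]

/-- The Fourier transform of the kernel samples the Mellin transform along the line Re s = D, so
only zeros of ζ on that line matter. -/
lemma fourier_lengthKernel (ψ : ℝ → ℝ) (D ξ : ℝ) :
    𝓕 (lengthKernel ψ D) ξ
      = mellin (fun t => ((ψ t : ℝ) : ℂ)) (-(D - 2 * Real.pi * ξ * Complex.I)) := by
  rw [mellin_eq_fourier]
  have h1 : (-(D - 2 * Real.pi * ξ * Complex.I)).re = -D := by simp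
  have h2 : (-(D - 2 * Real.pi * ξ * Complex.I)).im = 2 * Real.pi * ξ := by simp
  rw [h1, h2, mul_div_cancel_left₀ _ (by positivity)]
  simp only [neg_neg]
  rfl

/-- Such G are Schwartz functions. The first moment of the transform is what measures the smoothing
error of a Lipschitz function. -/
lemma integrable_fourier_of_contDiff {G : ℝ → ℂ} (hG : ContDiff ℝ ((⊤ : ℕ∞) : WithTop ℕ∞) G)
    (hGc : HasCompactSupport G) :
    Integrable G ∧ Integrable (𝓕 G) ∧ Integrable (fun y => |y| * ‖𝓕 G y‖) ∧ ∫ y, 𝓕 G y = G 0 := by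
  let S : SchwartzMap ℝ ℂ := hGc.toSchwartzMap hG
  have hS : (S : ℝ → ℂ) = G := rfl
  have hF : ((𝓕 S : SchwartzMap ℝ ℂ) : ℝ → ℂ) = 𝓕 G := by
    rw [SchwartzMap.fourier_coe]; rfl
  have i1 : Integrable G := hS ▸ S.integrable
  have i2 : Integrable (𝓕 G) := hF ▸ (𝓕 S).integrable
  refine ⟨i1, i2, ?_, ?_⟩
  · have := (𝓕 S).integrable_pow_mul volume 1
    rw [hF] at this
    simpa using this
  · have h := congrFun (hG.continuous.fourierInv_fourier_eq i1 i2) 0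
    rw [Real.fourierInv_eq'] at h
    simpa using h

lemma measurable_lengthSum [Countable ι] {ℓ : ι → ℝ} (hpos : ∀ i, 0 < ℓ i) (hsum : Summable ℓ)
    {ψ : ℝ → ℝ} (hψm : Measurable ψ) (hψ : ∀ u, 0 < u → |ψ u| ≤ min u 1) (D : ℝ) :
    Measurable (lengthSum ℓ ψ D) := by
  refine measurable_of_tendsto_metrizable' (atTop : Filter (Finset ι))
    (f := fun s X => ∑ i ∈ s, Real.exp (-D * X) * ψ (ℓ i * Real.exp X)) (fun s => ?_) ?_
  · fun_prop
  · rw [tendsto_pi_nhds]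
    intro X
    exact ((summable_comp_of_abs_le_min hpos hsum hψ (Real.exp_pos X)).mul_left _).hasSum

/-- Smoothed form of the Tauberian theorem: division by the zeta function on the line `Re s = D`
turns an asymptotic for the fractional parts into one for `min (ℓ x) 1`. -/
lemma tendsto_lengthSum_min_conv [Countable ι] {ℓ : ι → ℝ} (hpos : ∀ i, 0 < ℓ i) (hsum : Summable ℓ)
    {D B C : ℝ} (hD : 0 < D) (hD1 : D < 1) (hζ : ∀ t : ℝ, riemannZeta (D + t * Complex.I) ≠ 0)
    (hB : ∀ X, lengthSum ℓ (fun u => min u 1) D X ≤ B)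
    (hC : Tendsto (lengthSum ℓ Int.fract D) atTop (𝓝 C)) {G : ℝ → ℂ}
    (hG : ContDiff ℝ ((⊤ : ℕ∞) : WithTop ℕ∞) G) (hGc : HasCompactSupport G) :
    Tendsto (fun X => ∫ y, ((lengthSum ℓ (fun u => min u 1) D (X - y) : ℝ) : ℂ) * 𝓕 G y) atTop
      (𝓝 (-C / ((1 - D) * riemannZeta D) * G 0)) := by
  let s : ℝ → ℂ := fun ξ => D - 2 * Real.pi * ξ * Complex.I
  have hsre : ∀ ξ, (s ξ).re = D := fun ξ => by simp [s]
  have hsζ : ∀ ξ, riemannZeta (s ξ) ≠ 0 := fun ξ => by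
    have := hζ (-(2 * Real.pi * ξ))
    have e : (D + ((-(2 * Real.pi * ξ) : ℝ) : ℂ) * Complex.I) = s ξ := by
      simp only [s]; push_cast; ring
    rwa [e] at this
  have hs1 : ∀ ξ, s ξ ≠ 1 := fun ξ h => by
    have := hsre ξ; rw [h] at this; simp at this; linarith
  have hs0 : ∀ ξ, s ξ ≠ 0 := fun ξ h => by
    have := hsre ξ; rw [h] at this; simp at this; linarith
  -- The factor is the quotient of the Mellin transforms of min(t, 1) and {t}. `H` is again smooth
  -- with compact support because ζ does not vanish on the line.
  let H : ℝ → ℂ := fun ξ => G ξ * (-((1 - s ξ) * riemannZeta (s ξ))⁻¹)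
  have hsC : ContDiff ℝ ((⊤ : ℕ∞) : WithTop ℕ∞) s := by
    simp only [s]
    exact contDiff_const.sub ((contDiff_const.mul Complex.ofRealCLM.contDiff).mul contDiff_const)
  have hζC : ContDiff ℝ ((⊤ : ℕ∞) : WithTop ℕ∞) fun ξ => riemannZeta (s ξ) := by
    rw [contDiff_iff_contDiffAt]
    intro ξ
    have h1 : ContDiffAt ℂ ((⊤ : ℕ∞) : WithTop ℕ∞) riemannZeta (s ξ) :=
      (analyticOn_riemannZeta (s ξ) (hs1 ξ)).contDiffAt
    exact (h1.restrict_scalars ℝ).comp ξ hsC.contDiffAt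
  have hH : ContDiff ℝ ((⊤ : ℕ∞) : WithTop ℕ∞) H :=
    hG.mul (((contDiff_const.sub hsC).mul hζC).inv fun ξ =>
      mul_ne_zero (sub_ne_zero.mpr (Ne.symm (hs1 ξ))) (hsζ ξ)).neg
  have hHc : HasCompactSupport H := hGc.mul_right
  obtain ⟨iG, iFG, -, -⟩ := integrable_fourier_of_contDiff hG hGc
  obtain ⟨iH, iFH, -, hH0⟩ := integrable_fourier_of_contDiff hH hHc
  have hm1 := fun ξ => hasMellin_min_one (s := s ξ) (by rw [hsre]; exact hD) (by rw [hsre]; exact hD1)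
  have hm2 := fun ξ => hasMellin_fract (s := s ξ) (by rw [hsre]; exact hD) (by rw [hsre]; exact hD1)
  have hs00 : s 0 = D := by simp [s]
  have k1 : Integrable (lengthKernel (fun u => min u 1) D) :=
    integrable_lengthKernel (by have := (hm1 0).1; rwa [hs00] at this)
  have k2 : Integrable (lengthKernel Int.fract D) :=
    integrable_lengthKernel (by have := (hm2 0).1; rwa [hs00] at this)
  have hker : ∀ v, ∫ y, lengthKernel (fun u => min u 1) D (y - v) * 𝓕 G y
      = ∫ y, lengthKernel Int.fract D (y - v) * 𝓕 H y := by
    intro v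
    rw [integral_comp_sub_mul_fourier k1 iG, integral_comp_sub_mul_fourier k2 iH]
    refine integral_congr_ae (Eventually.of_forall fun ξ => ?_)
    simp only
    congr 1
    rw [fourier_lengthKernel, fourier_lengthKernel, (hm1 ξ).2, (hm2 ξ).2]
    have h1 := sub_ne_zero.mpr (Ne.symm (hs1 ξ))
    have h2 := hsζ ξ
    have h3 := hs0 ξ
    simp only [H]
    field_simp
  have hconv : ∀ X, ∫ y, ((lengthSum ℓ (fun u => min u 1) D (X - y) : ℝ) : ℂ) * 𝓕 G y
      = ∫ y, ((lengthSum ℓ Int.fract D (X - y) : ℝ) : ℂ) * 𝓕 H y := by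
    intro X
    rw [lengthSum_integral_eq_tsum hpos hsum hB (by fun_prop) (fun u hu => abs_min_one_le hu) iFG,
      lengthSum_integral_eq_tsum hpos hsum hB measurable_fract (fun u hu => abs_fract_le_min hu) iFH]
    simp only [hker]
  simp only [hconv]
  -- By Fourier inversion the integral of the transform of `H` is H(0), which gives the constant.
  have hlim : -C / ((1 - D) * riemannZeta D) * G 0 = ∫ y, (C : ℂ) * 𝓕 H y := by
    rw [integral_const_mul, hH0]
    simp only [H, hs00]
    ring
  rw [hlim]
  have hmeas := measurable_lengthSum hpos hsum measurable_fract (fun u hu => abs_fract_le_min hu) D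
  refine tendsto_integral_filter_of_dominated_convergence (fun y => B * ‖𝓕 H y‖) ?_ ?_
    (iFH.norm.const_mul B) ?_
  · refine Eventually.of_forall fun X => AEStronglyMeasurable.mul ?_ iFH.1
    exact (Complex.measurable_ofReal.comp (hmeas.comp (by fun_prop))).aestronglyMeasurable
  · refine Eventually.of_forall fun X => Eventually.of_forall fun y => ?_
    rw [norm_mul, Complex.norm_real]
    gcongr
    have hnn : 0 ≤ lengthSum ℓ Int.fract D (X - y) := tsum_nonneg fun i =>
      mul_nonneg (Real.exp_pos _).le (Int.fract_nonneg _)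
    rw [Real.norm_of_nonneg hnn]
    refine le_trans ?_ (hB (X - y))
    refine Summable.tsum_le_tsum (fun i => ?_)
      ((summable_comp_of_abs_le_min hpos hsum (fun u hu => abs_fract_le_min hu)
        (Real.exp_pos _)).mul_left _)
      ((summable_comp_of_abs_le_min (ψ := fun u => min u 1) hpos hsum (fun u hu => abs_min_one_le hu)
        (Real.exp_pos _)).mul_left _)
    gcongr
    exact (le_abs_self _).trans (abs_fract_le_min (mul_pos (hpos i) (Real.exp_pos _)))
  · refine Eventually.of_forall fun y => Tendsto.mul_const _ ?_
    exact (Complex.continuous_ofReal.tendsto C).comp (hC.comp (tendsto_atTop_add_const_right _ (-y) tendsto_id))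

/-- A Lipschitz function whose band-limited means converge to the same limit converges. -/
lemma tendsto_of_forall_tendsto_conv_fourier {Φ : ℝ → ℝ} {B : ℝ}
    (hΦ : ∀ X Y, |Φ X - Φ Y| ≤ B * |X - Y|) {M : ℂ}
    (h : ∀ G : ℝ → ℂ, ContDiff ℝ ((⊤ : ℕ∞) : WithTop ℕ∞) G → HasCompactSupport G →
      Tendsto (fun X => ∫ y, ((Φ (X - y) : ℝ) : ℂ) * 𝓕 G y) atTop (𝓝 (M * G 0))) :
    Tendsto (fun X => ((Φ X : ℝ) : ℂ)) atTop (𝓝 M) := by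
  have hB0 : 0 ≤ B := by
    have := (abs_nonneg _).trans (hΦ 1 0)
    simpa using this
  have hcont : Continuous Φ := by
    have : LipschitzWith B.toNNReal Φ := LipschitzWith.of_dist_le_mul fun X Y => by
      rw [Real.coe_toNNReal _ hB0]; exact hΦ X Y
    exact this.continuous
  let b : ContDiffBump (0 : ℝ) := ⟨1, 2, one_pos, one_lt_two⟩
  let G₀ : ℝ → ℂ := fun x => ((b x : ℝ) : ℂ)
  have hG₀ : ContDiff ℝ ((⊤ : ℕ∞) : WithTop ℕ∞) G₀ := Complex.ofRealCLM.contDiff.comp b.contDiff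
  have hG₀c : HasCompactSupport G₀ := b.hasCompactSupport.comp_left (g := fun x : ℝ => (x : ℂ)) (by simp)
  have hG₀0 : G₀ 0 = 1 := by
    simp only [G₀]
    rw [b.one_of_mem_closedBall (by simp [b])]; simp
  obtain ⟨i0, i1, i2, h0⟩ := integrable_fourier_of_contDiff hG₀ hG₀c
  rw [hG₀0] at h0
  set K := ∫ y, |y| * ‖𝓕 G₀ y‖ with hK
  have hK0 : 0 ≤ K := integral_nonneg fun y => by positivity
  rw [Metric.tendsto_atTop]
  intro ε hε
  -- Dilating `G₀` by `lam` concentrates its transform at scale 1/`lam`; the smoothing error B K /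
  -- `lam` is then below ε/2.
  obtain ⟨lam, hlam⟩ := exists_gt (max 1 (2 * B * K / ε))
  have hlam1 : 1 < lam := (le_max_left _ _).trans_lt hlam
  have hlam0 : 0 < lam := by linarith
  have hlam2 : B * K / lam < ε / 2 := by
    have := (le_max_right _ _).trans_lt hlam
    rw [div_lt_iff₀ hε] at this
    rw [div_lt_iff₀ hlam0]
    linarith
  let G : ℝ → ℂ := fun ξ => G₀ (lam⁻¹ * ξ)
  have hG : ContDiff ℝ ((⊤ : ℕ∞) : WithTop ℕ∞) G := hG₀.comp (contDiff_const.mul contDiff_id)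
  have hGc : HasCompactSupport G := by
    have := hG₀c.comp_homeomorph (Homeomorph.mulLeft₀ lam⁻¹ (inv_ne_zero hlam0.ne'))
    exact this
  have hF : ∀ y, 𝓕 G y = lam * 𝓕 G₀ (lam * y) := by
    intro y
    rw [Real.fourier_eq', Real.fourier_eq']
    have := Measure.integral_comp_mul_left (fun v : ℝ => Complex.exp (((-2 * Real.pi * inner ℝ v (lam * y) : ℝ) : ℂ) * Complex.I) • G₀ v) lam⁻¹
    rw [inv_inv, abs_of_pos hlam0, Complex.real_smul] at this
    rw [← this]
    refine integral_congr_ae (Eventually.of_forall fun v => ?_)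
    simp only [RCLike.inner_apply, conj_trivial, G]
    congr 5
    field_simp
  have hconv : ∀ X, ∫ y, ((Φ (X - y) : ℝ) : ℂ) * 𝓕 G y
      = ∫ y, ((Φ (X - lam⁻¹ * y) : ℝ) : ℂ) * 𝓕 G₀ y := by
    intro X
    have := Measure.integral_comp_mul_left (fun y : ℝ => ((Φ (X - lam⁻¹ * y) : ℝ) : ℂ) * 𝓕 G₀ y) lam
    rw [abs_of_pos (inv_pos.mpr hlam0)] at this
    have e : ∀ y : ℝ, ((Φ (X - y) : ℝ) : ℂ) * 𝓕 G y
        = lam * (((Φ (X - lam⁻¹ * (lam * y)) : ℝ) : ℂ) * 𝓕 G₀ (lam * y)) := by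
      intro y
      rw [hF, inv_mul_cancel_left₀ hlam0.ne']; ring
    simp only [e]
    rw [integral_const_mul, this, Complex.real_smul, ← mul_assoc]
    push_cast
    rw [mul_inv_cancel₀ (by exact_mod_cast hlam0.ne'), one_mul]
  have hdiff : ∀ X, ‖(∫ y, ((Φ (X - y) : ℝ) : ℂ) * 𝓕 G y) - ((Φ X : ℝ) : ℂ)‖ ≤ B * K / lam := by
    intro X
    have hb : ∀ y, ‖(((Φ (X - lam⁻¹ * y) : ℝ) : ℂ) - ((Φ X : ℝ) : ℂ)) * 𝓕 G₀ y‖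
        ≤ B * lam⁻¹ * (|y| * ‖𝓕 G₀ y‖) := by
      intro y
      rw [norm_mul, ← Complex.ofReal_sub, Complex.norm_real, ← mul_assoc]
      gcongr
      refine (hΦ _ _).trans (le_of_eq ?_)
      rw [sub_sub_cancel_left, abs_neg, abs_mul, abs_of_pos (inv_pos.mpr hlam0), mul_assoc]
    have iD : Integrable fun y => (((Φ (X - lam⁻¹ * y) : ℝ) : ℂ) - ((Φ X : ℝ) : ℂ)) * 𝓕 G₀ y := by
      refine (i2.const_mul (B * lam⁻¹)).mono' ?_ (Eventually.of_forall hb)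
      refine AEStronglyMeasurable.mul (Continuous.aestronglyMeasurable ?_) i1.1
      fun_prop
    have e1 : (∫ y, ((Φ (X - lam⁻¹ * y) : ℝ) : ℂ) * 𝓕 G₀ y) - ((Φ X : ℝ) : ℂ)
        = ∫ y, (((Φ (X - lam⁻¹ * y) : ℝ) : ℂ) - ((Φ X : ℝ) : ℂ)) * 𝓕 G₀ y := by
      have i3 : Integrable fun y => ((Φ X : ℝ) : ℂ) * 𝓕 G₀ y := i1.const_mul _
      have i4 : Integrable fun y => ((Φ (X - lam⁻¹ * y) : ℝ) : ℂ) * 𝓕 G₀ y :=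
        (iD.add i3).congr (Eventually.of_forall fun y => by simp only [Pi.add_apply]; ring)
      simp only [sub_mul]
      rw [integral_sub i4 i3, integral_const_mul, h0, mul_one]
    rw [hconv, e1]
    calc _ ≤ ∫ y, B * lam⁻¹ * (|y| * ‖𝓕 G₀ y‖) :=
          norm_integral_le_of_norm_le (i2.const_mul _) (Eventually.of_forall hb)
      _ = B * K / lam := by rw [integral_const_mul]; ring
  have hG0 : G 0 = 1 := by simp only [G, mul_zero, hG₀0]
  have hlim := h G hG hGc
  rw [hG0, mul_one, Metric.tendsto_atTop] at hlim
  obtain ⟨R, hR⟩ := hlim (ε / 2) (by linarith)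
  refine ⟨R, fun X hX => ?_⟩
  have h1 := hR X hX
  rw [dist_eq_norm] at h1 ⊢
  have h2 := hdiff X
  rw [norm_sub_rev] at h2
  calc ‖((Φ X : ℝ) : ℂ) - M‖ = ‖(((Φ X : ℝ) : ℂ) - ∫ y, ((Φ (X - y) : ℝ) : ℂ) * 𝓕 G y)
        + ((∫ y, ((Φ (X - y) : ℝ) : ℂ) * 𝓕 G y) - M)‖ := by ring_nf
    _ ≤ _ := norm_add_le _ _
    _ < ε := by linarith

/-- If the zeta function has no zero on the line `Re s = D`, an asymptotic `C xᴰ` for the sum of the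
fractional parts of `ℓ x` implies one for the sum of `min (ℓ x) 1`. -/
theorem exists_tendsto_tsum_min [Countable ι] {ℓ : ι → ℝ} (hpos : ∀ i, 0 < ℓ i) (hsum : Summable ℓ)
    {D C : ℝ} (hD : 0 < D) (hD1 : D < 1) (hζ : ∀ t : ℝ, riemannZeta (D + t * Complex.I) ≠ 0)
    (hC : C ≠ 0) (hO : (fun x : ℝ => (∑' i, Int.fract (ℓ i * x)) - C * x ^ D) =o[atTop]
      fun x : ℝ => x ^ D) :
    ∃ M, 0 < M ∧ Tendsto (fun x : ℝ => x ^ (-D) * ∑' i, min (ℓ i * x) 1) atTop (𝓝 M) := by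
  have hlim : Tendsto (fun x : ℝ => x ^ (-D) * ∑' i, Int.fract (ℓ i * x)) atTop (𝓝 C) := by
    have h1 := hO.tendsto_div_nhds_zero.add_const C
    rw [zero_add] at h1
    refine h1.congr' ?_
    filter_upwards [eventually_gt_atTop 0] with x hx
    have : 0 < x ^ D := Real.rpow_pos_of_pos hx D
    rw [Real.rpow_neg hx.le]
    generalize (∑' i, Int.fract (ℓ i * x)) = a
    field_simp
    ring
  have hbig : (fun x : ℝ => ∑' i, Int.fract (ℓ i * x)) =O[atTop] fun x : ℝ => x ^ D := by
    have := hO.isBigO.add ((isBigO_refl (fun x : ℝ => x ^ D) atTop).const_mul_left C)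
    simpa using this
  obtain ⟨B, -, hB⟩ := exists_tsum_min_le hpos hsum hD hD1 hbig
  have hB' : ∀ X, lengthSum ℓ (fun u => min u 1) D X ≤ B := by
    intro X
    rw [lengthSum_eq]
    have := mul_le_mul_of_nonneg_left (hB _ (Real.exp_pos X)) (Real.exp_pos (-D * X)).le
    refine this.trans (le_of_eq ?_)
    rw [← Real.exp_mul, mul_left_comm, ← Real.exp_add]
    rw [show -D * X + X * D = 0 by ring, Real.exp_zero, mul_one]
  have hC' : Tendsto (lengthSum ℓ Int.fract D) atTop (𝓝 C) := by
    refine (hlim.comp Real.tendsto_exp_atTop).congr fun X => ?_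
    rw [Function.comp_apply, ← lengthSum_eq_rpow ℓ Int.fract D (Real.exp_pos X), Real.log_exp]
  have hCpos : 0 < C := by
    refine lt_of_le_of_ne (ge_of_tendsto' hC' fun X => ?_) (Ne.symm hC)
    exact tsum_nonneg fun i => mul_nonneg (Real.exp_pos _).le (Int.fract_nonneg _)
  obtain ⟨z, hz, hζD⟩ := exists_riemannZeta_eq_neg hD hD1
  have h1 := tendsto_of_forall_tendsto_conv_fourier
    (abs_lengthSum_min_sub_le hpos hsum hD hD1 hB')
    (M := -C / ((1 - D) * riemannZeta D)) fun G hG hGc =>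
      tendsto_lengthSum_min_conv hpos hsum hD hD1 hζ hB' hC' hG hGc
  -- Positive because C > 0 (a limit of nonnegative sums, and nonzero) and ζ(D) = -z < 0.
  refine ⟨C / ((1 - D) * z), by have := sub_pos.mpr hD1; positivity, ?_⟩
  have h2 := (Complex.continuous_re.tendsto _).comp h1
  have e : (-(C : ℂ) / ((1 - D) * riemannZeta D)) = ((C / ((1 - D) * z) : ℝ) : ℂ) := by
    rw [hζD]; push_cast
    rw [mul_neg, neg_div_neg_eq]
  rw [e, Complex.ofReal_re] at h2
  refine (h2.comp Real.tendsto_log_atTop).congr' ?_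
  filter_upwards [eventually_gt_atTop 0] with x hx
  simp only [Function.comp_apply, Complex.ofReal_re]
  exact lengthSum_eq_rpow ℓ _ D hx

end Tauberian

/-! ### Lengths whose counting function oscillates -/

section Oscillation

variable {ι : Type*}

/-- The number of indices `i` with `ℓ i * x ≥ 1`. -/
noncomputable def lengthCount (ℓ : ι → ℝ) (x : ℝ) : ℝ :=
  ∑' i, (Ici (1 : ℝ)).indicator 1 (ℓ i * x)

lemma abs_indicator_Ici_le_min {u : ℝ} (hu : 0 < u) :
    |(Ici (1 : ℝ)).indicator (1 : ℝ → ℝ) u| ≤ min u 1 := by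
  by_cases h : 1 ≤ u
  · rw [indicator_of_mem (mem_Ici.mpr h)]
    simp [h]
  · rw [indicator_of_notMem (by simpa using h)]
    simp [hu.le]

lemma sum_indicator_Ici_div {u : ℝ} (hu : 0 < u) (K : ℕ) :
    ∑ n ∈ Finset.Icc 1 K, (Ici (1 : ℝ)).indicator (1 : ℝ → ℝ) (u / n)
      = ((min K ⌊u⌋₊ : ℕ) : ℝ) := by
  have h : ∀ n ∈ Finset.Icc 1 K, (Ici (1 : ℝ)).indicator (1 : ℝ → ℝ) (u / n)
      = if n ≤ ⌊u⌋₊ then 1 else 0 := by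
    intro n hn
    have hn0 : (0 : ℝ) < n := by exact_mod_cast (Finset.mem_Icc.mp hn).1
    simp only [indicator_apply, mem_Ici, one_le_div hn0, Nat.le_floor_iff hu.le, Pi.one_apply]
  rw [Finset.sum_congr rfl h, Finset.sum_boole]
  congr 1
  rw [show Finset.filter (fun n => n ≤ ⌊u⌋₊) (Finset.Icc 1 K) = Finset.Icc 1 (min K ⌊u⌋₊) by
    ext n; simp; omega]
  simp

/-- Cutting the count of integers n ≤ u at K: for u < K the formula {u} = u - ⌊u⌋ is exact, and for
u ≥ K the bracket is K - K = 0, leaving an error below 1. -/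
lemma abs_fract_sub_le {u : ℝ} (hu : 0 < u) {K : ℕ} (hK : 1 ≤ K) :
    |Int.fract u - (K * min (u / K) 1
      - ∑ n ∈ Finset.Icc 1 K, (Ici (1 : ℝ)).indicator (1 : ℝ → ℝ) (u / n))|
      ≤ (Ici (1 : ℝ)).indicator (1 : ℝ → ℝ) (u / K) := by
  have hK0 : (0 : ℝ) < K := by exact_mod_cast hK
  have hfl : Int.fract u = u - ⌊u⌋₊ := by
    rw [natCast_floor_eq_intCast_floor hu.le]; rfl
  rw [sum_indicator_Ici_div hu]
  rcases lt_or_ge u K with h | h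
  · have h1 : ⌊u⌋₊ ≤ K := Nat.floor_le_of_le h.le
    rw [min_eq_left ((div_le_one hK0).mpr h.le), min_eq_right h1, hfl,
      indicator_of_notMem (by rw [mem_Ici, not_le, div_lt_one hK0]; exact h), mul_div_cancel₀ _ hK0.ne']
    simp
  · have h1 : K ≤ ⌊u⌋₊ := Nat.le_floor h
    rw [min_eq_right ((one_le_div hK0).mpr h), min_eq_left h1,
      indicator_of_mem (mem_Ici.mpr ((one_le_div hK0).mpr h))]
    rw [mul_one, sub_self, sub_zero, Int.abs_fract]
    exact (Int.fract_lt_one u).le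

lemma abs_tsum_fract_sub_le {ℓ : ι → ℝ} (hpos : ∀ i, 0 < ℓ i) (hsum : Summable ℓ) {x : ℝ}
    (hx : 0 < x) {K : ℕ} (hK : 1 ≤ K) :
    |(∑' i, Int.fract (ℓ i * x)) - (K * (∑' i, min (ℓ i * (x / K)) 1)
      - ∑ n ∈ Finset.Icc 1 K, lengthCount ℓ (x / n))| ≤ lengthCount ℓ (x / K) := by
  have hpos' : ∀ n ∈ Finset.Icc 1 K, 0 < x / n := fun n hn =>
    div_pos hx (by exact_mod_cast (Finset.mem_Icc.mp hn).1)
  have hK' : 0 < x / K := hpos' K (by simp [hK])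
  have s1 := summable_comp_of_abs_le_min hpos hsum (fun u hu => abs_fract_le_min hu) hx
  have s2 := (summable_comp_of_abs_le_min (ψ := fun u => min u 1) hpos hsum
    (fun u hu => abs_min_one_le hu) hK').mul_left (K : ℝ)
  have s3 : ∀ n ∈ Finset.Icc 1 K, Summable fun i =>
      (Ici (1 : ℝ)).indicator (1 : ℝ → ℝ) (ℓ i * (x / n)) := fun n hn =>
    summable_comp_of_abs_le_min hpos hsum (fun u hu => abs_indicator_Ici_le_min hu) (hpos' n hn)
  have s4 := summable_sum s3
  unfold lengthCount
  rw [← tsum_mul_left, ← Summable.tsum_finsetSum s3, ← s2.tsum_sub s4, ← s1.tsum_sub (s2.sub s4)]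
  rw [← Real.norm_eq_abs]
  refine tsum_of_norm_bounded (s3 K (by simp [hK])).hasSum fun i => ?_
  simp only [← mul_div_assoc]
  exact abs_fract_sub_le (mul_pos (hpos i) hx) hK

/-- The truncation is an average of indicators over dilations, so asymptotics of the counting
function can be integrated. -/
lemma integral_indicator_Ici_div {u : ℝ} (hu : 0 < u) :
    IntegrableOn (fun v : ℝ => (Ici (1 : ℝ)).indicator (1 : ℝ → ℝ) (u / v)) (Ioc 0 1) ∧
      ∫ v in Ioc (0 : ℝ) 1, (Ici (1 : ℝ)).indicator (1 : ℝ → ℝ) (u / v) = min u 1 := by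
  have h : EqOn (fun v : ℝ => (Ici (1 : ℝ)).indicator (1 : ℝ → ℝ) (u / v))
      ((Ioc 0 u).indicator 1) (Ioc 0 1) := by
    intro v hv
    simp only [indicator_apply, mem_Ici, mem_Ioc, one_le_div hv.1, hv.1, true_and,
      Pi.one_apply]
  have hi : IntegrableOn ((Ioc 0 u).indicator (1 : ℝ → ℝ)) (Ioc 0 1) :=
    (integrable_indicator_iff measurableSet_Ioc).mpr (by
      rw [IntegrableOn, Measure.restrict_restrict measurableSet_Ioc]
      refine (integrable_const (1 : ℝ)).mono_measure (ν := volume.restrict (Ioc 0 u)) ?_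
      exact Measure.restrict_mono inter_subset_left le_rfl)
  refine ⟨hi.congr_fun h.symm measurableSet_Ioc, ?_⟩
  rw [setIntegral_congr_fun measurableSet_Ioc h, integral_indicator measurableSet_Ioc,
    Measure.restrict_restrict measurableSet_Ioc, Ioc_inter_Ioc]
  simp [hu.le]

lemma integral_lengthCount_div [Countable ι] {ℓ : ι → ℝ} (hpos : ∀ i, 0 < ℓ i) (hsum : Summable ℓ)
    {x : ℝ} (hx : 0 < x) :
    ∫ v in Ioc (0 : ℝ) 1, lengthCount ℓ (x / v) = ∑' i, min (ℓ i * x) 1 := by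
  have hi := fun i => integral_indicator_Ici_div (mul_pos (hpos i) hx)
  have h := hasSum_integral_of_summable_integral_norm (μ := volume.restrict (Ioc (0 : ℝ) 1))
    (F := fun i v => (Ici (1 : ℝ)).indicator (1 : ℝ → ℝ) (ℓ i * x / v)) (fun i => (hi i).1) (by
      have := summable_comp_of_abs_le_min (ψ := fun u => min u 1) hpos hsum
        (fun u hu => abs_min_one_le hu) hx
      refine this.congr fun i => ?_
      rw [← (hi i).2]
      refine integral_congr_ae (Eventually.of_forall fun v => ?_)
      exact (Real.norm_of_nonneg (indicator_nonneg (fun _ _ => zero_le_one) _)).symm)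
  rw [← tsum_congr fun i => (hi i).2, h.tsum_eq]
  simp only [lengthCount, mul_div_assoc]

lemma integral_cpow_div {s : ℂ} (hs : s.re < 1) {x : ℝ} (hx : 0 < x) :
    IntegrableOn (fun v : ℝ => ((x / v : ℝ) : ℂ) ^ s) (Ioc 0 1) ∧
      ∫ v in Ioc (0 : ℝ) 1, ((x / v : ℝ) : ℂ) ^ s = (x : ℂ) ^ s / (1 - s) := by
  have h : EqOn (fun v : ℝ => ((x / v : ℝ) : ℂ) ^ s) (fun v : ℝ => (x : ℂ) ^ s * (v : ℂ) ^ (-s))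
      (Ioc 0 1) := by
    intro v hv
    have hv0 : (v : ℂ) ≠ 0 := by exact_mod_cast hv.1.ne'
    simp only
    rw [div_eq_mul_inv, Complex.ofReal_mul, Complex.mul_cpow_ofReal_nonneg hx.le (inv_pos.mpr hv.1).le,
      Complex.ofReal_inv, Complex.inv_cpow _ _ (by
        rw [Complex.arg_ofReal_of_nonneg hv.1.le]; exact Real.pi_pos.ne), Complex.cpow_neg]
  have hr : -1 < (-s).re := by simpa using hs
  have hi : IntegrableOn (fun v : ℝ => (x : ℂ) ^ s * (v : ℂ) ^ (-s)) (Ioc 0 1) := by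
    have := intervalIntegral.intervalIntegrable_cpow' (a := 0) (b := 1) hr
    rw [intervalIntegrable_iff_integrableOn_Ioc_of_le zero_le_one] at this
    exact this.const_mul _
  refine ⟨hi.congr_fun h.symm measurableSet_Ioc, ?_⟩
  rw [setIntegral_congr_fun measurableSet_Ioc h, integral_const_mul,
    ← intervalIntegral.integral_of_le zero_le_one, integral_cpow (Or.inl hr)]
  have hs1 : -s + 1 ≠ 0 := by
    intro h0
    have := congrArg Complex.re h0
    simp at this
    linarith
  rw [Complex.ofReal_zero, Complex.zero_cpow hs1, Complex.ofReal_one, Complex.one_cpow, sub_zero,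
    neg_add_eq_sub, mul_one_div]

/-- An approximation of the counting function by a combination of powers gives one for the sum of
`min (ℓ x) 1`. -/
lemma abs_tsum_min_sub_le [Countable ι] {ℓ : ι → ℝ} (hpos : ∀ i, 0 < ℓ i) (hsum : Summable ℓ)
    {r s : ℂ} (hr : r.re < 1) (hs : s.re < 1) {β : ℂ}
    (hN : ∀ x, 0 < x → |lengthCount ℓ x - ((x : ℂ) ^ r + β * (x : ℂ) ^ s).re| ≤ 1) {x : ℝ}
    (hx : 0 < x) :
    |(∑' i, min (ℓ i * x) 1) - ((x : ℂ) ^ r / (1 - r) + β * ((x : ℂ) ^ s / (1 - s))).re| ≤ 1 := by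
  obtain ⟨i1, e1⟩ := integral_cpow_div hr hx
  obtain ⟨i2, e2⟩ := integral_cpow_div hs hx
  have i3 := i1.add (i2.const_mul β)
  have i3' : IntegrableOn (fun v : ℝ => (((x / v : ℝ) : ℂ) ^ r + β * ((x / v : ℝ) : ℂ) ^ s).re)
      (Ioc 0 1) := i3.re
  have e3 : ∫ v in Ioc (0 : ℝ) 1, (((x / v : ℝ) : ℂ) ^ r + β * ((x / v : ℝ) : ℂ) ^ s).re
      = ((x : ℂ) ^ r / (1 - r) + β * ((x : ℂ) ^ s / (1 - s))).re := by
    rw [← e1, ← e2, ← integral_const_mul, ← integral_add i1 (i2.const_mul β)]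
    exact integral_re i3
  have hm : AEStronglyMeasurable (fun v : ℝ => lengthCount ℓ (x / v)) (volume.restrict (Ioc 0 1)) := by
    have hmeas : Measurable (lengthCount ℓ) := by
      unfold lengthCount
      refine Measurable.tsum fun i => ?_
      exact (measurable_one.indicator measurableSet_Ici).comp (measurable_const_mul _)
    exact (hmeas.comp (by fun_prop)).aestronglyMeasurable
  have hb : ∀ v ∈ Ioc (0 : ℝ) 1, ‖lengthCount ℓ (x / v)
      - (((x / v : ℝ) : ℂ) ^ r + β * ((x / v : ℝ) : ℂ) ^ s).re‖ ≤ 1 := fun v hv =>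
    hN _ (div_pos hx hv.1)
  have i4 : IntegrableOn (fun v : ℝ => lengthCount ℓ (x / v)
      - (((x / v : ℝ) : ℂ) ^ r + β * ((x / v : ℝ) : ℂ) ^ s).re) (Ioc 0 1) := by
    refine (integrable_const (1 : ℝ)).mono' (hm.sub i3'.1) ?_
    filter_upwards [ae_restrict_mem measurableSet_Ioc] with v hv using hb v hv
  have i5 : IntegrableOn (fun v : ℝ => lengthCount ℓ (x / v)) (Ioc 0 1) :=
    (i4.add i3').congr (Eventually.of_forall fun v => by simp)
  rw [← integral_lengthCount_div hpos hsum hx, ← e3, ← integral_sub i5 i3']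
  have := norm_setIntegral_le_of_norm_le_const (μ := volume) (s := Ioc (0 : ℝ) 1) (by simp) hb
  simpa using this

/-- Inserting the powers into the truncated formula makes the corrected partial sums of ζ(r) and
ζ(s) appear. One K in the error comes from the K counting terms, the other from the truncated sum
multiplied by K. -/
lemma exists_abs_tsum_fract_sub_le [Countable ι] {ℓ : ι → ℝ} (hpos : ∀ i, 0 < ℓ i)
    (hsum : Summable ℓ) {r s : ℂ} (hr : r.re < 1) (hs : s.re < 1) {β : ℂ}
    (hN : ∀ x, 0 < x → |lengthCount ℓ x - ((x : ℂ) ^ r + β * (x : ℂ) ^ s).re| ≤ 1) {x : ℝ}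
    (hx : 0 < x) {K : ℕ} (hK : 1 ≤ K) :
    |(∑' i, Int.fract (ℓ i * x))
      + ((x : ℂ) ^ r * (∑ n ∈ Finset.Icc 1 K, (n : ℂ) ^ (-r) - (K : ℂ) ^ (1 - r) / (1 - r))
        + β * (x : ℂ) ^ s *
          (∑ n ∈ Finset.Icc 1 K, (n : ℂ) ^ (-s) - (K : ℂ) ^ (1 - s) / (1 - s))).re|
      ≤ lengthCount ℓ (x / K) + 2 * K := by
  have hpow : ∀ (n : ℕ) (z : ℂ), 1 ≤ n → ((x / n : ℝ) : ℂ) ^ z = (x : ℂ) ^ z * (n : ℂ) ^ (-z) := by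
    intro n z hn
    have hn0 : (0 : ℝ) < n := by exact_mod_cast hn
    rw [div_eq_mul_inv, Complex.ofReal_mul, Complex.mul_cpow_ofReal_nonneg hx.le (inv_pos.mpr hn0).le,
      Complex.ofReal_inv, Complex.inv_cpow _ _ (by
        rw [Complex.arg_ofReal_of_nonneg hn0.le]; exact Real.pi_pos.ne), Complex.cpow_neg]
    simp
  have hK0 : (0 : ℝ) < K := by exact_mod_cast hK
  have hKc : (K : ℂ) ≠ 0 := by exact_mod_cast hK0.ne'
  have h1 := abs_tsum_fract_sub_le hpos hsum hx hK
  have h2 := abs_tsum_min_sub_le hpos hsum hr hs hN (div_pos hx hK0)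
  have h3 : |(∑ n ∈ Finset.Icc 1 K, lengthCount ℓ (x / n))
      - ∑ n ∈ Finset.Icc 1 K, (((x / n : ℝ) : ℂ) ^ r + β * ((x / n : ℝ) : ℂ) ^ s).re| ≤ K := by
    rw [← Finset.sum_sub_distrib]
    refine (Finset.abs_sum_le_sum_abs _ _).trans ?_
    calc _ ≤ ∑ n ∈ Finset.Icc 1 K, (1 : ℝ) := Finset.sum_le_sum fun n hn =>
          hN (x / n) (div_pos hx (by exact_mod_cast (Finset.mem_Icc.mp hn).1))
      _ = K := by simp
  have e : ((x : ℂ) ^ r * (∑ n ∈ Finset.Icc 1 K, (n : ℂ) ^ (-r) - (K : ℂ) ^ (1 - r) / (1 - r))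
        + β * (x : ℂ) ^ s *
          (∑ n ∈ Finset.Icc 1 K, (n : ℂ) ^ (-s) - (K : ℂ) ^ (1 - s) / (1 - s))).re
      = (∑ n ∈ Finset.Icc 1 K, (((x / n : ℝ) : ℂ) ^ r + β * ((x / n : ℝ) : ℂ) ^ s).re)
        - K * (((x / K : ℝ) : ℂ) ^ r / (1 - r) + β * (((x / K : ℝ) : ℂ) ^ s / (1 - s))).re := by
    rw [← Complex.re_sum, ← Complex.re_ofReal_mul, ← Complex.sub_re]
    congr 1
    have hsum' : ∑ n ∈ Finset.Icc 1 K, (((x / n : ℝ) : ℂ) ^ r + β * ((x / n : ℝ) : ℂ) ^ s)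
        = ∑ n ∈ Finset.Icc 1 K, ((x : ℂ) ^ r * (n : ℂ) ^ (-r) + β * ((x : ℂ) ^ s * (n : ℂ) ^ (-s))) :=
      Finset.sum_congr rfl fun n hn => by
        rw [hpow n r (Finset.mem_Icc.mp hn).1, hpow n s (Finset.mem_Icc.mp hn).1]
    rw [hsum', hpow K r hK, hpow K s hK, Finset.sum_add_distrib, ← Finset.mul_sum, ← Finset.mul_sum, ← Finset.mul_sum,
      sub_eq_add_neg 1 r, sub_eq_add_neg 1 s, Complex.cpow_add _ _ hKc, Complex.cpow_add _ _ hKc]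
    simp only [Complex.cpow_one, Complex.ofReal_natCast]
    ring
  rw [e]
  set A := ∑' i, Int.fract (ℓ i * x)
  set A' := ∑' i, min (ℓ i * (x / K)) 1
  set S := ∑ n ∈ Finset.Icc 1 K, lengthCount ℓ (x / n)
  set S' := ∑ n ∈ Finset.Icc 1 K, (((x / n : ℝ) : ℂ) ^ r + β * ((x / n : ℝ) : ℂ) ^ s).re
  set W := (((x / K : ℝ) : ℂ) ^ r / (1 - r) + β * (((x / K : ℝ) : ℂ) ^ s / (1 - s))).re
  have h4 : |K * (A' - W)| ≤ K := by
    rw [abs_mul, abs_of_pos hK0]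
    exact mul_le_of_le_one_right hK0.le h2
  rw [abs_le] at *
  constructor <;> linarith [h1.1, h1.2, h3.1, h3.2, h4.1, h4.2]

/-- If the counting function is approximated by `Re (xᴰ + β xˢ)`, where `s` is a zero of the zeta
function on the line `Re s = D`, then the sum of the fractional parts is asymptotic to
`- ζ(D) xᴰ`. -/
theorem isLittleO_tsum_fract [Countable ι] {ℓ : ι → ℝ} (hpos : ∀ i, 0 < ℓ i)
    (hsum : Summable ℓ) {D z : ℝ} {s β : ℂ} (hD : 0 < D) (hD1 : D < 1) (hs : s.re = D)
    (hz : riemannZeta D = -(z : ℂ)) (hζ : riemannZeta s = 0)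
    (hN : ∀ x : ℝ, 0 < x → |lengthCount ℓ x - ((x : ℂ) ^ (D : ℂ) + β * (x : ℂ) ^ s).re| ≤ 1) :
    (fun x : ℝ => (∑' i, Int.fract (ℓ i * x)) - z * x ^ D) =o[atTop] fun x : ℝ => x ^ D := by
  have hDc : (D : ℂ).re = D := Complex.ofReal_re D
  have hD1c : (D : ℂ) ≠ 1 := by exact_mod_cast hD1.ne
  have hs1 : s ≠ 1 := by
    rintro rfl
    rw [Complex.one_re] at hs
    exact hD1.ne hs.symm
  have hnorm : ∀ x : ℝ, 0 < x → ∀ w : ℂ, w.re = D → ‖(x : ℂ) ^ w‖ = x ^ D := fun x hx w hw => by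
    rw [Complex.norm_cpow_eq_rpow_re_of_pos hx, hw]
  set P : ℂ → ℕ → ℂ := fun w K => ∑ n ∈ Finset.Icc 1 K, (n : ℂ) ^ (-w) - (K : ℂ) ^ (1 - w) / (1 - w)
    with hP
  have t1 := (tendsto_sum_cpow_sub_riemannZeta (s := D) (by rwa [hDc]) hD1c)
  have t2 := (tendsto_sum_cpow_sub_riemannZeta (s := s) (by rwa [hs]) hs1)
  rw [hζ] at t2
  rw [hz] at t1
  have hNle : ∀ x : ℝ, 0 < x → lengthCount ℓ x ≤ (1 + ‖β‖) * x ^ D + 1 := by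
    intro x hx
    have h1 := (abs_le.mp (hN x hx)).2
    have h2 := Complex.re_le_norm ((x : ℂ) ^ (D : ℂ) + β * (x : ℂ) ^ s)
    have h3 := norm_add_le ((x : ℂ) ^ (D : ℂ)) (β * (x : ℂ) ^ s)
    rw [norm_mul, hnorm x hx _ hDc, hnorm x hx _ hs] at h3
    linarith
  have t3 : Tendsto (fun K : ℕ => ‖P D K + z‖ + ‖β‖ * ‖P s K‖ + (1 + ‖β‖) * (K : ℝ) ^ (-D)) atTop
      (𝓝 0) := by
    have a1 := (t1.add_const (z : ℂ)).norm
    have a2 := t2.norm.const_mul ‖β‖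
    have a3 := ((tendsto_rpow_neg_atTop hD).comp tendsto_natCast_atTop_atTop).const_mul (1 + ‖β‖)
    have := (a1.add a2).add a3
    simpa using this
  rw [isLittleO_iff]
  intro ε hε
  -- `K` is fixed first, making every term proportional to x^D small; x is then taken large to
  -- absorb the constant 1 + 2K.
  obtain ⟨K, hK1, hK⟩ := ((eventually_ge_atTop 1).and (t3.eventually_lt_const (half_pos hε))).exists
  have hK0 : (0 : ℝ) < K := by exact_mod_cast hK1
  filter_upwards [eventually_gt_atTop 0,
    (tendsto_rpow_atTop hD).eventually_ge_atTop ((1 + 2 * K) / (ε / 2))] with x hx hxK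
  rw [div_le_iff₀ (half_pos hε)] at hxK
  have hxD : 0 < x ^ D := Real.rpow_pos_of_pos hx D
  have h1 := exists_abs_tsum_fract_sub_le hpos hsum (r := D) (s := s) (by simpa) (by rwa [hs]) hN
    hx hK1
  have h2 := hNle (x / K) (div_pos hx hK0)
  rw [Real.div_rpow hx.le hK0.le, div_eq_mul_inv (x ^ D), ← Real.rpow_neg hK0.le] at h2
  have e : ((x : ℂ) ^ (D : ℂ) * P D K + β * (x : ℂ) ^ s * P s K).re
      = ((x : ℂ) ^ (D : ℂ) * (P D K + z) + β * (x : ℂ) ^ s * P s K).re - z * x ^ D := by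
    rw [mul_add, add_right_comm, Complex.add_re (_ + _), ← Complex.ofReal_cpow hx.le,
      ← Complex.ofReal_mul, Complex.ofReal_re]
    ring
  have h3 : |((x : ℂ) ^ (D : ℂ) * (P D K + z) + β * (x : ℂ) ^ s * P s K).re|
      ≤ x ^ D * (‖P D K + z‖ + ‖β‖ * ‖P s K‖) := by
    refine (Complex.abs_re_le_norm _).trans ((norm_add_le _ _).trans (le_of_eq ?_))
    rw [norm_mul, norm_mul, norm_mul, hnorm x hx _ hDc, hnorm x hx _ hs]
    ring
  change |_ + ((x : ℂ) ^ (D : ℂ) * P D K + β * (x : ℂ) ^ s * P s K).re| ≤ _ at h1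
  rw [e] at h1
  rw [Real.norm_eq_abs, Real.norm_of_nonneg hxD.le]
  have h4 : x ^ D * (‖P D K + z‖ + ‖β‖ * ‖P s K‖ + (1 + ‖β‖) * (K : ℝ) ^ (-D)) ≤ x ^ D * (ε / 2) := by
    gcongr
  rw [abs_le] at *
  constructor <;> nlinarith [h1.1, h1.2, h3.1, h3.2]

lemma re_cpow_add {x : ℝ} (hx : 0 < x) (D τ β : ℝ) :
    ((x : ℂ) ^ (D : ℂ) + β * (x : ℂ) ^ (D + τ * Complex.I)).re
      = Real.exp (D * Real.log x) * (1 + β * Real.cos (τ * Real.log x)) := by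
  have hx0 : (x : ℂ) ≠ 0 := by exact_mod_cast hx.ne'
  rw [Complex.add_re, Complex.re_ofReal_mul, Complex.cpow_def_of_ne_zero hx0,
    Complex.cpow_def_of_ne_zero hx0, ← Complex.ofReal_log hx.le, Complex.exp_re, Complex.exp_re]
  simp
  ring_nf

/-- A counting function must increase, so the oscillation has to be small: its contribution to the
derivative, relative to e^{Dv}, is at most β(D + |τ|). -/
lemma strictMono_exp_mul_cos {D τ β : ℝ} (hβ : 0 < β) (h : β * (D + |τ|) < D) (hD : 0 < D) :
    StrictMono fun v : ℝ => Real.exp (D * v) * (1 + β * Real.cos (τ * v)) := by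
  refine strictMono_of_deriv_pos fun v => ?_
  have h1 : HasDerivAt (fun v : ℝ => Real.exp (D * v) * (1 + β * Real.cos (τ * v)))
      (Real.exp (D * v) * (D * 1) * (1 + β * Real.cos (τ * v))
        + Real.exp (D * v) * (β * (-Real.sin (τ * v) * (τ * 1)))) v :=
    (((hasDerivAt_id v).const_mul D).exp).mul
      (((((hasDerivAt_id v).const_mul τ).cos).const_mul β).const_add 1)
  rw [h1.deriv]
  have h2 : 0 < D + β * (D * Real.cos (τ * v) - τ * Real.sin (τ * v)) := by
    have a1 := Real.neg_one_le_cos (τ * v)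
    have a2 : τ * Real.sin (τ * v) ≤ |τ| := by
      refine (le_abs_self _).trans ?_
      rw [abs_mul]
      exact mul_le_of_le_one_right (abs_nonneg _) (Real.abs_sin_le_one _)
    have a3 : -(D + |τ|) ≤ D * Real.cos (τ * v) - τ * Real.sin (τ * v) := by nlinarith
    nlinarith
  have := mul_pos (Real.exp_pos (D * v)) h2
  linarith

/-- A zero of the zeta function on the line `Re s = D` yields lengths whose counting function has
regular fractional part sums but whose sums of `min (ℓ x) 1` oscillate. -/
theorem exists_oscillating_lengths {D τ : ℝ} (hD : 0 < D) (hD1 : D < 1) (hτ : τ ≠ 0) :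
    ∃ (ℓ : ℕ → ℝ) (β : ℝ), β ≠ 0 ∧ |β| ≤ 1 / 2 ∧ (∀ i, 0 < ℓ i) ∧ Summable ℓ ∧ ∀ x : ℝ, 0 < x →
      |lengthCount ℓ x - ((x : ℂ) ^ (D : ℂ) + β * (x : ℂ) ^ (D + τ * Complex.I)).re| ≤ 1 := by
  have hτ0 : 0 < |τ| := abs_pos.mpr hτ
  -- This gives β(D + |τ|) = D/2, which ensures monotonicity, and also β ≤ 1/2.
  set β := D / (2 * (D + |τ|)) with hβdef
  have hβ : 0 < β := by positivity
  have hβD : β * (D + |τ|) = D / 2 := by rw [hβdef]; field_simp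
  have hβ1 : β ≤ 1 / 2 := by
    rw [hβdef, div_le_div_iff₀ (by positivity) (by norm_num)]
    linarith
  set h : ℝ → ℝ := fun v => Real.exp (D * v) * (1 + β * Real.cos (τ * v)) with hh
  have hmono : StrictMono h := strictMono_exp_mul_cos hβ (by linarith) hD
  have hcont : Continuous h := by fun_prop
  have hup : ∀ v, h v ≤ 3 / 2 * Real.exp (D * v) := fun v => by
    have h1 : β * Real.cos (τ * v) ≤ 1 / 2 := by nlinarith [Real.cos_le_one (τ * v)]
    have := Real.exp_pos (D * v)
    simp only [hh]
    nlinarith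
  have hlow : ∀ v, Real.exp (D * v) / 2 ≤ h v := fun v => by
    have h1 : -(1 / 2) ≤ β * Real.cos (τ * v) := by nlinarith [Real.neg_one_le_cos (τ * v)]
    have := Real.exp_pos (D * v)
    simp only [hh]
    nlinarith
  have hsurj : ∀ j : ℕ, ∃ v, h v = j + 1 := fun j => by
    have hj : (0 : ℝ) < j + 1 := by positivity
    refine mem_range_of_exists_le_of_exists_ge hcont
      ⟨Real.log ((j + 1) / 2) / D, (hup _).trans ?_⟩ ⟨Real.log (2 * (j + 1)) / D, le_trans ?_ (hlow _)⟩
    · rw [mul_div_cancel₀ _ hD.ne', Real.exp_log (by positivity)]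
      linarith
    · rw [mul_div_cancel₀ _ hD.ne', Real.exp_log (by positivity)]
      linarith
  -- The lengths e^{-v_j} with h(v_j) = j + 1 have counting function exactly ⌊h(log x)⌋. From h(v) ≤
  -- (3/2)e^{Dv} they are at most a constant times (j + 1)^{-1/D}, which is summable as D < 1.
  choose v hv using hsurj
  refine ⟨fun j => Real.exp (-v j), β, hβ.ne', by rwa [abs_of_pos hβ], fun i => Real.exp_pos _, ?_, ?_⟩
  · have hs : Summable fun j : ℕ => (2 / 3 : ℝ) ^ (-(1 / D)) * ((j + 1 : ℕ) : ℝ) ^ (-(1 / D)) :=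
      ((summable_nat_add_iff 1).mpr (Real.summable_nat_rpow.mpr (by
        rw [neg_lt_neg_iff]; exact (one_lt_div hD).mpr hD1))).mul_left _
    refine hs.of_nonneg_of_le (fun j => (Real.exp_pos _).le) fun j => ?_
    have h1 := hup (v j)
    rw [hv] at h1
    have h2 : (2 / 3 : ℝ) * (j + 1) ≤ Real.exp (D * v j) := by linarith
    rw [← Real.mul_rpow (by norm_num) (by positivity)]
    have h3 := Real.rpow_le_rpow_of_nonpos (z := -(1 / D)) (by positivity) h2
      (by have := one_div_pos.mpr hD; linarith)
    push_cast
    refine le_trans (le_of_eq ?_) h3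
    rw [← Real.exp_mul]
    congr 1
    field_simp
  · intro x hx
    rw [re_cpow_add hx]
    change |_ - h (Real.log x)| ≤ 1
    have hpos : 0 ≤ h (Real.log x) := (by positivity : (0 : ℝ) ≤ _).trans (hlow (Real.log x))
    have hind : ∀ j, (Ici (1 : ℝ)).indicator (1 : ℝ → ℝ) (Real.exp (-v j) * x)
        = if j ∈ Finset.range ⌊h (Real.log x)⌋₊ then 1 else 0 := by
      intro j
      have : 1 ≤ Real.exp (-v j) * x ↔ j < ⌊h (Real.log x)⌋₊ := by
        rw [← Nat.succ_le_iff, Nat.le_floor_iff hpos, Nat.cast_succ, ← hv, hmono.le_iff_le,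
          Real.exp_neg, inv_mul_eq_div, one_le_div (Real.exp_pos _), Real.le_log_iff_exp_le hx]
      simp only [indicator_apply, mem_Ici, this, Finset.mem_range, Pi.one_apply]
    have hcount : lengthCount (fun j => Real.exp (-v j)) x = ⌊h (Real.log x)⌋₊ := by
      unfold lengthCount
      simp only [hind]
      rw [tsum_eq_sum (s := Finset.range ⌊h (Real.log x)⌋₊) fun j hj => if_neg hj,
        Finset.sum_congr rfl fun j hj => if_pos hj]
      simp
    rw [hcount, abs_le]
    have a1 := Nat.floor_le hpos
    have a2 := Nat.lt_floor_add_one (h (Real.log x))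
    constructor <;> linarith

/-- `Re (c e^{iτv})` has no limit as `v → ∞`. -/
lemma not_tendsto_re_mul_exp {τ : ℝ} (hτ : τ ≠ 0) {c : ℂ} (hc : c ≠ 0) (M : ℝ) :
    ¬ Tendsto (fun v : ℝ => (c * Complex.exp (τ * v * Complex.I)).re) atTop (𝓝 M) := by
  intro h
  have hτ0 : 0 < |τ| := abs_pos.mpr hτ
  -- A periodic function with a limit is constant. The values at 0, π/τ and π/(2τ) are then Re c,
  -- -Re c and -Im c, forcing c = 0.
  have key : ∀ v₀ : ℝ, (c * Complex.exp (τ * v₀ * Complex.I)).re = M := by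
    intro v₀
    have hseq : Tendsto (fun n : ℕ => v₀ + n * (2 * Real.pi / |τ|)) atTop atTop :=
      tendsto_atTop_add_const_left _ _
        (tendsto_natCast_atTop_atTop.atTop_mul_const (by have := Real.pi_pos; positivity))
    refine tendsto_nhds_unique (tendsto_const_nhds.congr fun n => ?_) (h.comp hseq)
    simp only [Function.comp_apply]
    congr 2
    rw [Complex.exp_eq_exp_iff_exists_int]
    rcases abs_choice τ with h' | h'
    · refine ⟨-n, ?_⟩
      rw [h']
      have : (τ : ℂ) ≠ 0 := by exact_mod_cast hτ
      push_cast
      field_simp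
      ring
    · refine ⟨n, ?_⟩
      rw [h']
      have : (τ : ℂ) ≠ 0 := by exact_mod_cast hτ
      push_cast
      field_simp
      ring
  have hτc : (τ : ℂ) ≠ 0 := by exact_mod_cast hτ
  have h0 := key 0
  have h1 := key (Real.pi / τ)
  have h2 := key (Real.pi / 2 / τ)
  push_cast at h0 h1 h2
  rw [mul_div_cancel₀ _ hτc, Complex.exp_pi_mul_I] at h1
  rw [mul_div_cancel₀ _ hτc, Complex.exp_pi_div_two_mul_I] at h2
  simp at h0 h1 h2
  refine hc (Complex.ext ?_ ?_) <;> simp <;> linarith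

/-- A zero of the zeta function on the line `Re s = D` yields lengths for which the sum of
fractional parts is asymptotic to a multiple of `xᴰ`, while the sum of `min (ℓ x) 1` is of order
`xᴰ` but not asymptotic to a multiple of it. -/
theorem exists_lengths_of_riemannZeta_eq_zero {D τ : ℝ} (hD : 0 < D) (hD1 : D < 1)
    (hζ : riemannZeta (D + τ * Complex.I) = 0) :
    ∃ (ℓ : ℕ → ℝ), (∀ i, 0 < ℓ i) ∧ Summable ℓ ∧
      (∃ C : ℝ, C ≠ 0 ∧ (fun x : ℝ => (∑' i, Int.fract (ℓ i * x)) - C * x ^ D) =o[atTop]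
        fun x : ℝ => x ^ D) ∧
      (∃ a, 0 < a ∧ ∀ᶠ x : ℝ in atTop, a ≤ x ^ (-D) * ∑' i, min (ℓ i * x) 1) ∧
      (∃ b, ∀ᶠ x : ℝ in atTop, x ^ (-D) * ∑' i, min (ℓ i * x) 1 ≤ b) ∧
      ∀ M, ¬ Tendsto (fun x : ℝ => x ^ (-D) * ∑' i, min (ℓ i * x) 1) atTop (𝓝 M) := by
  obtain ⟨z, hz, hzD⟩ := exists_riemannZeta_eq_neg hD hD1
  -- The zero cannot be real, because ζ is negative on (0, 1).
  have hτ : τ ≠ 0 := by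
    rintro rfl
    rw [Complex.ofReal_zero, zero_mul, add_zero, hzD, neg_eq_zero] at hζ
    exact hz.ne' (by exact_mod_cast hζ)
  obtain ⟨ℓ, β, hβ, hβ2, hpos, hsum, hN⟩ := exists_oscillating_lengths hD hD1 hτ
  have hs : (D + τ * Complex.I : ℂ).re = D := by simp
  set s : ℂ := D + τ * Complex.I with hsdef
  have hDc : (D : ℂ).re = D := Complex.ofReal_re D
  have hs1 : 1 - s ≠ 0 := by
    intro h
    have := congrArg Complex.re h
    rw [Complex.sub_re, hs] at this
    simp at this
    linarith
  have hmin := fun x hx => abs_tsum_min_sub_le hpos hsum (r := D) (s := s) (by rwa [hDc])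
    (by rwa [hs]) hN (x := x) hx
  have hcpow : ∀ x : ℝ, 0 < x → (x : ℂ) ^ s
      = ((x ^ D : ℝ) : ℂ) * Complex.exp (τ * (Real.log x : ℝ) * Complex.I) := by
    intro x hx
    have hx0 : (x : ℂ) ≠ 0 := by exact_mod_cast hx.ne'
    rw [hsdef, Complex.cpow_add _ _ hx0, Complex.ofReal_cpow hx.le, Complex.cpow_def_of_ne_zero hx0
      (_ * _), ← Complex.ofReal_log hx.le]
    congr 2
    ring
  have hmain : Tendsto (fun x : ℝ => x ^ (-D) * (∑' i, min (ℓ i * x) 1)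
      - (1 / (1 - D) + (β / (1 - s) * Complex.exp (τ * (Real.log x : ℝ) * Complex.I)).re)) atTop
      (𝓝 0) := by
    refine squeeze_zero_norm' ?_ (tendsto_rpow_neg_atTop hD)
    filter_upwards [eventually_gt_atTop 0] with x hx
    have hxD : 0 < x ^ D := Real.rpow_pos_of_pos hx D
    have h1 := hmin x hx
    have e : ((x : ℂ) ^ (D : ℂ) / (1 - D) + β * ((x : ℂ) ^ s / (1 - s))).re = x ^ D *
        (1 / (1 - D) + (β / (1 - s) * Complex.exp (τ * (Real.log x : ℝ) * Complex.I)).re) := by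
      rw [hcpow x hx, ← Complex.ofReal_cpow hx.le,
        show ((x ^ D : ℝ) : ℂ) / (1 - D) + β * (((x ^ D : ℝ) : ℂ)
          * Complex.exp (τ * (Real.log x : ℝ) * Complex.I) / (1 - s))
          = ((x ^ D : ℝ) : ℂ) * (((1 / (1 - D) : ℝ) : ℂ)
            + β / (1 - s) * Complex.exp (τ * (Real.log x : ℝ) * Complex.I)) by push_cast; ring,
        Complex.re_ofReal_mul, Complex.add_re, Complex.ofReal_re]
    rw [e] at h1
    rw [Real.norm_eq_abs, Real.rpow_neg hx.le]
    rw [show (x ^ D)⁻¹ * (∑' i, min (ℓ i * x) 1) - (1 / (1 - D)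
      + (β / (1 - s) * Complex.exp (τ * (Real.log x : ℝ) * Complex.I)).re)
      = (x ^ D)⁻¹ * ((∑' i, min (ℓ i * x) 1) - x ^ D * (1 / (1 - D)
      + (β / (1 - s) * Complex.exp (τ * (Real.log x : ℝ) * Complex.I)).re)) by
        rw [mul_sub, inv_mul_cancel_left₀ hxD.ne'], abs_mul, abs_of_pos (inv_pos.mpr hxD)]
    exact mul_le_of_le_one_right (inv_pos.mpr hxD).le h1
  -- As |1 - s| ≥ 1 - D and |β| ≤ 1/2, the oscillation is at most half of the mean 1/(1 - D). The
  -- normalized sum thus stays between positive bounds, which pins the dimension to D.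
  have hosc : ∀ y : ℝ, |(β / (1 - s) * Complex.exp (τ * y * Complex.I)).re| ≤ 1 / 2 / (1 - D) := by
    intro y
    refine (Complex.abs_re_le_norm _).trans ?_
    rw [norm_mul, ← Complex.ofReal_mul, Complex.norm_exp_ofReal_mul_I, mul_one, norm_div,
      Complex.norm_real, Real.norm_eq_abs]
    refine div_le_div₀ (by norm_num) hβ2 (by linarith) ?_
    refine le_trans (le_of_eq ?_) (Complex.re_le_norm _)
    rw [Complex.sub_re, hs, Complex.one_re]
  have hD1' : 0 < 1 - D := by linarith
  have hq : 0 < 1 / (1 - D) := by positivity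
  have hq2 : 1 / 2 / (1 - D) = 1 / (1 - D) / 2 := by ring
  rw [hq2] at hosc
  refine ⟨ℓ, hpos, hsum, ⟨z, hz.ne', isLittleO_tsum_fract hpos hsum hD hD1 hs hzD hζ hN⟩,
    ⟨1 / (1 - D) / 4, by positivity, ?_⟩, ⟨1 / (1 - D) * 2, ?_⟩, fun M hM => ?_⟩
  · filter_upwards [hmain.eventually_const_lt (by linarith : -(1 / (1 - D) / 4) < 0)] with x hx
    have := (abs_le.mp (hosc (Real.log x))).1
    linarith
  · filter_upwards [hmain.eventually_lt_const (by linarith : 0 < 1 / (1 - D) / 2)] with x hx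
    have := (abs_le.mp (hosc (Real.log x))).2
    linarith
  · refine not_tendsto_re_mul_exp hτ (c := β / (1 - s))
      (div_ne_zero (by exact_mod_cast hβ) hs1) (M - 1 / (1 - D)) ?_
    have h1 := ((hM.sub hmain).sub_const (1 / (1 - D))).comp Real.tendsto_exp_atTop
    rw [sub_zero] at h1
    refine h1.congr fun v => ?_
    simp only [Function.comp_apply, Real.log_exp]
    ring

end Oscillation

/-! ### Geometry of open subsets of the line -/

section Geometry

/-- An endpoint belonging to Ω could be adjoined to the component, contradicting maximality. -/
lemma exists_eq_Ioo_of_mem_intervalsOf {Ω I : Set ℝ} (ho : IsOpen Ω) (hb : Bornology.IsBounded Ω)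
    (hI : I ∈ intervalsOf Ω) : ∃ a b, a < b ∧ I = Ioo a b ∧ a ∉ Ω ∧ b ∉ Ω := by
  obtain ⟨x, hx, rfl⟩ := hI
  set I := connectedComponentIn Ω x with hIdef
  have hxI : x ∈ I := mem_connectedComponentIn hx
  have hIo : IsOpen I := ho.connectedComponentIn
  have hIΩ : I ⊆ Ω := connectedComponentIn_subset Ω x
  have hIb := hb.subset hIΩ
  have hIc : I.OrdConnected := isPreconnected_connectedComponentIn.ordConnected
  have ha : ∀ y ∈ I, sInf I < y := by
    intro y hy
    obtain ⟨r, hr, hball⟩ := Metric.isOpen_iff.mp hIo y hy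
    have hz : y - r / 2 ∈ I := hball (by rw [Metric.mem_ball, Real.dist_eq, abs_lt]; constructor <;> linarith)
    exact (csInf_le hIb.bddBelow hz).trans_lt (by linarith)
  have hb' : ∀ y ∈ I, y < sSup I := by
    intro y hy
    obtain ⟨r, hr, hball⟩ := Metric.isOpen_iff.mp hIo y hy
    have hz : y + r / 2 ∈ I := hball (by rw [Metric.mem_ball, Real.dist_eq, abs_lt]; constructor <;> linarith)
    exact (by linarith : y < y + r / 2).trans_le (le_csSup hIb.bddAbove hz)
  have hIoo : I = Ioo (sInf I) (sSup I) := by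
    refine Subset.antisymm (fun y hy => ⟨ha y hy, hb' y hy⟩) fun y hy => ?_
    obtain ⟨u, hu, huy⟩ := exists_lt_of_csInf_lt ⟨x, hxI⟩ hy.1
    obtain ⟨v, hv, hvy⟩ := exists_lt_of_lt_csSup ⟨x, hxI⟩ hy.2
    exact hIc.out hu hv ⟨huy.le, hvy.le⟩
  have hsub : Ioo (sInf I) (sSup I) ⊆ Ω := hIoo ▸ hIΩ
  have hxIoo : x ∈ Ioo (sInf I) (sSup I) := hIoo ▸ hxI
  refine ⟨sInf I, sSup I, hxIoo.1.trans hxIoo.2, hIoo, fun h => ?_, fun h => ?_⟩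
  · have h1 : Ico (sInf I) (sSup I) ⊆ Ω := by
      rw [← Ioo_insert_left (hxIoo.1.trans hxIoo.2)]
      exact insert_subset h hsub
    have h2 := isPreconnected_Ico.subset_connectedComponentIn (Ioo_subset_Ico_self hxIoo) h1
    exact lt_irrefl _ (ha _ (h2 (left_mem_Ico.mpr (hxIoo.1.trans hxIoo.2))))
  · have h1 : Ioc (sInf I) (sSup I) ⊆ Ω := by
      rw [← Ioo_insert_right (hxIoo.1.trans hxIoo.2)]
      exact insert_subset h hsub
    have h2 := isPreconnected_Ioc.subset_connectedComponentIn (Ioo_subset_Ioc_self hxIoo) h1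
    exact lt_irrefl _ (hb' _ (h2 (right_mem_Ioc.mpr (hxIoo.1.trans hxIoo.2))))

lemma pairwiseDisjoint_intervalsOf (Ω : Set ℝ) : (intervalsOf Ω).PairwiseDisjoint id := by
  rintro _ ⟨x, hx, rfl⟩ _ ⟨y, hy, rfl⟩ hne
  rw [Function.onFun, id, id, Set.disjoint_left]
  intro z hzx hzy
  exact hne ((connectedComponentIn_eq hzx).trans (connectedComponentIn_eq hzy).symm)

lemma isOpen_of_mem_intervalsOf {Ω I : Set ℝ} (ho : IsOpen Ω) (hI : I ∈ intervalsOf Ω) :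
    IsOpen I := by
  obtain ⟨x, hx, rfl⟩ := hI
  exact ho.connectedComponentIn

lemma countable_intervalsOf {Ω : Set ℝ} (ho : IsOpen Ω) : (intervalsOf Ω).Countable := by
  refine (pairwiseDisjoint_intervalsOf Ω).countable_of_isOpen
    (fun I hI => isOpen_of_mem_intervalsOf ho hI) ?_
  rintro _ ⟨x, hx, rfl⟩
  exact ⟨x, mem_connectedComponentIn hx⟩

lemma iUnion_intervalsOf (Ω : Set ℝ) : ⋃ I : intervalsOf Ω, (I : Set ℝ) = Ω := by
  refine Subset.antisymm (iUnion_subset ?_) fun x hx => ?_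
  · rintro ⟨_, x, hx, rfl⟩
    exact connectedComponentIn_subset Ω x
  · exact mem_iUnion.mpr ⟨⟨_, x, hx, rfl⟩, mem_connectedComponentIn hx⟩

/-- Both endpoints are boundary points, and no boundary point lies inside the interval, so the
nearest one is an endpoint. -/
lemma infDist_frontier_lt_iff {Ω : Set ℝ} (ho : IsOpen Ω) {a b x : ℝ} (hab : Ioo a b ⊆ Ω)
    (ha : a ∉ Ω) (hb : b ∉ Ω) (hx : x ∈ Ioo a b) (ε : ℝ) :
    Metric.infDist x (frontier Ω) < ε ↔ x - a < ε ∨ b - x < ε := by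
  have hlt : a < b := hx.1.trans hx.2
  have hcl : Icc a b ⊆ closure Ω := by
    rw [← closure_Ioo hlt.ne]
    exact closure_mono hab
  have hfa : a ∈ frontier Ω := by
    rw [ho.frontier_eq]
    exact ⟨hcl (left_mem_Icc.mpr hlt.le), ha⟩
  have hfb : b ∈ frontier Ω := by
    rw [ho.frontier_eq]
    exact ⟨hcl (right_mem_Icc.mpr hlt.le), hb⟩
  rw [Metric.infDist_lt_iff ⟨a, hfa⟩]
  constructor
  · rintro ⟨y, hy, hxy⟩
    rw [ho.frontier_eq] at hy
    have hy' : ¬ (a < y ∧ y < b) := fun h => hy.2 (hab h)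
    rw [Real.dist_eq, abs_lt] at hxy
    by_cases h : a < y
    · right
      have : b ≤ y := not_lt.mp fun h' => hy' ⟨h, h'⟩
      linarith
    · left
      linarith
  · rintro (h | h)
    · exact ⟨a, hfa, by rwa [Real.dist_eq, abs_of_pos (sub_pos.mpr hx.1)]⟩
    · exact ⟨b, hfb, by rwa [Real.dist_eq, abs_sub_comm, abs_of_pos (sub_pos.mpr hx.2)]⟩

lemma volume_Ioo_diff_Icc {a b ε : ℝ} (hε : 0 < ε) :
    volume (Ioo a b \ Icc (a + ε) (b - ε)) = ENNReal.ofReal (min (b - a) (2 * ε)) := by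
  have hsub : Icc (a + ε) (b - ε) ⊆ Ioo a b := fun y hy => ⟨by linarith [hy.1], by linarith [hy.2]⟩
  rw [measure_sdiff hsub measurableSet_Icc.nullMeasurableSet (by simp), Real.volume_Ioo, Real.volume_Icc]
  rcases le_total (b - a) (2 * ε) with h | h
  · rw [min_eq_left h, ENNReal.ofReal_of_nonpos (p := b - ε - (a + ε)) (by linarith), tsub_zero]
  · rw [min_eq_right h, ← ENNReal.ofReal_sub _ (by linarith)]
    congr 1
    ring

/-! ### Tube volume and spectral count as sums over the lengths. -/

namespace FractalString

variable (L : FractalString)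

instance : Countable (intervalsOf L.carrier) := (countable_intervalsOf L.isOpen_carrier).to_subtype

/-- The lengths of the intervals of a fractal string. -/
noncomputable def length (I : intervalsOf L.carrier) : ℝ :=
  volume.real (I : Set ℝ)

lemma volume_eq_ofReal_length (I : intervalsOf L.carrier) :
    volume (I : Set ℝ) = ENNReal.ofReal (L.length I) := by
  refine (ENNReal.ofReal_toReal ?_).symm
  obtain ⟨a, b, -, h, -⟩ := exists_eq_Ioo_of_mem_intervalsOf L.isOpen_carrier L.isBounded_carrier I.2
  rw [h]
  simp

lemma length_pos (I : intervalsOf L.carrier) : 0 < L.length I := by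
  obtain ⟨a, b, hab, h, -⟩ :=
    exists_eq_Ioo_of_mem_intervalsOf L.isOpen_carrier L.isBounded_carrier I.2
  unfold length
  rw [h, Real.volume_real_Ioo_of_le hab.le]
  exact sub_pos.mpr hab

lemma volume_eq_tsum {s : Set ℝ} (hs : s ⊆ L.carrier) (hsm : MeasurableSet s) :
    volume s = ∑' I : intervalsOf L.carrier, volume (s ∩ I) := by
  conv_lhs => rw [← inter_eq_left.mpr hs, ← iUnion_intervalsOf L.carrier, inter_iUnion]
  refine measure_iUnion (fun I J hIJ => ?_) fun I =>
    hsm.inter (isOpen_of_mem_intervalsOf L.isOpen_carrier I.2).measurableSet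
  exact (pairwiseDisjoint_intervalsOf L.carrier I.2 J.2 (Subtype.coe_injective.ne hIJ)).mono
    inter_subset_right inter_subset_right

lemma volume_carrier_eq : volume L.carrier = ∑' I : intervalsOf L.carrier, volume (I : Set ℝ) := by
  rw [L.volume_eq_tsum Subset.rfl L.isOpen_carrier.measurableSet]
  refine tsum_congr fun I => ?_
  rw [inter_eq_right.mpr]
  obtain ⟨_, x, hx, rfl⟩ := I
  exact connectedComponentIn_subset _ x

lemma summable_length : Summable L.length :=
  ENNReal.summable_toReal (by
    rw [← L.volume_carrier_eq]
    exact L.isBounded_carrier.measure_lt_top.ne)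

lemma volume_real_carrier : volume.real L.carrier = ∑' I, L.length I := by
  rw [Measure.real, L.volume_carrier_eq, ENNReal.tsum_toReal_eq fun I => by
    rw [L.volume_eq_ofReal_length]; exact ENNReal.ofReal_ne_top]
  rfl

lemma volume_innerTube_inter {ε : ℝ} (hε : 0 < ε) (I : intervalsOf L.carrier) :
    volume (L.innerTube ε ∩ I) = ENNReal.ofReal (min (L.length I) (2 * ε)) := by
  obtain ⟨a, b, hab, h, ha, hb⟩ :=
    exists_eq_Ioo_of_mem_intervalsOf L.isOpen_carrier L.isBounded_carrier I.2
  have hsub : (I : Set ℝ) ⊆ L.carrier := by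
    obtain ⟨_, x, hx, rfl⟩ := I
    exact connectedComponentIn_subset _ x
  have hlen : L.length I = b - a := by
    unfold length
    rw [h, Real.volume_real_Ioo_of_le hab.le]
  rw [hlen, ← volume_Ioo_diff_Icc hε]
  congr 1
  rw [h] at hsub ⊢
  ext x
  simp only [innerTube, mem_inter_iff, mem_ofPred_eq, Set.mem_sdiff, mem_Icc, not_and_or, not_le]
  constructor
  · rintro ⟨⟨-, h1⟩, h2⟩
    refine ⟨h2, ?_⟩
    rcases (infDist_frontier_lt_iff L.isOpen_carrier hsub ha hb h2 ε).mp h1 with h3 | h3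
    · left; linarith
    · right; linarith
  · rintro ⟨h2, h1⟩
    refine ⟨⟨hsub h2, (infDist_frontier_lt_iff L.isOpen_carrier hsub ha hb h2 ε).mpr ?_⟩, h2⟩
    rcases h1 with h3 | h3
    · left; linarith
    · right; linarith

lemma tubeVolume_eq {ε : ℝ} (hε : 0 < ε) :
    L.tubeVolume ε = ENNReal.ofReal (2 * ε * ∑' I, min (L.length I * (2 * ε)⁻¹) 1) := by
  have hmeas : MeasurableSet (L.innerTube ε) :=
    L.isOpen_carrier.measurableSet.inter
      (measurableSet_lt (Metric.continuous_infDist_pt _).measurable measurable_const)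
  have h2 : 0 < 2 * ε := by linarith
  rw [tubeVolume, L.volume_eq_tsum (fun x hx => hx.1) hmeas, ← tsum_mul_left,
    ENNReal.ofReal_tsum_of_nonneg]
  · refine tsum_congr fun I => ?_
    rw [L.volume_innerTube_inter hε, mul_min_of_nonneg _ _ h2.le, mul_one, mul_left_comm,
      mul_inv_cancel₀ h2.ne', mul_one]
  · intro I
    have := L.length_pos I
    positivity
  · exact (summable_comp_of_abs_le_min (ψ := fun u => min u 1) L.length_pos L.summable_length
      (fun u hu => abs_min_one_le hu) (inv_pos.mpr h2)).mul_left _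

/-- Up to the constant 2^{1-d}, the quotient defining the contents is the normalized truncated sum
at x = 1/(2ε), so the contents are governed by x → ∞. -/
lemma tubeVolume_div {ε : ℝ} (hε : 0 < ε) (d : ℝ) :
    L.tubeVolume ε / ENNReal.ofReal (ε ^ (1 - d)) = ENNReal.ofReal
      (2 ^ (1 - d) * ((2 * ε)⁻¹ ^ (-d) * ∑' I, min (L.length I * (2 * ε)⁻¹) 1)) := by
  rw [L.tubeVolume_eq hε, ← ENNReal.ofReal_div_of_pos (Real.rpow_pos_of_pos hε _)]
  congr 1
  generalize (∑' I, min (L.length I * (2 * ε)⁻¹) 1) = A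
  have h2 : 0 < 2 * ε := by linarith
  rw [Real.inv_rpow h2.le, Real.rpow_neg h2.le, inv_inv, Real.mul_rpow (by norm_num) hε.le,
    Real.rpow_sub hε, Real.rpow_sub two_pos, Real.rpow_one, Real.rpow_one]
  have := Real.rpow_pos_of_pos hε d
  have := Real.rpow_pos_of_pos (two_pos : (0 : ℝ) < 2) d
  field_simp

lemma spectralCount_eq {x : ℝ} (hx : 0 < x) :
    (L.spectralCount x : ℝ) = ∑' I, (⌊L.length I * x⌋₊ : ℝ) := by
  have hfin : {I | 1 ≤ L.length I * x}.Finite := by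
    have := (L.summable_length.mul_right x).tendsto_cofinite_zero.eventually_lt_const one_pos
    simpa [Filter.eventually_cofinite] using this
  classical
  -- Presenting the pairs as the image of a finite set matters: `Set.ncard` would be 0 on an
  -- infinite set. Finiteness holds because only finitely many lengths satisfy ℓx ≥ 1.
  set T : Finset (Σ _ : intervalsOf L.carrier, ℕ) :=
    hfin.toFinset.sigma fun I => Finset.Icc 1 ⌊L.length I * x⌋₊ with hT
  have hset : {p : ℕ × Set ℝ | 1 ≤ p.1 ∧ p.2 ∈ intervalsOf L.carrier ∧
      (p.1 : ℝ) * (volume.real p.2)⁻¹ ≤ x}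
      = (fun q : Σ _ : intervalsOf L.carrier, ℕ => ((q.2, (q.1 : Set ℝ)) : ℕ × Set ℝ)) '' T := by
    have key : ∀ (n : ℕ) (I : intervalsOf L.carrier),
        (n : ℝ) * (volume.real (I : Set ℝ))⁻¹ ≤ x ↔ n ≤ ⌊L.length I * x⌋₊ := by
      intro n I
      have hl := L.length_pos I
      change (n : ℝ) * (L.length I)⁻¹ ≤ x ↔ _
      rw [Nat.le_floor_iff (mul_pos hl hx).le, mul_inv_le_iff₀ hl, mul_comm x]
    ext ⟨n, J⟩
    simp only [mem_ofPred_eq, mem_image, hT, Finset.mem_coe, Finset.mem_sigma, Finset.mem_Icc,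
      Finite.mem_toFinset, Prod.mk.injEq]
    constructor
    · rintro ⟨h1, h2, h3⟩
      have h4 := (key n ⟨J, h2⟩).mp h3
      refine ⟨⟨⟨J, h2⟩, n⟩, ⟨?_, h1, h4⟩, rfl, rfl⟩
      exact (Nat.one_le_floor_iff _).mp (h1.trans h4)
    · rintro ⟨⟨I, m⟩, ⟨h0, h1, h2⟩, rfl, rfl⟩
      exact ⟨h1, I.2, (key m I).mpr h2⟩
  have hinj : Function.Injective
      (fun q : Σ _ : intervalsOf L.carrier, ℕ => ((q.2, (q.1 : Set ℝ)) : ℕ × Set ℝ)) := by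
    rintro ⟨I, m⟩ ⟨J, n⟩ h
    simp only [Prod.mk.injEq] at h
    obtain ⟨rfl, h⟩ := h
    rw [Subtype.coe_injective h]
  rw [spectralCount, hset, ncard_image_of_injective _ hinj, ncard_coe_finset, hT, Finset.card_sigma,
    tsum_eq_sum (s := hfin.toFinset)]
  · simp
  · intro I hI
    rw [Finite.mem_toFinset, mem_ofPred_eq, not_le] at hI
    rw [Nat.floor_eq_zero.mpr hI, Nat.cast_zero]

lemma weylTerm_sub_spectralCount {x : ℝ} (hx : 0 < x) :
    L.weylTerm x - L.spectralCount x = ∑' I, Int.fract (L.length I * x) := by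
  have h1 := L.summable_length.mul_right x
  have h2 := summable_comp_of_abs_le_min L.length_pos L.summable_length
    (fun u hu => abs_fract_le_min hu) hx
  have e : ∀ I, (⌊L.length I * x⌋₊ : ℝ) = L.length I * x - Int.fract (L.length I * x) := fun I => by
    rw [natCast_floor_eq_intCast_floor (mul_pos (L.length_pos I) hx).le]
    exact (Int.self_sub_fract _).symm
  rw [L.spectralCount_eq hx, tsum_congr e, h1.tsum_sub h2, weylTerm, volume_real_carrier,
    tsum_mul_right]
  ring

lemma hasMonotonicSecondTerm_iff (D : ℝ) :
    L.HasMonotonicSecondTerm D ↔ ∃ C : ℝ, C ≠ 0 ∧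
      (fun x : ℝ => (∑' I, Int.fract (L.length I * x)) - C * x ^ D) =o[atTop] fun x : ℝ => x ^ D := by
  refine exists_congr fun C => and_congr_right fun _ => ?_
  rw [← isLittleO_neg_left]
  refine isLittleO_congr ?_ EventuallyEq.rfl
  filter_upwards [eventually_gt_atTop 0] with x hx
  rw [← L.weylTerm_sub_spectralCount hx]
  ring

lemma tendsto_inv_two_mul : Tendsto (fun ε : ℝ => (2 * ε)⁻¹) (𝓝[>] 0) atTop := by
  have := tendsto_inv_nhdsGT_zero (𝕜 := ℝ)
  refine (this.const_mul_atTop (by norm_num : (0 : ℝ) < 2⁻¹)).congr fun ε => ?_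
  rw [mul_inv]

lemma isMinkowskiMeasurable_of_tendsto {M : ℝ} (hM : 0 < M)
    (h : Tendsto (fun x : ℝ => x ^ (-L.dimension) * ∑' I, min (L.length I * x) 1) atTop (𝓝 M)) :
    L.IsMinkowskiMeasurable := by
  have h1 : Tendsto (fun ε : ℝ => L.tubeVolume ε / ENNReal.ofReal (ε ^ (1 - L.dimension))) (𝓝[>] 0)
      (𝓝 (ENNReal.ofReal (2 ^ (1 - L.dimension) * M))) := by
    refine (ENNReal.tendsto_ofReal ((h.comp tendsto_inv_two_mul).const_mul _)).congr' ?_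
    filter_upwards [self_mem_nhdsWithin] with ε hε
    rw [L.tubeVolume_div hε]
    rfl
  rw [IsMinkowskiMeasurable, upperContent, lowerContent, h1.limsup_eq, h1.liminf_eq]
  refine ⟨?_, rfl, ENNReal.ofReal_lt_top⟩
  rw [ENNReal.ofReal_pos]
  positivity

/-- The upper bound makes the content at D finite. For d < D the lower bound gains a factor x^{D-d},
so the content is infinite and D is the least admissible exponent. -/
lemma dimension_eq {D a b : ℝ} (hD : 0 ≤ D) (ha : 0 < a)
    (h1 : ∀ᶠ x : ℝ in atTop, a ≤ x ^ (-D) * ∑' I, min (L.length I * x) 1)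
    (h2 : ∀ᶠ x : ℝ in atTop, x ^ (-D) * ∑' I, min (L.length I * x) 1 ≤ b) :
    L.dimension = D := by
  have hup : L.upperContent D < ∞ := by
    refine lt_of_le_of_lt (limsup_le_of_le (a := ENNReal.ofReal (2 ^ (1 - D) * b)) ?_ ?_)
      ENNReal.ofReal_lt_top
    · isBoundedDefault
    · filter_upwards [self_mem_nhdsWithin, tendsto_inv_two_mul.eventually h2] with ε hε hb
      rw [L.tubeVolume_div hε]
      gcongr
  refine IsLeast.csInf_eq ⟨⟨hD, hup⟩, fun d hd => ?_⟩
  by_contra! hlt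
  refine hd.2.ne ?_
  have h3 : Tendsto (fun x : ℝ => x ^ (-d) * ∑' I, min (L.length I * x) 1) atTop atTop := by
    refine tendsto_atTop_mono' _ ?_ ((tendsto_rpow_atTop (sub_pos.mpr hlt)).atTop_mul_const ha)
    filter_upwards [h1, eventually_gt_atTop 0] with x hx hx0
    have e : x ^ (-d) = x ^ (D - d) * x ^ (-D) := by
      rw [← Real.rpow_add hx0]
      ring_nf
    rw [e, mul_assoc]
    gcongr
  have h4 : Tendsto (fun ε : ℝ => L.tubeVolume ε / ENNReal.ofReal (ε ^ (1 - d))) (𝓝[>] 0) (𝓝 ∞) := by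
    have h5 := (h3.comp tendsto_inv_two_mul).const_mul_atTop
      (Real.rpow_pos_of_pos (two_pos : (0 : ℝ) < 2) (1 - d))
    refine (ENNReal.tendsto_ofReal_atTop.comp h5).congr' ?_
    filter_upwards [self_mem_nhdsWithin] with ε hε
    rw [L.tubeVolume_div hε]
    rfl
  exact h4.limsup_eq

lemma exists_tendsto_of_isMinkowskiMeasurable (h : L.IsMinkowskiMeasurable) :
    ∃ M, Tendsto (fun x : ℝ => x ^ (-L.dimension) * ∑' I, min (L.length I * x) 1) atTop (𝓝 M) := by
  obtain ⟨-, h2, h3⟩ := h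
  have h4 : Tendsto (fun ε : ℝ => L.tubeVolume ε / ENNReal.ofReal (ε ^ (1 - L.dimension))) (𝓝[>] 0)
      (𝓝 (L.upperContent L.dimension)) := tendsto_of_liminf_eq_limsup h2 rfl
  have h5 : Tendsto (fun x : ℝ => 2⁻¹ * x⁻¹) atTop (𝓝[>] 0) := by
    refine tendsto_nhdsWithin_iff.mpr ⟨?_, ?_⟩
    · simpa using (tendsto_inv_atTop_zero (𝕜 := ℝ)).const_mul 2⁻¹
    · filter_upwards [eventually_gt_atTop 0] with x hx
      exact mul_pos (by norm_num) (inv_pos.mpr hx)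
  have h6 := ((ENNReal.tendsto_toReal h3.ne).comp (h4.comp h5)).const_mul
    ((2 : ℝ) ^ (1 - L.dimension))⁻¹
  refine ⟨_, h6.congr' ?_⟩
  filter_upwards [eventually_gt_atTop 0] with x hx
  have hx' : 0 < 2⁻¹ * x⁻¹ := mul_pos (by norm_num) (inv_pos.mpr hx)
  have hnn : 0 ≤ ∑' I, min (L.length I * x) 1 := tsum_nonneg fun I => by
    have := L.length_pos I
    positivity
  have h2pos := Real.rpow_pos_of_pos (two_pos : (0 : ℝ) < 2) (1 - L.dimension)
  simp only [Function.comp_apply]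
  rw [L.tubeVolume_div hx', mul_inv_cancel_left₀ (by norm_num : (2 : ℝ) ≠ 0), inv_inv,
    ENNReal.toReal_ofReal (by positivity), inv_mul_cancel_left₀ h2pos.ne']

end FractalString

/-- A summable sequence of positive numbers is the sequence of lengths of a fractal string. -/
theorem exists_fractalString {ℓ : ℕ → ℝ} (hpos : ∀ j, 0 < ℓ j) (hsum : Summable ℓ) :
    ∃ L : FractalString, ∀ φ : ℝ → ℝ, ∑' I, φ (L.length I) = ∑' j, φ (ℓ j) := by
  -- The intervals are laid end to end; the partial sums stay outside Ω and separate them, so each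
  -- interval is a component.
  set S : ℕ → ℝ := fun j => ∑ i ∈ Finset.range j, ℓ i with hS
  have hS1 : ∀ j, S (j + 1) = S j + ℓ j := fun j => Finset.sum_range_succ ℓ j
  have hmono : StrictMono S := strictMono_nat_of_lt_succ fun j => by
    rw [hS1]; exact lt_add_of_pos_right _ (hpos j)
  set J : ℕ → Set ℝ := fun j => Ioo (S j) (S (j + 1)) with hJ
  set Ω : Set ℝ := ⋃ j, J j with hΩ
  have hnot : ∀ k, S k ∉ Ω := by
    intro k hk
    obtain ⟨j, hj⟩ := mem_iUnion.mp hk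
    have h1 := hmono.lt_iff_lt.mp hj.1
    have h2 := hmono.lt_iff_lt.mp hj.2
    omega
  have hcomp : ∀ j, ∀ x ∈ J j, connectedComponentIn Ω x = J j := by
    intro j x hx
    have hxΩ : x ∈ Ω := mem_iUnion.mpr ⟨j, hx⟩
    refine Subset.antisymm (fun y hy => ?_)
      (isPreconnected_Ioo.subset_connectedComponentIn hx (subset_iUnion J j))
    have hoc : (connectedComponentIn Ω x).OrdConnected :=
      isPreconnected_connectedComponentIn.ordConnected
    have hxc := mem_connectedComponentIn hxΩ
    have hsub := connectedComponentIn_subset Ω x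
    refine ⟨not_le.mp fun h => ?_, not_le.mp fun h => ?_⟩
    · exact hnot j (hsub (hoc.out hy hxc ⟨h, hx.1.le⟩))
    · exact hnot (j + 1) (hsub (hoc.out hxc hy ⟨hx.2.le, h⟩))
  have hint : intervalsOf Ω = range J := by
    ext I
    constructor
    · rintro ⟨x, hx, rfl⟩
      obtain ⟨j, hj⟩ := mem_iUnion.mp hx
      exact ⟨j, (hcomp j x hj).symm⟩
    · rintro ⟨j, rfl⟩
      obtain ⟨x, hx⟩ := nonempty_Ioo.mpr (hmono (Nat.lt_succ_self j))
      exact ⟨x, mem_iUnion.mpr ⟨j, hx⟩, (hcomp j x hx).symm⟩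
  have hinj : Function.Injective J := by
    intro i j hij
    have := congrArg sInf hij
    simp only [hJ] at this
    rw [csInf_Ioo (hmono (Nat.lt_succ_self i)), csInf_Ioo (hmono (Nat.lt_succ_self j))] at this
    exact hmono.injective this
  have hbdd : Bornology.IsBounded Ω := by
    refine (Metric.isBounded_Icc 0 (∑' i, ℓ i)).subset (iUnion_subset fun j x hx => ⟨?_, ?_⟩)
    · exact (Finset.sum_nonneg fun i _ => (hpos i).le).trans hx.1.le
    · exact hx.2.le.trans (hsum.sum_le_tsum _ fun i _ => (hpos i).le)
  refine ⟨⟨Ω, isOpen_iUnion fun j => isOpen_Ioo, hbdd, hint ▸ infinite_range_of_injective hinj⟩,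
    fun φ => ?_⟩
  have h1 := tsum_congr_set_coe (fun I : Set ℝ => φ (volume.real I)) hint
  refine h1.trans ((tsum_range (fun I : Set ℝ => φ (volume.real I)) hinj).trans ?_)
  refine tsum_congr fun j => ?_
  simp only [hJ]
  rw [Real.volume_real_Ioo_of_le (hmono (Nat.lt_succ_self j)).le, hS1, add_sub_cancel_left]

end Geometry

/-! ### The inverse spectral problem and the zeros of the zeta function -/

/-- The inverse spectral problem in dimension `D` is true exactly when the zeta function has no zero
on the line `Re s = D`. -/
theorem inverseSpectralProblem_iff {D : ℝ} (hD : 0 < D) (hD1 : D < 1) :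
    InverseSpectralProblem D ↔ ∀ t : ℝ, riemannZeta (D + t * Complex.I) ≠ 0 := by
  constructor
  · intro h t ht
    obtain ⟨ℓ, hpos, hsum, ⟨C, hC, hfr⟩, ⟨a, ha, hlow⟩, ⟨b, hup⟩, hosc⟩ :=
      exists_lengths_of_riemannZeta_eq_zero hD hD1 ht
    obtain ⟨L, hL⟩ := exists_fractalString hpos hsum
    have hmin : ∀ x : ℝ, ∑' I, min (L.length I * x) 1 = ∑' j, min (ℓ j * x) 1 := fun x =>
      hL fun l => min (l * x) 1
    have hfract : ∀ x : ℝ, ∑' I, Int.fract (L.length I * x) = ∑' j, Int.fract (ℓ j * x) := fun x =>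
      hL fun l => Int.fract (l * x)
    have hdim : L.dimension = D := L.dimension_eq hD.le ha (by simpa only [hmin]) (by simpa only [hmin])
    have hmm := h L hdim ((L.hasMonotonicSecondTerm_iff D).mpr ⟨C, hC, by simpa only [hfract]⟩)
    obtain ⟨M, hM⟩ := L.exists_tendsto_of_isMinkowskiMeasurable hmm
    rw [hdim] at hM
    exact hosc M (by simpa only [hmin] using hM)
  · intro hζ L hdim hL
    obtain ⟨C, hC, hO⟩ := (L.hasMonotonicSecondTerm_iff D).mp hL
    obtain ⟨M, hM, hlim⟩ :=
      exists_tendsto_tsum_min L.length_pos L.summable_length hD hD1 hζ hC hO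
    exact L.isMinkowskiMeasurable_of_tendsto hM (hdim ▸ hlim)

/-- A nontrivial zero of the zeta function lies in the open critical strip. -/
theorem re_mem_Ioo_of_riemannZeta_eq_zero {s : ℂ} (hs : riemannZeta s = 0)
    (htriv : ¬ ∃ n : ℕ, s = -2 * (n + 1)) : s.re ∈ Ioo (0 : ℝ) 1 := by
  have hlt : s.re < 1 := not_le.mp fun h => riemannZeta_ne_zero_of_one_le_re h hs
  refine ⟨not_le.mp fun h => ?_, hlt⟩
  have h0 : s ≠ 0 := by
    rintro rfl
    rw [riemannZeta_zero] at hs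
    norm_num at hs
  have hne : ∀ n : ℕ, 1 - s ≠ -n := by
    intro n hn
    have := congrArg Complex.re hn
    simp at this
    have : (0 : ℝ) ≤ n := n.cast_nonneg
    linarith
  have hre : 1 ≤ (1 - s).re := by simpa using h
  -- If Re s ≤ 0, every factor of the functional equation other than the cosine is nonzero, so the
  -- cosine vanishes. This forces s = -2k with k ≥ 1, a trivial zero.
  have hfe := riemannZeta_one_sub hne (by simpa using h0)
  rw [sub_sub_cancel, hs] at hfe
  have hπ : (2 * (Real.pi : ℂ)) ≠ 0 := by
    simp [Real.pi_ne_zero]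
  have hcos : Complex.cos (Real.pi * (1 - s) / 2) = 0 := by
    have h1 := Complex.Gamma_ne_zero hne
    have h2 := riemannZeta_ne_zero_of_one_le_re hre
    have h3 : (2 * (Real.pi : ℂ)) ^ (-(1 - s)) ≠ 0 := by
      rw [Ne, Complex.cpow_eq_zero_iff]
      exact fun h => hπ h.1
    by_contra h4
    exact (mul_ne_zero (mul_ne_zero (mul_ne_zero (mul_ne_zero two_ne_zero h3) h1) h4) h2) hfe.symm
  rw [Complex.cos_eq_zero_iff] at hcos
  obtain ⟨k, hk⟩ := hcos
  have hs' : s = -2 * (k : ℂ) := by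
    have : (Real.pi : ℂ) ≠ 0 := by exact_mod_cast Real.pi_ne_zero
    field_simp at hk
    linear_combination -hk
  have hk0 : 0 < k := by
    have h1 : s.re = -2 * k := by
      rw [hs']
      simp
    have h2 : k ≠ 0 := by
      rintro rfl
      exact h0 (by simp [hs'])
    have h3 : (0 : ℝ) ≤ k := by linarith
    have h4 : 0 ≤ k := by exact_mod_cast h3
    omega
  refine htriv ⟨(k - 1).toNat, ?_⟩
  have h5 : (((k - 1).toNat : ℤ) : ℂ) = ((k - 1 : ℤ) : ℂ) := by
    rw [Int.toNat_of_nonneg (by omega)]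
  push_cast at h5
  rw [h5, hs']
  ring

theorem theorem6p4 :
    ¬ InverseSpectralProblem (1 / 2) ∧
      (RiemannHypothesis ↔
        {D : ℝ | D ∈ Set.Ioo (0 : ℝ) 1 ∧ ¬ InverseSpectralProblem D} = {1 / 2}) := by
  have hhalf : ¬ InverseSpectralProblem (1 / 2) := by
    obtain ⟨t, ht⟩ := exists_riemannZeta_eq_zero_on_critical_line
    rw [inverseSpectralProblem_iff (by norm_num) (by norm_num)]
    refine fun h => h t ?_
    push_cast
    exact ht
  refine ⟨hhalf, fun hRH => ?_, fun hset s hs htriv hs1 => ?_⟩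
  · refine Subset.antisymm ?_ ?_
    · rintro D ⟨hD, hISP⟩
      rw [inverseSpectralProblem_iff hD.1 hD.2] at hISP
      push Not at hISP
      obtain ⟨t, ht⟩ := hISP
      have hre : (D + t * Complex.I : ℂ).re = D := by simp
      have := hRH _ ht (by
        rintro ⟨n, hn⟩
        have h1 := congrArg Complex.re hn
        rw [hre] at h1
        simp at h1
        have : (0 : ℝ) ≤ n := n.cast_nonneg
        linarith [hD.1]) (by
        intro h
        have h1 := congrArg Complex.re h
        rw [hre, Complex.one_re] at h1
        linarith [hD.2])
      rwa [hre] at this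
    · rintro _ rfl
      exact ⟨by norm_num, hhalf⟩
  -- A nontrivial zero makes the inverse problem fail in dimension Re s, which lies in (0, 1), so Re
  -- s belongs to a set assumed to be {1/2}.
  · have hstrip := re_mem_Ioo_of_riemannZeta_eq_zero hs htriv
    have hmem : s.re ∈ {D : ℝ | D ∈ Set.Ioo (0 : ℝ) 1 ∧ ¬ InverseSpectralProblem D} := by
      refine ⟨hstrip, ?_⟩
      rw [inverseSpectralProblem_iff hstrip.1 hstrip.2]
      refine fun h => h s.im ?_
      rwa [Complex.re_add_im]
    rw [hset] at hmem
    exact hmem
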